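/- **Conventions.** All vector spaces are over $\mathbb{Q}$, carry three gradings $\deg_{\mathrm a},\deg_{\mathrm q},\deg_{\mathrm t}$ and a descending filtration $F$; $\deg_{\mathrm t}$ and the filtration index may be half-integers. $\mathbf a,\mathbf q,\mathbf t,\mathbf s$ are the corresponding shift functors ($\mathbf a$ raises $\deg_{\mathrm a}$ by one, etc., and $F^i(\mathbf sV)=F^{i-1}V$). Put $$\mathbf a_q=\mathbf a\mathbf q^2,\quad \mathbf s_q=\mathbf s\mathbf q^2,\quad \mathbf t_a=\mathbf t\mathbf a,\quad \mathbf u=(\mathbf t\mathbf s)^{1/2},\quad \mathbf t_{\mathrm{tot}}=\mathbf t_a\mathbf s_q .$$ Polynomial variables have $\deg_{\mathrm q}=2$. $\mathbb{Q}$ and $\mathbb{Q}[z]$ stand in degrees $\deg_{\mathrm a}=\deg_{\mathrm t}=0$ and have the trivial filtration $F^s=$ everything for $s\le 0$ and $F^s=0$ for $s>0$; $1$ has $\deg_{\mathrm q}=0$. **Complexes of braid words.** For strands $i,i+1$ of $n$ strands with variables $\mathbf x$ (source) and $\mathbf y$ (target), let $B_i=\mathbb{Q}[\mathbf x,\mathbf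 y]/(y_i+y_{i+1}-x_i-x_{i+1},\;y_iy_{i+1}-x_ix_{i+1},\;y_j-x_j\ (j\ne i,i+1))$. The filtered bimodules $B_i^{\bullet}$ and $B_i^{\circ}$ ("black" and "green" blob) are $B_i$ with $F^0=B_i$, $F^2=0$, and with $F^1$ generated by $(y_{i+1}-y_i)-(x_{i+1}-x_i)$, respectively by $(y_{i+1}-y_i)+(x_{i+1}-x_i)$. The identity braid is assigned the diagonal bimodule $I=\mathbb{Q}[\mathbf x,\mathbf y]/(y_j-x_j)$ with the trivial filtration, and $$\langle\sigma_i\rangle=\mathbf u\,\mathbf a_q\bigl[\,I\xrightarrow{\ \chi_+\ }\mathbf t_a^{-1}\mathbf s_q^{-1}B_i^{\circ}\,\bigr],\qquad \langle\sigma_i^{-1}\rangle=(\mathbf u\,\mathbf a_q)^{-1}\bigl[\,\mathbf t_aB_i^{\bullet}\xrightarrow{\ \chi_-\ }I\,\bigr],$$ where $\chi_-$ is the quotient map and $\chi_+(1)=(y_{i+1}-y_i)+(x_{i+1}-x_i)$. A product of elementary braids is assigned the tensor product of their complexes over the intermediate variables, with the tensor product filtration. For the circular closure $L_\beta$ of an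 $n$-strand braid word $\beta$, set $$H^{(3)}(L_\beta)=H_{\mathrm{out}}\bigl(H_{\mathrm{in}}\bigl(\mathbf u^{\,n}\,\langle\beta\rangle\overset{\mathrm L}{\otimes}_{\mathbb{Q}[\mathbf x,\mathbf y]}I\bigr)\bigr).$$ Here the derived tensor product is taken with the Koszul resolution of $I$ (tensor product over $j$ of $\mathbf a_q\,\mathbb{Q}[\mathbf x,\mathbf y]\xrightarrow{\,y_j-x_j\,}\mathbb{Q}[\mathbf x,\mathbf y]$); $H_{\mathrm{in}}$ is the homology of the Koszul differential (that is, Hochschild homology), $H_{\mathrm{out}}$ is the homology of the differential that the differential of $\langle\beta\rangle$ induces on $H_{\mathrm{in}}$, and both carry the induced gradings and filtration. Let $\bigcirc$ be the closure of the one-strand identity braid, and let $\sigma=\sigma_1$ on two strands. **Theorem.** As filtered triply graded $\mathbb{Q}$-vector spaces, for every $n\ge 0$, $$H^{(3)}(L_{\sigma^{-(2n+1)}})\;\cong\;(\mathbf u\,\mathbf a_q)^{-2n}\,H^{(3)}(\bigcirc)\otimes\Bigl(\mathbb{Q}\;\oplus\;\mathbf t_a\bigoplus_{k=0}^{n-1}\mathbf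 t_{\mathrm{tot}}^{\,2k+1}\bigl(\mathbf s_q\mathbb{Q}\oplus\mathbf a_q^{-1}\mathbb{Q}\bigr)\Bigr),$$ and for every $n\ge 1$, $$H^{(3)}(L_{\sigma^{-2n}})\;\cong\;(\mathbf u\,\mathbf a_q)^{-1}H^{(3)}(L_{\sigma^{-2n+1}})\;\oplus\;\mathbf u^{2n-1}\mathbf a_q^{-1}\mathbf t_a\,H^{(3)}(\bigcirc)\otimes\bigl(\mathbf a_q\mathbf s_q\mathbb{Q}[z]\oplus\mathbf s_q\mathbb{Q}[z]\oplus\mathbb{Q}\bigr).$$ -/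

import Mathlib

open scoped TensorProduct

noncomputable section

/-! ### Filtered triply graded vector spaces -/

/-- A `ℚ`-vector space with its subspaces of elements of degree `(deg_a, deg_q, deg_t)` and its
descending filtration `fil`.  The `t`-degree and the filtration index may be half-integers. -/
structure FTVect where
  carrier : Type
  [acg : AddCommGroup carrier]
  [mod : Module ℚ carrier]
  gr : ℤ → ℤ → ℚ → Submodule ℚ carrier
  fil : ℚ → Submodule ℚ carrier

namespace FTVect

attribute [instance] FTVect.acg FTVect.mod

/-- Isomorphism of filtered triply graded vector spaces: a linear isomorphism that identifies the
homogeneous pieces and the filtrations. -/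
def Isomorphic (V W : FTVect) : Prop :=
  ∃ e : V.carrier ≃ₗ[ℚ] W.carrier,
    (∀ a q t, (V.gr a q t).map e.toLinearMap = W.gr a q t) ∧
      ∀ s, (V.fil s).map e.toLinearMap = W.fil s

/-- Degree shifts: the tuple `(a, q, t, s)` stands for `𝐚^a 𝐪^q 𝐭^t 𝐬^s`. -/
abbrev Shift : Type := ℤ × ℤ × ℚ × ℚ

/-- The shift functor `𝐚^a 𝐪^q 𝐭^t 𝐬^s`; in particular `F^i (𝐬 V) = F^(i-1) V`. -/
def shift (c : Shift) (V : FTVect) : FTVect where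
  carrier := V.carrier
  gr a q t := V.gr (a - c.1) (q - c.2.1) (t - c.2.2.1)
  fil s := V.fil (s - c.2.2.2)

/-- The direct sum of two filtered triply graded vector spaces. -/
def sum (V W : FTVect) : FTVect where
  carrier := V.carrier × W.carrier
  gr a q t := (V.gr a q t).prod (W.gr a q t)
  fil s := (V.fil s).prod (W.fil s)

/-- The direct sum of finitely many filtered triply graded vector spaces. -/
def finSum {n : ℕ} (V : Fin n → FTVect) : FTVect where
  carrier := (k : Fin n) → (V k).carrier
  gr a q t := Submodule.pi Set.univ fun k => (V k).gr a q t
  fil s := Submodule.pi Set.univ fun k => (V k).fil s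

/-- The tensor product over `ℚ`. -/
def tensor (V W : FTVect) : FTVect where
  carrier := V.carrier ⊗[ℚ] W.carrier
  gr a q t := Submodule.span ℚ
    {x | ∃ a' q' t', ∃ v ∈ V.gr a' q' t', ∃ w ∈ W.gr (a - a') (q - q') (t - t'), v ⊗ₜ[ℚ] w = x}
  fil s := Submodule.span ℚ
    {x | ∃ s', ∃ v ∈ V.fil s', ∃ w ∈ W.fil (s - s'), v ⊗ₜ[ℚ] w = x}

/-- The trivial filtration: `F^s = V` for `s ≤ 0` and `F^s = 0` for `s > 0`. -/
def trivialFil (V : Type) [AddCommGroup V] [Module ℚ V] (s : ℚ) : Submodule ℚ V :=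
  if s ≤ 0 then ⊤ else ⊥

/-- The polynomials of `q`-degree `q`, every variable having `q`-degree 2. -/
def polyGr (σ : Type) (q : ℤ) : Submodule ℚ (MvPolynomial σ ℚ) :=
  MvPolynomial.weightedHomogeneousSubmodule ℚ (fun _ => (2 : ℤ)) q

/-- A polynomial ring in `a`-degree 0 and `t`-degree 0, with the trivial filtration. -/
def poly (σ : Type) : FTVect where
  carrier := MvPolynomial σ ℚ
  gr a q t := if a = 0 ∧ t = 0 then polyGr σ q else ⊥
  fil := trivialFil _

/-- The one-dimensional space `ℚ` in degree 0. -/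
def rat : FTVect where
  carrier := ℚ
  gr a q t := if a = 0 ∧ q = 0 ∧ t = 0 then ⊤ else ⊥
  fil := trivialFil _

/-- `ℚ[z]`, with `z` of `q`-degree 2. -/
def ratZ : FTVect := poly Unit

/-- The subspace of `ker d / im d` of classes that are represented by cycles in `S`. -/
def inducedSub {V : Type} [AddCommGroup V] [Module ℚ V] (d : V →ₗ[ℚ] V) (S : Submodule ℚ V) :
    Submodule ℚ (LinearMap.ker d ⧸ (LinearMap.range d).submoduleOf (LinearMap.ker d)) :=
  (S.submoduleOf (LinearMap.ker d)).map (Submodule.mkQ _)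

/-- The homology `ker d / im d` of a differential, with the induced gradings and filtration. -/
def homology (V : FTVect) (d : V.carrier →ₗ[ℚ] V.carrier) : FTVect where
  carrier := LinearMap.ker d ⧸ (LinearMap.range d).submoduleOf (LinearMap.ker d)
  gr a q t := inducedSub d (V.gr a q t)
  fil s := inducedSub d (V.fil s)

/-- The endomorphism that an endomorphism commuting with `d` induces on the homology of `d`. -/
def homologyMap (V : FTVect) (d f : V.carrier →ₗ[ℚ] V.carrier) (h : ∀ v, d (f v) = f (d v)) :
    (V.homology d).carrier →ₗ[ℚ] (V.homology d).carrier :=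
  Submodule.mapQ _ _
    (f.restrict (p := LinearMap.ker d) (q := LinearMap.ker d) fun v hv => by
      rw [LinearMap.mem_ker] at hv ⊢
      rw [h, hv, map_zero])
    (by
      rintro ⟨v, hv⟩ ⟨w, hw⟩
      exact ⟨f w, by rw [h, hw]; rfl⟩)

end FTVect

open FTVect

/-- `𝐚𝐪²` -/
def shA : Shift := (1, 2, 0, 0)
/-- `𝐬𝐪²` -/
def shS : Shift := (0, 2, 0, 1)
/-- `𝐭𝐚` -/
def shT : Shift := (1, 0, 1, 0)
/-- `(𝐭𝐬)^(1/2)` -/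
def shTS : Shift := (0, 0, 1 / 2, 1 / 2)
/-- `𝐭𝐚 · 𝐬𝐪²` -/
def shTot : Shift := shT + shS

/-! ### Complexes of filtered graded bimodules -/

/-- The polynomial algebra assigned to `k + 1` points. -/
abbrev PolyAlg (k : ℕ) : Type := MvPolynomial (Fin (k + 1)) ℚ

/-- A complex of filtered graded bimodules over `PolyAlg k`, written as its total space: the
left action is the module structure, `right` is the right action, and the differential `d`, of
degree `-1` with respect to both `deg_a` and `deg_t`, is filtered and preserves the `q`-degree. -/
structure BimodComplex (k : ℕ) extends FTVect where
  [lmod : Module (PolyAlg k) carrier]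
  [tower : IsScalarTower ℚ (PolyAlg k) carrier]
  right : PolyAlg k →+* Module.End (PolyAlg k) carrier
  gr_left : ∀ a q t q', ∀ p ∈ polyGr (Fin (k + 1)) q', ∀ m ∈ gr a q t, p • m ∈ gr a (q' + q) t
  gr_right : ∀ a q t q', ∀ p ∈ polyGr (Fin (k + 1)) q', ∀ m ∈ gr a q t, right p m ∈ gr a (q' + q) t
  fil_anti : ∀ s s', s ≤ s' → fil s' ≤ fil s
  fil_left : ∀ s, ∀ p : PolyAlg k, ∀ m ∈ fil s, p • m ∈ fil s
  fil_right : ∀ s, ∀ p : PolyAlg k, ∀ m ∈ fil s, right p m ∈ fil s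
  d : carrier →ₗ[PolyAlg k] carrier
  d_right : ∀ p m, d (right p m) = right p (d m)
  d_d : ∀ m, d (d m) = 0
  d_gr : ∀ a q t, ∀ m ∈ gr a q t, d m ∈ gr (a - 1) q (t - 1)
  d_fil : ∀ s, ∀ m ∈ fil s, d m ∈ fil s

attribute [instance] BimodComplex.lmod BimodComplex.tower

/-- The shift functors on complexes of bimodules. -/
def BimodComplex.shift {k : ℕ} (c : Shift) (X : BimodComplex k) : BimodComplex k where
  toFTVect := X.toFTVect.shift c
  lmod := X.lmod
  tower := X.tower
  right := X.right
  gr_left a q t q' p hp m hm := by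
    have := X.gr_left _ _ _ _ p hp m hm
    rwa [← add_sub_assoc] at this
  gr_right a q t q' p hp m hm := by
    have := X.gr_right _ _ _ _ p hp m hm
    rwa [← add_sub_assoc] at this
  fil_anti s s' h := X.fil_anti _ _ (sub_le_sub_right h _)
  fil_left s := X.fil_left _
  fil_right s := X.fil_right _
  d := X.d
  d_right := X.d_right
  d_d := X.d_d
  d_gr a q t m hm := by
    have := X.d_gr _ _ _ m hm
    rwa [sub_right_comm, sub_right_comm (t : ℚ)] at this
  d_fil s m hm := X.d_fil _ m hm

/-- The differential `(x, y) ↦ (-d x, f x + d y)`. -/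
def BimodComplex.bracketD {k : ℕ} (X Y : BimodComplex k)
    (f : X.carrier →ₗ[PolyAlg k] Y.carrier) :
    (X.carrier × Y.carrier) →ₗ[PolyAlg k] (X.carrier × Y.carrier) :=
  LinearMap.prod (-(X.d ∘ₗ LinearMap.fst _ _ _)) (f.coprod Y.d)

/-- The total complex of `[X → Y]` for a map `f` of filtered graded bimodules that commutes with
the differentials and has degree `-1` with respect to both `deg_a` and `deg_t`. -/
def BimodComplex.bracket {k : ℕ} (X Y : BimodComplex k) (f : X.carrier →ₗ[PolyAlg k] Y.carrier)
    (f_right : ∀ p m, f (X.right p m) = Y.right p (f m))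
    (f_d : ∀ m, f (X.d m) = Y.d (f m))
    (f_gr : ∀ a q t, ∀ m ∈ X.gr a q t, f m ∈ Y.gr (a - 1) q (t - 1))
    (f_fil : ∀ s, ∀ m ∈ X.fil s, f m ∈ Y.fil s) : BimodComplex k where
  toFTVect := X.toFTVect.sum Y.toFTVect
  lmod := inferInstanceAs (Module (PolyAlg k) (X.carrier × Y.carrier))
  tower := inferInstanceAs (IsScalarTower ℚ (PolyAlg k) (X.carrier × Y.carrier))
  right :=
    { toFun := fun p => LinearMap.prodMap (X.right p) (Y.right p)
      map_one' := by rw [map_one, map_one]; rfl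
      map_mul' := fun p q => by rw [map_mul, map_mul]; rfl
      map_zero' := by rw [map_zero, map_zero]; rfl
      map_add' := fun p q => by rw [map_add, map_add]; rfl }
  gr_left a q t q' p hp m hm := ⟨X.gr_left _ _ _ _ p hp _ hm.1, Y.gr_left _ _ _ _ p hp _ hm.2⟩
  gr_right a q t q' p hp m hm := ⟨X.gr_right _ _ _ _ p hp _ hm.1, Y.gr_right _ _ _ _ p hp _ hm.2⟩
  fil_anti s s' h := Submodule.prod_mono (X.fil_anti _ _ h) (Y.fil_anti _ _ h)
  fil_left s p m hm := ⟨X.fil_left _ p _ hm.1, Y.fil_left _ p _ hm.2⟩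
  fil_right s p m hm := ⟨X.fil_right _ p _ hm.1, Y.fil_right _ p _ hm.2⟩
  d := X.bracketD Y f
  d_right p m := by
    refine Prod.ext ?_ ?_
    · change -X.d (X.right p m.1) = X.right p (-X.d m.1)
      rw [X.d_right, map_neg]
    · change f (X.right p m.1) + Y.d (Y.right p m.2) = Y.right p (f m.1 + Y.d m.2)
      rw [f_right, Y.d_right, map_add]
  d_d m := by
    refine Prod.ext ?_ ?_
    · change -X.d (-X.d m.1) = 0
      rw [map_neg, X.d_d, neg_zero, neg_zero]
    · change f (-X.d m.1) + Y.d (f m.1 + Y.d m.2) = 0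
      rw [map_neg, f_d, map_add, Y.d_d, add_zero, neg_add_cancel]
  d_gr a q t m hm := ⟨Submodule.neg_mem _ (X.d_gr _ _ _ _ hm.1),
    Submodule.add_mem _ (f_gr _ _ _ _ hm.1) (Y.d_gr _ _ _ _ hm.2)⟩
  d_fil s m hm := ⟨Submodule.neg_mem _ (X.d_fil _ _ hm.1),
    Submodule.add_mem _ (f_fil _ _ hm.1) (Y.d_fil _ _ hm.2)⟩

lemma polyGr_mul {σ : Type} {q q' : ℤ} {p p' : MvPolynomial σ ℚ} (hp : p ∈ polyGr σ q)
    (hp' : p' ∈ polyGr σ q') : p * p' ∈ polyGr σ (q + q') :=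
  MvPolynomial.IsWeightedHomogeneous.mul hp hp'

lemma polyGr_rename {σ τ : Type} (f : σ → τ) {q : ℤ} {p : MvPolynomial σ ℚ}
    (hp : p ∈ polyGr σ q) : MvPolynomial.rename f p ∈ polyGr τ q := by
  intro c hc
  obtain ⟨u, rfl, hu⟩ := MvPolynomial.coeff_rename_ne_zero f p c hc
  rw [← hp hu]
  exact Finsupp.linearCombination_mapDomain ℕ f u

lemma poly_gr_mul {σ : Type} {a q q' : ℤ} {t : ℚ} {p m : MvPolynomial σ ℚ}
    (hp : p ∈ polyGr σ q') (hm : m ∈ (poly σ).gr a q t) : p * m ∈ (poly σ).gr a (q' + q) t := by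
  unfold poly at hm ⊢
  dsimp only at hm ⊢
  split_ifs at hm ⊢ with h
  · exact polyGr_mul hp hm
  · rw [Submodule.mem_bot] at hm ⊢
    rw [hm, mul_zero]

lemma trivialFil_mem_iff {V : Type} [AddCommGroup V] [Module ℚ V] {s : ℚ} {v : V} :
    v ∈ trivialFil V s ↔ (0 < s → v = 0) := by
  unfold trivialFil
  split_ifs with h
  · simp [not_lt.mpr h]
  · simp [not_le.mp h]

/-- The identity braid: the diagonal bimodule `ℚ[x, y] / (y_j - x_j)`, that is, the polynomial
algebra acting on itself from both sides. -/
def BimodComplex.diag (k : ℕ) : BimodComplex k where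
  toFTVect := poly (Fin (k + 1))
  lmod := inferInstanceAs (Module (PolyAlg k) (PolyAlg k))
  tower := inferInstanceAs (IsScalarTower ℚ (PolyAlg k) (PolyAlg k))
  right := (Algebra.lmul (PolyAlg k) (PolyAlg k)).toRingHom
  gr_left _ _ _ _ _ hp _ hm := poly_gr_mul hp hm
  gr_right _ _ _ _ _ hp _ hm := poly_gr_mul hp hm
  fil_anti s s' h m hm := trivialFil_mem_iff.mpr fun hs =>
    trivialFil_mem_iff.mp hm (hs.trans_le h)
  fil_left s p m hm := trivialFil_mem_iff.mpr fun hs => by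
    rw [trivialFil_mem_iff.mp hm hs]
    exact mul_zero p
  fil_right s p m hm := trivialFil_mem_iff.mpr fun hs => by
    rw [trivialFil_mem_iff.mp hm hs, map_zero]
  d := 0
  d_right _ _ := (map_zero _).symm
  d_d _ := rfl
  d_gr _ _ _ _ _ := Submodule.zero_mem _
  d_fil _ _ _ := Submodule.zero_mem _

/-! ### The blob bimodule -/

/-- The left variable `z_j` of `ℚ[z, y]`. -/
def varL {k : ℕ} (j : Fin (k + 1)) : MvPolynomial (Fin (k + 1) ⊕ Fin (k + 1)) ℚ :=
  MvPolynomial.X (Sum.inl j)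

/-- The right variable `y_j` of `ℚ[z, y]`. -/
def varR {k : ℕ} (j : Fin (k + 1)) : MvPolynomial (Fin (k + 1) ⊕ Fin (k + 1)) ℚ :=
  MvPolynomial.X (Sum.inr j)

/-- The relations of the blob on the adjacent strands `i` and `i + 1`: the two elementary
symmetric functions on these strands agree, and so do the variables of every other strand. -/
def blobIdeal (k : ℕ) (i : Fin k) : Ideal (MvPolynomial (Fin (k + 1) ⊕ Fin (k + 1)) ℚ) :=
  Ideal.span
    ({varL i.castSucc + varL i.succ - (varR i.castSucc + varR i.succ),
      varL i.castSucc * varL i.succ - varR i.castSucc * varR i.succ} ∪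
      {p | ∃ j, j ≠ i.castSucc ∧ j ≠ i.succ ∧ p = varL j - varR j})

/-- The Soergel bimodule of the blob on the strands `i` and `i + 1`. -/
def Blob (k : ℕ) (i : Fin k) : Type :=
  MvPolynomial (Fin (k + 1) ⊕ Fin (k + 1)) ℚ ⧸ blobIdeal k i

instance (k : ℕ) (i : Fin k) : CommRing (Blob k i) :=
  inferInstanceAs (CommRing (_ ⧸ blobIdeal k i))

instance (k : ℕ) (i : Fin k) : Algebra ℚ (Blob k i) :=
  inferInstanceAs (Algebra ℚ (_ ⧸ blobIdeal k i))

namespace Blob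

variable {k : ℕ} {i : Fin k}

/-- The quotient map. -/
def mk (i : Fin k) : MvPolynomial (Fin (k + 1) ⊕ Fin (k + 1)) ℚ →ₐ[ℚ] Blob k i :=
  Ideal.Quotient.mkₐ ℚ (blobIdeal k i)

/-- The left action, through the variables `z`. -/
def left (i : Fin k) : PolyAlg k →ₐ[ℚ] Blob k i :=
  (mk i).comp (MvPolynomial.rename Sum.inl)

/-- The right action, through the variables `y`, used for tensor products over `ℚ[y]`. -/
instance : Algebra (PolyAlg k) (Blob k i) :=
  ((mk i).comp (MvPolynomial.rename Sum.inr)).toRingHom.toAlgebra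

instance : IsScalarTower ℚ (PolyAlg k) (Blob k i) :=
  IsScalarTower.of_algebraMap_eq fun r =>
    (((mk i).comp (MvPolynomial.rename Sum.inr)).commutes r).symm

/-- The elements of `q`-degree `q`. -/
def gr (i : Fin k) (q : ℤ) : Submodule ℚ (Blob k i) :=
  (polyGr (Fin (k + 1) ⊕ Fin (k + 1)) q).map (mk i).toLinearMap

/-- The difference `z_{i+1} - z_i` of left variables. -/
def leftDiff (i : Fin k) : Blob k i := mk i (varL i.succ - varL i.castSucc)

/-- The difference `y_{i+1} - y_i` of right variables. -/
def rightDiff (i : Fin k) : Blob k i := mk i (varR i.succ - varR i.castSucc)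

/-- The two filtrations: for `black` the first step of the filtration is generated by
`(z_{i+1} - z_i) - (y_{i+1} - y_i)` and is isomorphic to the shifted bimodule of the virtual
crossing; for `green` it is generated by `(z_{i+1} - z_i) + (y_{i+1} - y_i)` and is isomorphic
to the shifted diagonal bimodule. -/
inductive Color
  | black
  | green

/-- The generator of the first step of the filtration. -/
def theta (i : Fin k) : Color → Blob k i
  | .black => leftDiff i - rightDiff i
  | .green => leftDiff i + rightDiff i

/-- `F^s = Blob` for `s ≤ 0`, `F^s = (theta)` for `0 < s ≤ 1`, `F^s = 0` for `s > 1`. -/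
def fil (i : Fin k) (c : Color) (s : ℚ) : Submodule ℚ (Blob k i) :=
  if s ≤ 0 then ⊤ else if s ≤ 1 then (Ideal.span {theta i c}).restrictScalars ℚ else ⊥

lemma left_X_sub (j : Fin (k + 1)) :
    left i (MvPolynomial.X j) - algebraMap (PolyAlg k) (Blob k i) (MvPolynomial.X j)
      = mk i (varL j - varR j) := by
  have h : algebraMap (PolyAlg k) (Blob k i) (MvPolynomial.X j)
      = mk i (MvPolynomial.rename Sum.inr (MvPolynomial.X j)) := rfl
  rw [h, left, AlgHom.comp_apply, ← map_sub, MvPolynomial.rename_X, MvPolynomial.rename_X]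
  rfl

lemma mk_eq_zero {p} (h : p ∈ blobIdeal k i) : mk i p = 0 :=
  Ideal.Quotient.eq_zero_iff_mem.mpr h

/-- The two actions agree on the generator of the first step of the `green` filtration. -/
lemma left_mul_theta (p : PolyAlg k) :
    left i p * theta i .green = algebraMap (PolyAlg k) (Blob k i) p * theta i .green := by
  have h1 : varL i.castSucc + varL i.succ - (varR i.castSucc + varR i.succ) ∈ blobIdeal k i :=
    Ideal.subset_span (by simp)
  have h2 : varL i.castSucc * varL i.succ - varR i.castSucc * varR i.succ ∈ blobIdeal k i :=
    Ideal.subset_span (by simp)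
  induction p using MvPolynomial.induction_on with
  | C r =>
    have e1 : left i (MvPolynomial.C r) = algebraMap ℚ _ r := (left i).commutes r
    have e2 : algebraMap (PolyAlg k) (Blob k i) (MvPolynomial.C r) = algebraMap ℚ _ r :=
      ((mk i).comp (MvPolynomial.rename Sum.inr)).commutes r
    rw [e1, e2]
  | add p q hp hq => rw [map_add, map_add, add_mul, add_mul, hp, hq]
  | mul_X p j hp =>
    have hj : left i (MvPolynomial.X j) * theta i .green
        = algebraMap (PolyAlg k) (Blob k i) (MvPolynomial.X j) * theta i .green := by
      rw [← sub_eq_zero, ← sub_mul, left_X_sub, theta, leftDiff, rightDiff, ← map_add, ← map_mul]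
      apply mk_eq_zero
      by_cases c1 : j = i.castSucc
      · subst c1
        have e : (varL i.castSucc - varR i.castSucc) *
            (varL i.succ - varL i.castSucc + (varR i.succ - varR i.castSucc))
            = (-varL i.castSucc - varR i.castSucc) *
                (varL i.castSucc + varL i.succ - (varR i.castSucc + varR i.succ))
              + 2 * (varL i.castSucc * varL i.succ - varR i.castSucc * varR i.succ) := by
          ring
        rw [e]
        exact Ideal.add_mem _ (Ideal.mul_mem_left _ _ h1) (Ideal.mul_mem_left _ _ h2)
      · by_cases c2 : j = i.succ
        · subst c2
          have e : (varL i.succ - varR i.succ) *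
              (varL i.succ - varL i.castSucc + (varR i.succ - varR i.castSucc))
              = (varL i.succ + varR i.succ) *
                  (varL i.castSucc + varL i.succ - (varR i.castSucc + varR i.succ))
                - 2 * (varL i.castSucc * varL i.succ - varR i.castSucc * varR i.succ) := by
            ring
          rw [e]
          exact Ideal.sub_mem _ (Ideal.mul_mem_left _ _ h1) (Ideal.mul_mem_left _ _ h2)
        · exact Ideal.mul_mem_right _ _
            (Ideal.subset_span (Or.inr ⟨j, c1, c2, rfl⟩))
    rw [map_mul, map_mul, mul_assoc, hj, mul_left_comm, hp, mul_left_comm, mul_assoc]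

/-- The projection of the blob bimodule to the diagonal bimodule, `z_j, y_j ↦ y_j`. -/
def proj (i : Fin k) : Blob k i →ₐ[ℚ] PolyAlg k :=
  Ideal.Quotient.liftₐ (blobIdeal k i) (MvPolynomial.rename (Sum.elim id id)) (by
    have h : blobIdeal k i ≤
        RingHom.ker (MvPolynomial.rename (R := ℚ) (Sum.elim (id : Fin (k + 1) → _) id)) := by
      refine Ideal.span_le.mpr ?_
      rintro p ((rfl | rfl) | ⟨j, -, -, rfl⟩) <;>
        simp [varL, varR]
    exact fun p hp => h hp)

lemma proj_mk (p) : proj i (mk i p) = MvPolynomial.rename (Sum.elim id id) p := rfl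

lemma proj_left (p : PolyAlg k) : proj i (left i p) = p := by
  rw [left, AlgHom.comp_apply, proj_mk, MvPolynomial.rename_rename]
  simp

lemma proj_algebraMap (p : PolyAlg k) : proj i (algebraMap _ _ p) = p := by
  change proj i (mk i (MvPolynomial.rename Sum.inr p)) = p
  rw [proj_mk, MvPolynomial.rename_rename]
  simp

end Blob

/-! ### Tensor products with blobs -/

/-- The tensor product of the blob bimodule with a module over the intermediate variables `y`. -/
def BlobTensor {k : ℕ} (i : Fin k) (M : Type) [AddCommGroup M] [Module (PolyAlg k) M] : Type :=
  Blob k i ⊗[PolyAlg k] M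

namespace BlobTensor

variable {k : ℕ} (i : Fin k) (M : Type) [AddCommGroup M] [Module (PolyAlg k) M]

instance : AddCommGroup (BlobTensor i M) :=
  inferInstanceAs (AddCommGroup (Blob k i ⊗[PolyAlg k] M))

instance : Module (Blob k i) (BlobTensor i M) :=
  inferInstanceAs (Module (Blob k i) (Blob k i ⊗[PolyAlg k] M))

/-- The left action of the polynomial algebra, through the variables `z` of the blob. -/
instance : Module (PolyAlg k) (BlobTensor i M) :=
  Module.compHom _ (Blob.left i).toRingHom

instance : Module ℚ (BlobTensor i M) :=
  Module.compHom _ (algebraMap ℚ (Blob k i))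

instance : IsScalarTower ℚ (PolyAlg k) (BlobTensor i M) where
  smul_assoc r p x := by
    change Blob.left i (r • p) • x = algebraMap ℚ (Blob k i) r • (Blob.left i p • x)
    rw [map_smul, Algebra.smul_def, mul_smul]

variable {M}

/-- The pure tensors. -/
def tmul (b : Blob k i) (m : M) : BlobTensor i M := b ⊗ₜ[PolyAlg k] m

lemma left_smul_tmul (p : PolyAlg k) (b : Blob k i) (m : M) :
    p • tmul i b m = tmul i (Blob.left i p * b) m := rfl

lemma rat_smul_tmul (r : ℚ) (b : Blob k i) (m : M) :
    r • tmul i b m = tmul i (r • b) m := by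
  change tmul i (algebraMap ℚ (Blob k i) r * b) m = _
  rw [← Algebra.smul_def]

lemma tmul_smul (p : PolyAlg k) (b : Blob k i) (m : M) :
    tmul i b (p • m) = tmul i (algebraMap _ _ p * b) m := by
  unfold tmul
  rw [TensorProduct.tmul_smul, TensorProduct.smul_tmul', Algebra.smul_def]

lemma tmul_add (b : Blob k i) (m m' : M) : tmul i b (m + m') = tmul i b m + tmul i b m' :=
  TensorProduct.tmul_add _ _ _

lemma induction {P : BlobTensor i M → Prop} (h0 : P 0) (ht : ∀ b m, P (tmul i b m))
    (ha : ∀ x y, P x → P y → P (x + y)) (x : BlobTensor i M) : P x :=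
  TensorProduct.induction_on x h0 ht ha

/-- The map `1 ⊗ f`. -/
def map (f : M →ₗ[PolyAlg k] M) : BlobTensor i M →ₗ[PolyAlg k] BlobTensor i M where
  toFun := f.baseChange (Blob k i)
  map_add' := map_add _
  map_smul' p := (f.baseChange (Blob k i)).map_smul (Blob.left i p)

lemma map_tmul (f : M →ₗ[PolyAlg k] M) (b : Blob k i) (m : M) :
    map i f (tmul i b m) = tmul i b (f m) := rfl

/-- The right action of the polynomial algebra, given a right action on `M`. -/
def right (ρ : PolyAlg k →+* Module.End (PolyAlg k) M) :
    PolyAlg k →+* Module.End (PolyAlg k) (BlobTensor i M) where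
  toFun p := map i (ρ p)
  map_one' := by
    ext x
    induction x using BlobTensor.induction with
    | h0 => simp
    | ht b m => rw [map_tmul, map_one]; rfl
    | ha x y hx hy => rw [map_add, map_add, hx, hy]
  map_mul' p q := by
    ext x
    induction x using BlobTensor.induction with
    | h0 => simp
    | ht b m => rw [map_tmul, map_mul]; rfl
    | ha x y hx hy => rw [map_add, map_add, hx, hy]
  map_zero' := by
    ext x
    induction x using BlobTensor.induction with
    | h0 => simp
    | ht b m =>
      rw [map_tmul, map_zero]
      exact TensorProduct.tmul_zero _ _
    | ha x y hx hy => rw [map_add, map_add, hx, hy]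
  map_add' p q := by
    ext x
    induction x using BlobTensor.induction with
    | h0 => simp
    | ht b m =>
      rw [map_tmul, map_add]
      exact tmul_add i b _ _
    | ha x y hx hy => rw [LinearMap.map_add, LinearMap.map_add, hx, hy]

/-- The map `χ₋ ⊗ 1 : Blob ⊗ M → M`, where `χ₋` is the projection to the diagonal bimodule, as an
additive map. -/
def chiMinusAdd : BlobTensor i M →+ M :=
  (TensorProduct.lift (LinearMap.mk₂ (PolyAlg k) (fun (b : Blob k i) (m : M) =>
      Blob.proj i b • m)
    (fun b b' m => by rw [map_add, add_smul])
    (fun p b m => by rw [Algebra.smul_def, map_mul, Blob.proj_algebraMap, mul_smul])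
    (fun b m m' => smul_add _ _ _)
    (fun p b m => smul_comm _ _ _))).toAddMonoidHom

lemma chiMinusAdd_tmul (b : Blob k i) (m : M) :
    chiMinusAdd i (tmul i b m) = Blob.proj i b • m := rfl

/-- The map `χ₋ ⊗ 1 : Blob ⊗ M → M`, where `χ₋` is the projection to the diagonal bimodule. -/
def chiMinus : BlobTensor i M →ₗ[PolyAlg k] M where
  toFun := chiMinusAdd i
  map_add' := map_add _
  map_smul' p x := by
    induction x using BlobTensor.induction with
    | h0 => rw [smul_zero, map_zero, smul_zero]
    | ht b m =>
      rw [left_smul_tmul, chiMinusAdd_tmul, chiMinusAdd_tmul, map_mul, Blob.proj_left, mul_smul]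
      rfl
    | ha x y hx hy => rw [smul_add, map_add, hx, hy, map_add, smul_add]

lemma chiMinus_tmul (b : Blob k i) (m : M) : chiMinus i (tmul i b m) = Blob.proj i b • m := rfl

/-- The map `χ₊ ⊗ 1 : M → Blob ⊗ M`, where `χ₊` sends the generator of the diagonal bimodule to
`(z_{i+1} - z_i) + (y_{i+1} - y_i)`. -/
def chiPlus : M →ₗ[PolyAlg k] BlobTensor i M where
  toFun m := tmul i (Blob.theta i .green) m
  map_add' := tmul_add i _
  map_smul' p m := by
    rw [tmul_smul, RingHom.id_apply, left_smul_tmul, Blob.left_mul_theta]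

/-- The gradings and the filtration of the tensor product of the blob bimodule, with the
filtration of the given color, and a filtered graded bimodule. -/
def ft {k : ℕ} (i : Fin k) (c : Blob.Color) (X : BimodComplex k) : FTVect where
  carrier := BlobTensor i X.carrier
  gr a q t := Submodule.span ℚ
    {x | ∃ q', ∃ b ∈ Blob.gr i q', ∃ m ∈ X.gr a (q - q') t, tmul i b m = x}
  fil s := Submodule.span ℚ
    {x | ∃ s', ∃ b ∈ Blob.fil i c s', ∃ m ∈ X.fil (s - s'), tmul i b m = x}

end BlobTensor

namespace BlobTensor

variable {k : ℕ} {i : Fin k} {c : Blob.Color} {X : BimodComplex k}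

lemma tmul_mem_gr {a q q' : ℤ} {t : ℚ} {b : Blob k i} {m : X.carrier}
    (hb : b ∈ Blob.gr i q') (hm : m ∈ X.gr a q t) :
    (show (ft i c X).carrier from tmul i b m) ∈ (ft i c X).gr a (q' + q) t :=
  Submodule.subset_span (M := BlobTensor i X.carrier) ⟨q', b, hb, m, by rwa [add_sub_cancel_left], rfl⟩

lemma tmul_mem_fil {s s' : ℚ} {b : Blob k i} {m : X.carrier}
    (hb : b ∈ Blob.fil i c s') (hm : m ∈ X.fil s) :
    (show (ft i c X).carrier from tmul i b m) ∈ (ft i c X).fil (s' + s) :=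
  Submodule.subset_span (M := BlobTensor i X.carrier) ⟨s', b, hb, m, by rwa [add_sub_cancel_left], rfl⟩

/-- An additive map that sends the tensors of homogeneous elements into `S` sends all
homogeneous elements into `S`. -/
lemma gr_induction {V : Type} [AddCommGroup V] [Module ℚ V] {a q : ℤ} {t : ℚ}
    (S : Submodule ℚ V) (f : BlobTensor i X.carrier →+ V)
    (h : ∀ q', ∀ b ∈ Blob.gr i q', ∀ m ∈ X.gr a (q - q') t, f (tmul i b m) ∈ S)
    {x : BlobTensor i X.carrier} (hx : x ∈ (ft i c X).gr a q t) : f x ∈ S := by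
  have : (ft i c X).gr a q t ≤ S.comap f.toRatLinearMap := by
    refine Submodule.span_le.mpr ?_
    rintro _ ⟨q', b, hb, m, hm, rfl⟩
    exact h q' b hb m hm
  exact this hx

lemma fil_induction {V : Type} [AddCommGroup V] [Module ℚ V] {s : ℚ}
    (S : Submodule ℚ V) (f : BlobTensor i X.carrier →+ V)
    (h : ∀ s', ∀ b ∈ Blob.fil i c s', ∀ m ∈ X.fil (s - s'), f (tmul i b m) ∈ S)
    {x : BlobTensor i X.carrier} (hx : x ∈ (ft i c X).fil s) : f x ∈ S := by
  have : (ft i c X).fil s ≤ S.comap f.toRatLinearMap := by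
    refine Submodule.span_le.mpr ?_
    rintro _ ⟨s', b, hb, m, hm, rfl⟩
    exact h s' b hb m hm
  exact this hx

end BlobTensor

lemma Blob.gr_left_mul {k : ℕ} {i : Fin k} {q q' : ℤ} {p : PolyAlg k} {b : Blob k i}
    (hp : p ∈ polyGr _ q') (hb : b ∈ Blob.gr i q) : Blob.left i p * b ∈ Blob.gr i (q' + q) := by
  obtain ⟨r, hr, rfl⟩ := hb
  exact ⟨MvPolynomial.rename Sum.inl p * r, polyGr_mul (polyGr_rename _ hp) hr, map_mul (Blob.mk i) _ _⟩

lemma Blob.fil_mul {k : ℕ} {i : Fin k} {c : Blob.Color} {s : ℚ} {b : Blob k i} (b' : Blob k i)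
    (hb : b ∈ Blob.fil i c s) : b' * b ∈ Blob.fil i c s := by
  unfold Blob.fil at hb ⊢
  split_ifs at hb ⊢ with h1 h2
  · trivial
  · exact Ideal.mul_mem_left _ _ hb
  · rw [Submodule.mem_bot] at hb ⊢
    rw [hb, mul_zero]

/-- The tensor product of the blob bimodule of the given color and a complex of bimodules. -/
def BimodComplex.tensorBlob {k : ℕ} (i : Fin k) (c : Blob.Color) (X : BimodComplex k) :
    BimodComplex k where
  toFTVect := BlobTensor.ft i c X
  lmod := inferInstanceAs (Module (PolyAlg k) (BlobTensor i X.carrier))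
  tower := inferInstanceAs (IsScalarTower ℚ (PolyAlg k) (BlobTensor i X.carrier))
  right := BlobTensor.right i X.right
  gr_left a q t q' p hp x hx :=
    BlobTensor.gr_induction _ (DistribSMul.toAddMonoidHom (BlobTensor i X.carrier) p)
      (fun q'' b hb m hm => by
        have := BlobTensor.tmul_mem_gr (c := c) (Blob.gr_left_mul hp hb) hm
        rwa [add_assoc, add_sub_cancel] at this) hx
  gr_right a q t q' p hp x hx :=
    BlobTensor.gr_induction _ (BlobTensor.map i (X.right p)).toAddMonoidHom
      (fun q'' b hb m hm => by
        have := BlobTensor.tmul_mem_gr (c := c) hb (X.gr_right _ _ _ _ p hp m hm)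
        rwa [add_left_comm, add_sub_cancel] at this) hx
  fil_anti s s' h x hx :=
    BlobTensor.fil_induction _ (AddMonoidHom.id _) (fun s'' b hb m hm => by
      have := BlobTensor.tmul_mem_fil hb (X.fil_anti _ _ (sub_le_sub_right h s'') hm)
      rwa [add_sub_cancel] at this) hx
  fil_left s p x hx :=
    BlobTensor.fil_induction _ (DistribSMul.toAddMonoidHom (BlobTensor i X.carrier) p)
      (fun s' b hb m hm => by
        have := BlobTensor.tmul_mem_fil (c := c) (Blob.fil_mul (Blob.left i p) hb) hm
        rwa [add_sub_cancel] at this) hx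
  fil_right s p x hx :=
    BlobTensor.fil_induction _ (BlobTensor.map i (X.right p)).toAddMonoidHom
      (fun s' b hb m hm => by
        have := BlobTensor.tmul_mem_fil (c := c) hb (X.fil_right _ p m hm)
        rwa [add_sub_cancel] at this) hx
  d := BlobTensor.map i X.d
  d_right p x := by
    change BlobTensor.map i X.d (BlobTensor.map i (X.right p) x)
      = BlobTensor.map i (X.right p) (BlobTensor.map i X.d x)
    induction x using BlobTensor.induction with
    | h0 => simp only [map_zero]
    | ht b m => simp only [BlobTensor.map_tmul, X.d_right]
    | ha x y hx hy => simp only [map_add, hx, hy]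
  d_d x := by
    change BlobTensor.map i X.d (BlobTensor.map i X.d x) = 0
    induction x using BlobTensor.induction with
    | h0 => simp only [map_zero]
    | ht b m =>
      rw [BlobTensor.map_tmul, BlobTensor.map_tmul, X.d_d]
      exact TensorProduct.tmul_zero _ _
    | ha x y hx hy => rw [map_add, map_add, hx, hy, add_zero]
  d_gr a q t x hx :=
    BlobTensor.gr_induction _ (BlobTensor.map i X.d).toAddMonoidHom
      (fun q' b hb m hm => by
        have := BlobTensor.tmul_mem_gr (c := c) hb (X.d_gr _ _ _ m hm)
        rwa [add_sub_cancel] at this) hx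
  d_fil s x hx :=
    BlobTensor.fil_induction _ (BlobTensor.map i X.d).toAddMonoidHom
      (fun s' b hb m hm => by
        have := BlobTensor.tmul_mem_fil (c := c) hb (X.d_fil _ m hm)
        rwa [add_sub_cancel] at this) hx

lemma Blob.proj_mem_polyGr {k : ℕ} {i : Fin k} {q : ℤ} {b : Blob k i} (hb : b ∈ Blob.gr i q) :
    Blob.proj i b ∈ polyGr (Fin (k + 1)) q := by
  obtain ⟨r, hr, rfl⟩ := hb
  exact polyGr_rename _ hr

lemma Blob.proj_theta_black {k : ℕ} (i : Fin k) : Blob.proj i (Blob.theta i .black) = 0 := by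
  rw [theta, leftDiff, rightDiff, ← map_sub, proj_mk]
  simp [varL, varR]

lemma Blob.theta_green_mem_gr {k : ℕ} (i : Fin k) : Blob.theta i .green ∈ Blob.gr i 2 := by
  refine ⟨varL i.succ - varL i.castSucc + (varR i.succ - varR i.castSucc), ?_, map_add (Blob.mk i) _ _⟩
  have h (j : Fin (k + 1) ⊕ Fin (k + 1)) : MvPolynomial.X j ∈ polyGr _ 2 :=
    MvPolynomial.isWeightedHomogeneous_X ℚ _ j
  exact Submodule.add_mem _ (Submodule.sub_mem _ (h _) (h _)) (Submodule.sub_mem _ (h _) (h _))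

lemma Blob.theta_mem_fil {k : ℕ} (i : Fin k) (c : Blob.Color) :
    Blob.theta i c ∈ Blob.fil i c 1 := by
  unfold Blob.fil
  rw [if_neg (by norm_num), if_pos le_rfl]
  exact Ideal.subset_span rfl

/-! ### Rouquier complexes of braid words -/

namespace BlobTensor

variable {k : ℕ} (i : Fin k) (X : BimodComplex k)

/-- `χ₋` as a map from `𝐭𝐚 Blob ⊗ X`. -/
def chiMinusHom : ((X.tensorBlob i .black).shift shT).carrier →ₗ[PolyAlg k] X.carrier :=
  chiMinus i

lemma chiMinus_map (f : X.carrier →ₗ[PolyAlg k] X.carrier) (x : BlobTensor i X.carrier) :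
    chiMinus i (map i f x) = f (chiMinus i x) := by
  induction x using BlobTensor.induction with
  | h0 => simp only [map_zero]
  | ht b m => rw [map_tmul, chiMinus_tmul, chiMinus_tmul, map_smul]
  | ha x y hx hy => simp only [map_add, hx, hy]

lemma chiMinus_gr (a q : ℤ) (t : ℚ) (x : ((X.tensorBlob i .black).shift shT).carrier)
    (hx : x ∈ ((X.tensorBlob i .black).shift shT).gr a q t) :
    chiMinusHom i X x ∈ X.gr (a - 1) q (t - 1) := by
  have hx' : x ∈ (ft i .black X).gr (a - 1) (q - 0) (t - 1) := hx
  rw [sub_zero] at hx'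
  refine gr_induction _ (chiMinus i (M := X.carrier)).toAddMonoidHom (fun q' b hb m hm => ?_) hx'
  have := X.gr_left _ _ _ _ _ (Blob.proj_mem_polyGr hb) m hm
  rwa [add_sub_cancel] at this

lemma chiMinus_fil (s : ℚ) (x : ((X.tensorBlob i .black).shift shT).carrier)
    (hx : x ∈ ((X.tensorBlob i .black).shift shT).fil s) : chiMinusHom i X x ∈ X.fil s := by
  have hx' : x ∈ (ft i .black X).fil (s - 0) := hx
  rw [sub_zero] at hx'
  refine fil_induction _ (chiMinus i (M := X.carrier)).toAddMonoidHom (fun s' b hb m hm => ?_) hx'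
  change Blob.proj i b • m ∈ _
  by_cases h : s' ≤ 0
  · exact X.fil_left _ _ _ (X.fil_anti _ _ (by linarith) hm)
  · have h0 : Blob.proj i b = 0 := by
      unfold Blob.fil at hb
      rw [if_neg h] at hb
      split_ifs at hb
      · obtain ⟨r, rfl⟩ := Ideal.mem_span_singleton'.mp hb
        rw [map_mul, Blob.proj_theta_black, mul_zero]
      · rw [(Submodule.mem_bot ℚ).mp hb, map_zero]
    rw [h0, zero_smul]
    exact Submodule.zero_mem _

/-- `χ₊` as a map to `(𝐭𝐚)^(-1) (𝐬𝐪²)^(-1) Blob ⊗ X`. -/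
def chiPlusHom :
    X.carrier →ₗ[PolyAlg k] ((X.tensorBlob i .green).shift (-shT - shS)).carrier :=
  chiPlus i

lemma chiPlus_gr (a q : ℤ) (t : ℚ) (m : X.carrier) (hm : m ∈ X.gr a q t) :
    chiPlusHom i X m ∈ ((X.tensorBlob i .green).shift (-shT - shS)).gr (a - 1) q (t - 1) := by
  have h : chiPlusHom i X m ∈ (ft i .green X).gr a (2 + q) t :=
    tmul_mem_gr (Blob.theta_green_mem_gr i) hm
  have e1 : a = a - 1 - (-1 - 0) := by ring
  have e2 : 2 + q = q - (-0 - 2) := by ring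
  have e3 : t = t - 1 - (-1 - 0) := by ring
  rw [e1, e2, e3] at h
  exact h

lemma chiPlus_fil (s : ℚ) (m : X.carrier) (hm : m ∈ X.fil s) :
    chiPlusHom i X m ∈ ((X.tensorBlob i .green).shift (-shT - shS)).fil s := by
  have h : chiPlusHom i X m ∈ (ft i .green X).fil (1 + s) :=
    tmul_mem_fil (Blob.theta_mem_fil i .green) hm
  have e : 1 + s = s - (-0 - 1) := by ring
  rw [e] at h
  exact h

end BlobTensor

/-- The complex of `σ_i^{-1} β`, where `X` is the complex of `β`: the tensor product of
`(𝐭𝐬)^(-1/2) (𝐚𝐪²)^(-1) [ 𝐭𝐚 Blob → Id ]` and `X`, where the blob is black and the map is `χ₋`. -/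
def BimodComplex.neg {k : ℕ} (i : Fin k) (X : BimodComplex k) : BimodComplex k :=
  (BimodComplex.bracket ((X.tensorBlob i .black).shift shT) X (BlobTensor.chiMinusHom i X)
    (fun p => BlobTensor.chiMinus_map i X (X.right p))
    (BlobTensor.chiMinus_map i X X.d)
    (BlobTensor.chiMinus_gr i X)
    (BlobTensor.chiMinus_fil i X)).shift (-(shTS + shA))

/-- The complex of `σ_i β`, where `X` is the complex of `β`: the tensor product of
`(𝐭𝐬)^(1/2) 𝐚𝐪² [ Id → (𝐭𝐚)^(-1) (𝐬𝐪²)^(-1) Blob ]` and `X`, where the blob is green and the map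
is `χ₊`. -/
def BimodComplex.pos {k : ℕ} (i : Fin k) (X : BimodComplex k) : BimodComplex k :=
  (BimodComplex.bracket X ((X.tensorBlob i .green).shift (-shT - shS)) (BlobTensor.chiPlusHom i X)
    (fun _ _ => rfl)
    (fun _ => rfl)
    (BlobTensor.chiPlus_gr i X)
    (BlobTensor.chiPlus_fil i X)).shift (shTS + shA)

/-- The elementary braids on `k + 1` strands. -/
inductive Crossing (k : ℕ)
  | pos (i : Fin k)
  | neg (i : Fin k)

/-- The complex of a braid word on `k + 1` strands. -/
def rouquier {k : ℕ} : List (Crossing k) → BimodComplex k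
  | [] => BimodComplex.diag k
  | .pos i :: β => (rouquier β).pos i
  | .neg i :: β => (rouquier β).neg i

/-! ### Homology of the closure of a braid word -/

namespace BimodComplex

variable {k : ℕ} (X : BimodComplex k)

/-- The derived tensor product with the diagonal bimodule, through the Koszul resolution of the
latter: `f S` is the component at the exterior monomial `∏_{j ∈ S} e_j`, and each `e_j` has
degree `𝐚𝐪²`. -/
def koszul : FTVect where
  carrier := Finset (Fin (k + 1)) → X.carrier
  gr a q t := Submodule.pi Set.univ fun S => X.gr (a - S.card) (q - 2 * S.card) t
  fil s := Submodule.pi Set.univ fun _ => X.fil s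

/-- The operator `y_j - x_j`. -/
def varDiff (j : Fin (k + 1)) : X.carrier →ₗ[PolyAlg k] X.carrier :=
  (MvPolynomial.X j : PolyAlg k) • LinearMap.id - X.right (MvPolynomial.X j)

/-- The inner differential: the Koszul differential, `e_j ↦ y_j - x_j`. -/
def inner : (Finset (Fin (k + 1)) → X.carrier) →ₗ[ℚ] (Finset (Fin (k + 1)) → X.carrier) :=
  LinearMap.pi fun T => ∑ j ∈ Tᶜ, ((-1 : ℚ) ^ (T.filter (· < j)).card) •
    ((X.varDiff j).restrictScalars ℚ ∘ₗ LinearMap.proj (insert j T))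

/-- The outer differential. -/
def outer : (Finset (Fin (k + 1)) → X.carrier) →ₗ[ℚ] (Finset (Fin (k + 1)) → X.carrier) :=
  LinearMap.pi fun T => X.d.restrictScalars ℚ ∘ₗ LinearMap.proj T

lemma inner_outer (f : Finset (Fin (k + 1)) → X.carrier) :
    X.inner (X.outer f) = X.outer (X.inner f) := by
  funext T
  simp only [inner, outer, LinearMap.pi_apply, LinearMap.sum_apply, LinearMap.smul_apply,
    LinearMap.comp_apply, LinearMap.proj_apply, LinearMap.restrictScalars_apply, map_sum]
  refine Finset.sum_congr rfl fun j _ => ?_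
  rw [LinearMap.map_smul_of_tower, varDiff]
  simp only [LinearMap.sub_apply, LinearMap.smul_apply, LinearMap.id_apply, map_sub, map_smul,
    X.d_right]

/-- The homology of the inner differential, which is the Hochschild homology. -/
def innerHomology : FTVect := X.koszul.homology X.inner

/-- The homology of the outer differential on the homology of the inner differential. -/
def outerHomology : FTVect :=
  X.innerHomology.homology (X.koszul.homologyMap X.inner X.outer X.inner_outer)

end BimodComplex

/-- The filtered triply graded homology of the circular closure of a braid word on `k + 1`
strands. -/
def H3 {k : ℕ} (β : List (Crossing k)) : FTVect :=
  (rouquier β).outerHomology.shift ((k + 1) • shTS)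

/-- The homology of the unknot, the closure of the braid with one strand. -/
def H3unknot : FTVect := H3 ([] : List (Crossing 0))

/-- The homology of the closure of the two-strand braid word `σ^{-m}`. -/
def H3torus (m : ℕ) : FTVect := H3 (List.replicate m (Crossing.neg (0 : Fin 1)))

end

open scoped TensorProduct
noncomputable section
open FTVect

/-! ### The blob bimodule is free over the right variables -/

/-! The blob bimodule is free over its right variables with basis `1`, `theta`, where `theta` is the
generator of the black filtration (`Blob.eq_expand`). If `b` is the right difference of the
variables, the left difference is `b + theta`, and `theta ^ 2 = -2 * b * theta`
(`Blob.theta_mul_theta`). Hence the complex of `σ⁻¹ β` consists of three shifted copies of the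
complex of `β`, with explicit matrices `negLeft`, `negMap`, `negD` for the two actions and the
differential, and the black filtration is the direct sum of shifted filtrations
(`BimodComplex.retractNeg`). The sum of the two variables acts equally from both sides (`Central`),
so only the actions of their difference matter.

The complex of `σ^{-m}` retracts to a chain of `m` blobs ending in the diagonal bimodule. In
`OpComplex.torus` it is written with two sequences over `R = ℚ[x₀, x₁]`: entries `u j` for `j < m`
and `v j` for `j ≤ m`. The pair `u j`, `v (j + 1)` is one blob, and `v 0` is the diagonal bimodule.
The left action alternates between the action on the basis of the black and of the green generator,
and the differential sends `u j` to `v j`. One more crossing doubles every blob and adds a cone that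
cancels one copy of each; `OpComplex.retractTorus` is this cancellation, by maps that are
homogeneous and filtered in both directions.

By centrality the two Koszul operators are opposite multiples of `δ = left - right`. The iterated
homology is therefore built from two homologies of `d`: that on the cokernel of `δ` and that on the
kernel of `δ` (`BimodComplex.outerHomology_isomorphic`). On the simplified complex, `δ` is zero on
`u j` for even `j` up to the term that moves it to `v (j + 1)`, and is `-2 * b` for odd `j`. The
kernel contributes `R / b` at each even index of `v` below `m`, and the cokernel contributes `R / b`
at odd indices of `u`. If `m` is even, the last `v m` is not hit by `d`, which gives a full copy of
`R` in each of the two homologies; in the cokernel it is glued to the class of `u (m - 1)` through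
`v m = 2 * b * u (m - 1)`, and must be split off compatibly with the filtration (`homologyDataOdd`,
`homologyDataEven`).

Since all comparison maps and their sections respect gradings and filtration, no strictness argument
is needed. The theorem then becomes a bijection of homogeneous bases (`HasDegrees.isomorphic`),
whose degrees match because `𝐭_tot = 𝐭_a 𝐬_q = 𝐮² 𝐚_q`. -/

/-- The difference of the variables of the strands `i + 1` and `i`. -/
def PolyAlg.diff {k : ℕ} (i : Fin k) : PolyAlg k :=
  MvPolynomial.X i.succ - MvPolynomial.X i.castSucc

lemma X_mem_polyGr {σ : Type} (j : σ) : (MvPolynomial.X j : MvPolynomial σ ℚ) ∈ polyGr σ 2 :=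
  MvPolynomial.isWeightedHomogeneous_X ℚ _ j

lemma C_mem_polyGr {σ : Type} (r : ℚ) : (MvPolynomial.C r : MvPolynomial σ ℚ) ∈ polyGr σ 0 :=
  MvPolynomial.isWeightedHomogeneous_C _ r

lemma polyGr_C_mul {σ : Type} {q : ℤ} (r : ℚ) {p : MvPolynomial σ ℚ} (hp : p ∈ polyGr σ q) :
    MvPolynomial.C r * p ∈ polyGr σ q := by
  have := polyGr_mul (C_mem_polyGr r) hp
  rwa [zero_add] at this

lemma PolyAlg.diff_mem {k : ℕ} (i : Fin k) : PolyAlg.diff i ∈ polyGr (Fin (k + 1)) 2 :=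
  Submodule.sub_mem _ (X_mem_polyGr _) (X_mem_polyGr _)

namespace Blob

variable {k : ℕ} {i : Fin k}

lemma mk_surjective (b : Blob k i) : ∃ r, mk i r = b := Ideal.Quotient.mk_surjective b

/-- The monic polynomial satisfied by the generator `theta` of the black filtration over the right
variables. -/
def thetaPoly (i : Fin k) : Polynomial (PolyAlg k) :=
  Polynomial.X ^ 2 + Polynomial.C (2 * PolyAlg.diff i) * Polynomial.X

/-- Monicity makes `AdjoinRoot` free on `1` and the root, so that the coefficient of the root is
well defined. -/
lemma thetaPoly_monic : (thetaPoly i).Monic := by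
  unfold thetaPoly
  monicity!

lemma thetaPoly_natDegree : (thetaPoly i).natDegree = 2 := by
  unfold thetaPoly
  compute_degree!

lemma root_mul_root : AdjoinRoot.root (thetaPoly i) * AdjoinRoot.root (thetaPoly i)
    = - (AdjoinRoot.of _ (2 * PolyAlg.diff i) * AdjoinRoot.root (thetaPoly i)) := by
  have h : Polynomial.eval₂ (AdjoinRoot.of (thetaPoly i)) (AdjoinRoot.root (thetaPoly i))
      (Polynomial.X ^ 2 + Polynomial.C (2 * PolyAlg.diff i) * Polynomial.X) = 0 :=
    AdjoinRoot.eval₂_root _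
  rw [Polynomial.eval₂_add, Polynomial.eval₂_pow, Polynomial.eval₂_mul, Polynomial.eval₂_X,
    Polynomial.eval₂_C] at h
  rw [eq_neg_iff_add_eq_zero, ← sq]
  exact h

/-- The values of the left and the right variables in the free model. -/
def modelVar (i : Fin k) : Fin (k + 1) ⊕ Fin (k + 1) → AdjoinRoot (thetaPoly i)
  -- The left and right sums agree and the differences differ by the root, so the upper variable
  -- moves by half the root and the lower one by minus half of it.
  | .inl j => AdjoinRoot.of _ (MvPolynomial.X j) +
      ((if j = i.succ then (1 / 2 : ℚ) else 0) - (if j = i.castSucc then (1 / 2 : ℚ) else 0)) •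
        AdjoinRoot.root (thetaPoly i)
  | .inr j => AdjoinRoot.of _ (MvPolynomial.X j)

lemma modelVar_right (p : PolyAlg k) :
    MvPolynomial.aeval (modelVar i) (MvPolynomial.rename Sum.inr p) = AdjoinRoot.of _ p := by
  rw [MvPolynomial.aeval_rename]
  induction p using MvPolynomial.induction_on with
  | C r => 
    rw [MvPolynomial.aeval_C]; rfl
  | add p q hp hq => rw [map_add, hp, hq, map_add]
  | mul_X p j hp => rw [map_mul, hp, map_mul, MvPolynomial.aeval_X]; rfl

/-- The map from the blob bimodule to the free model. -/
def toModel (i : Fin k) : Blob k i →ₐ[ℚ] AdjoinRoot (thetaPoly i) :=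
  Ideal.Quotient.liftₐ (blobIdeal k i) (MvPolynomial.aeval (modelVar i)) (by
    have hne : i.castSucc ≠ i.succ := i.castSucc_lt_succ.ne
    have h : blobIdeal k i ≤ RingHom.ker (MvPolynomial.aeval (R := ℚ) (modelVar i)) := by
      refine Ideal.span_le.mpr ?_
      rintro p ((rfl | rfl) | ⟨j, h1, h2, rfl⟩)
      · simp only [SetLike.mem_coe, RingHom.mem_ker, varL, varR, map_sub, map_add,
          MvPolynomial.aeval_X, modelVar, if_true, if_neg hne, if_neg hne.symm]
        module
      · simp only [SetLike.mem_coe, RingHom.mem_ker, varL, varR, map_sub, map_mul,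
          MvPolynomial.aeval_X, modelVar, if_true, if_neg hne, if_neg hne.symm]
        have h := root_mul_root (i := i)
        rw [PolyAlg.diff, map_mul, map_ofNat, map_sub] at h
        have hw : 2 * algebraMap ℚ (AdjoinRoot (thetaPoly i)) (1 / 2) = 1 := by
          rw [← map_ofNat (algebraMap ℚ (AdjoinRoot (thetaPoly i))), ← map_mul]
          norm_num
        simp only [Algebra.smul_def, map_sub, map_zero]
        -- With `w` in place of one half, the product relation is `-w ^ 2` times the quadratic
        -- equation of the root, corrected by `2 * w = 1`.
        generalize algebraMap ℚ (AdjoinRoot (thetaPoly i)) (1 / 2) = w at hw ⊢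
        linear_combination (-w ^ 2) * h - w * (AdjoinRoot.of (thetaPoly i) (MvPolynomial.X i.castSucc)
          - AdjoinRoot.of (thetaPoly i) (MvPolynomial.X i.succ)) * AdjoinRoot.root (thetaPoly i) * hw
      · simp [varL, varR, modelVar, h1, h2]
    exact fun p hp => h hp)

lemma toModel_mk (p) : toModel i (mk i p) = MvPolynomial.aeval (modelVar i) p := rfl

lemma toModel_algebraMap (p : PolyAlg k) :
    toModel i (algebraMap _ _ p) = AdjoinRoot.of _ p := modelVar_right p

lemma toModel_theta : toModel i (theta i .black) = AdjoinRoot.root (thetaPoly i) := by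
  have hne : i.castSucc ≠ i.succ := i.castSucc_lt_succ.ne
  rw [theta, leftDiff, rightDiff, map_sub, toModel_mk, toModel_mk]
  simp only [varL, varR, map_sub, MvPolynomial.aeval_X, modelVar, if_true, if_neg hne,
    if_neg hne.symm]
  module

/-- The coefficient of `theta` in an element of the blob bimodule (a Demazure operator). -/
def coeffTheta (i : Fin k) : Blob k i →+ PolyAlg k :=
  ((Polynomial.lcoeff (PolyAlg k) 1).toAddMonoidHom.comp
    (AdjoinRoot.modByMonicHom (thetaPoly_monic (i := i))).toAddMonoidHom).comp
      (toModel i : Blob k i →+ AdjoinRoot (thetaPoly i))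

/-- The polynomial `p + q X` has degree below that of the monic `thetaPoly`, hence is its own
remainder. This is the uniqueness half of freeness on `1` and `theta`. -/
lemma coeffTheta_expand (p q : PolyAlg k) :
    coeffTheta i (algebraMap _ _ p + algebraMap _ _ q * theta i .black) = q := by
  change ((AdjoinRoot.modByMonicHom (thetaPoly_monic (i := i)))
    (toModel i (algebraMap _ _ p + algebraMap _ _ q * theta i .black))).coeff 1 = q
  rw [map_add, map_mul, toModel_algebraMap, toModel_algebraMap, toModel_theta,
    ← AdjoinRoot.mk_C, ← AdjoinRoot.mk_C, ← AdjoinRoot.mk_X, ← map_mul, ← map_add,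
    AdjoinRoot.modByMonicHom_mk,
    (Polynomial.modByMonic_eq_self_iff thetaPoly_monic).mpr]
  · simp
  · rw [Polynomial.degree_eq_natDegree thetaPoly_monic.ne_zero, thetaPoly_natDegree]
    refine lt_of_le_of_lt (b := 1) ?_ (by norm_num)
    compute_degree

lemma proj_expand (p q : PolyAlg k) :
    proj i (algebraMap _ _ p + algebraMap _ _ q * theta i .black) = p := by
  rw [map_add, map_mul, proj_theta_black, mul_zero, add_zero, proj_algebraMap]

/-- The squares of the left and of the right difference are both the discriminant of the same
symmetric functions, hence equal. Thus `theta * (theta + 2 * rightDiff) = leftDiff ^ 2 - rightDiff ^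
2 = 0`. -/
lemma theta_mul_theta : theta i .black * theta i .black
    = - (algebraMap _ _ (2 * PolyAlg.diff i) * theta i .black) := by
  have h1 : varL i.castSucc + varL i.succ - (varR i.castSucc + varR i.succ) ∈ blobIdeal k i :=
    Ideal.subset_span (by simp)
  have h2 : varL i.castSucc * varL i.succ - varR i.castSucc * varR i.succ ∈ blobIdeal k i :=
    Ideal.subset_span (by simp)
  have h : algebraMap (PolyAlg k) (Blob k i) (2 * PolyAlg.diff i)
      = mk i (2 * (varR i.succ - varR i.castSucc)) := by
    change mk i (MvPolynomial.rename Sum.inr _) = _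
    rw [PolyAlg.diff, map_mul, map_ofNat, map_sub, MvPolynomial.rename_X, MvPolynomial.rename_X]
    rfl
  rw [eq_neg_iff_add_eq_zero, h, theta, leftDiff, rightDiff, ← map_sub, ← map_mul, ← map_mul,
    ← map_add]
  apply mk_eq_zero
  have e : (varL i.succ - varL i.castSucc - (varR i.succ - varR i.castSucc)) *
          (varL i.succ - varL i.castSucc - (varR i.succ - varR i.castSucc)) +
        2 * (varR i.succ - varR i.castSucc) *
          (varL i.succ - varL i.castSucc - (varR i.succ - varR i.castSucc))
      = (varL i.castSucc + varL i.succ + (varR i.castSucc + varR i.succ)) *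
          (varL i.castSucc + varL i.succ - (varR i.castSucc + varR i.succ))
        - 4 * (varL i.castSucc * varL i.succ - varR i.castSucc * varR i.succ) := by
    ring
  rw [e]
  exact Ideal.sub_mem _ (Ideal.mul_mem_left _ _ h1) (Ideal.mul_mem_left _ _ h2)

lemma algebraMap_X (j : Fin (k + 1)) :
    algebraMap (PolyAlg k) (Blob k i) (MvPolynomial.X j) = mk i (varR j) := by
  change mk i (MvPolynomial.rename Sum.inr _) = _
  rw [MvPolynomial.rename_X]
  rfl

lemma algebraMap_C (r : ℚ) :
    algebraMap (PolyAlg k) (Blob k i) (MvPolynomial.C r) = mk i (MvPolynomial.C r) := by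
  change mk i (MvPolynomial.rename Sum.inr _) = _
  rw [MvPolynomial.rename_C]

lemma algebraMap_diff :
    algebraMap (PolyAlg k) (Blob k i) (PolyAlg.diff i) = rightDiff i := by
  rw [PolyAlg.diff, map_sub, algebraMap_X, algebraMap_X, ← map_sub]
  rfl

lemma expand_mul (p q p' q' : PolyAlg k) :
    (algebraMap (PolyAlg k) (Blob k i) p + algebraMap _ _ q * theta i .black) *
        (algebraMap _ _ p' + algebraMap _ _ q' * theta i .black)
      = algebraMap _ _ (p * p') + algebraMap _ _ (p * q' + q * p'
          - 2 * PolyAlg.diff i * (q * q')) * theta i .black := by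
  have h := theta_mul_theta (i := i)
  simp only [map_add, map_sub, map_mul] at h ⊢
  linear_combination (algebraMap (PolyAlg k) (Blob k i) q * algebraMap _ _ q') * h

/-- The left variable `z_j` in terms of the right variables and `theta`. -/
lemma mk_varL (j : Fin (k + 1)) : ∃ r : ℚ, mk i (varL j)
    = algebraMap (PolyAlg k) (Blob k i) (MvPolynomial.X j) + algebraMap (PolyAlg k) (Blob k i) (MvPolynomial.C r) * theta i .black := by
  have h1 : varL i.castSucc + varL i.succ - (varR i.castSucc + varR i.succ) ∈ blobIdeal k i :=
    Ideal.subset_span (by simp)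
  have key (j : Fin (k + 1)) (r : ℚ) (h : varL j - (varR j + MvPolynomial.C r *
      (varL (k := k) i.succ - varL i.castSucc - (varR i.succ - varR i.castSucc))) ∈ blobIdeal k i) :
      ∃ r : ℚ, mk i (varL j) = algebraMap (PolyAlg k) (Blob k i) (MvPolynomial.X j)
        + algebraMap (PolyAlg k) (Blob k i) (MvPolynomial.C r) * theta i .black := by
    refine ⟨r, ?_⟩
    rw [algebraMap_X, algebraMap_C, theta, leftDiff, rightDiff, ← map_sub, ← map_mul, ← map_add,
      ← sub_eq_zero, ← map_sub]
    exact mk_eq_zero h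
  have e2 : (MvPolynomial.C (1 / 2 : ℚ) : MvPolynomial (Fin (k + 1) ⊕ Fin (k + 1)) ℚ) * 2 = 1 := by
    rw [← map_ofNat MvPolynomial.C, ← map_mul]
    norm_num
  by_cases c1 : j = i.castSucc
  · subst c1
    -- The sum relation alone determines the coefficient: minus one half here, one half on the
    -- strand `i + 1`, and zero elsewhere.
    refine key _ (-(1 / 2)) ?_
    have e : varL i.castSucc - (varR i.castSucc + MvPolynomial.C (-(1 / 2) : ℚ) *
        (varL i.succ - varL i.castSucc - (varR i.succ - varR i.castSucc)))
        = MvPolynomial.C (1 / 2) * (varL i.castSucc + varL i.succ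
            - (varR i.castSucc + varR i.succ)) := by
      rw [map_neg]
      linear_combination (- varL i.castSucc + varR i.castSucc) * e2
    rw [e]
    exact Ideal.mul_mem_left _ _ h1
  · by_cases c2 : j = i.succ
    · subst c2
      refine key _ (1 / 2) ?_
      have e : varL i.succ - (varR i.succ + MvPolynomial.C (1 / 2 : ℚ) *
          (varL i.succ - varL i.castSucc - (varR i.succ - varR i.castSucc)))
          = MvPolynomial.C (1 / 2) * (varL i.castSucc + varL i.succ
              - (varR i.castSucc + varR i.succ)) := by
        linear_combination (- varL i.succ + varR i.succ) * e2
      rw [e]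
      exact Ideal.mul_mem_left _ _ h1
    · refine key _ 0 ?_
      rw [map_zero, zero_mul, add_zero]
      exact Ideal.subset_span (Or.inr ⟨j, c1, c2, rfl⟩)

/-- Homogeneous elements, in terms of the right variables and `theta`. -/
lemma exists_expand_monomial (s : (Fin (k + 1) ⊕ Fin (k + 1)) →₀ ℕ) :
    ∃ p q : PolyAlg k, p ∈ polyGr _ (Finsupp.weight (fun _ => (2 : ℤ)) s) ∧
      q ∈ polyGr _ (Finsupp.weight (fun _ => (2 : ℤ)) s - 2) ∧
      mk i (MvPolynomial.monomial s 1)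
        = algebraMap _ _ p + algebraMap _ _ q * theta i .black := by
  -- Homogeneous expansions are closed under multiplication by `expand_mul`, so it is enough to
  -- expand one variable.
  induction s using Finsupp.induction_linear with
  | zero => exact ⟨1, 0, by simpa using C_mem_polyGr 1, Submodule.zero_mem _, by simp⟩
  | add s t hs ht =>
    obtain ⟨p, q, hp, hq, h⟩ := hs
    obtain ⟨p', q', hp', hq', h'⟩ := ht
    refine ⟨p * p', p * q' + q * p' - 2 * PolyAlg.diff i * (q * q'), ?_, ?_, ?_⟩
    · rw [map_add]
      exact polyGr_mul hp hp'
    · rw [map_add]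
      refine Submodule.sub_mem _ (Submodule.add_mem _ ?_ ?_) ?_
      · rw [add_sub_assoc]
        exact polyGr_mul hp hq'
      · rw [add_sub_right_comm]
        exact polyGr_mul hq hp'
      · have := polyGr_mul (polyGr_C_mul 2 (PolyAlg.diff_mem i)) (polyGr_mul hq hq')
        rw [map_ofNat] at this
        convert this using 2
        ring
    · rw [← one_mul (1 : ℚ), ← MvPolynomial.monomial_mul, map_mul, h, h', expand_mul]
  | single j n =>
    have hw : Finsupp.weight (fun _ => (2 : ℤ)) (Finsupp.single j n) = n * 2 := by
      simp [Finsupp.weight_apply]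
    rw [hw]
    have e : (MvPolynomial.monomial (Finsupp.single j n) 1 : MvPolynomial _ ℚ)
        = MvPolynomial.X j ^ n := by
      rw [MvPolynomial.X_pow_eq_monomial]
    rw [e]
    clear e hw
    have hj : ∃ p q : PolyAlg k, p ∈ polyGr _ 2 ∧ q ∈ polyGr _ 0 ∧
        mk i (MvPolynomial.X j) = algebraMap _ _ p + algebraMap _ _ q * theta i .black := by
      rcases j with j | j
      · obtain ⟨r, hr⟩ := mk_varL (i := i) j
        exact ⟨_, _, X_mem_polyGr j, C_mem_polyGr r, hr⟩
      · refine ⟨_, 0, X_mem_polyGr j, Submodule.zero_mem _, ?_⟩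
        rw [map_zero, zero_mul, add_zero, algebraMap_X]
        rfl
    obtain ⟨p', q', hp', hq', h'⟩ := hj
    induction n with
    | zero =>
      exact ⟨1, 0, by simpa using C_mem_polyGr 1, Submodule.zero_mem _, by simp⟩
    | succ n ih =>
      obtain ⟨p, q, hp, hq, h⟩ := ih
      refine ⟨p * p', p * q' + q * p' - 2 * PolyAlg.diff i * (q * q'), ?_, ?_, ?_⟩
      · convert polyGr_mul hp hp' using 2
        push_cast; ring
      · refine Submodule.sub_mem _ (Submodule.add_mem _ ?_ ?_) ?_
        · convert polyGr_mul hp hq' using 2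
          push_cast; ring
        · convert polyGr_mul hq hp' using 2
          push_cast; ring
        · have := polyGr_mul (polyGr_C_mul 2 (PolyAlg.diff_mem i)) (polyGr_mul hq hq')
          rw [map_ofNat] at this
          convert this using 2
          push_cast; ring
      · rw [pow_succ, map_mul, h, h', expand_mul]

lemma exists_expand_of_mem_gr {q : ℤ} {b : Blob k i} (hb : b ∈ gr i q) :
    ∃ p p' : PolyAlg k, p ∈ polyGr _ q ∧ p' ∈ polyGr _ (q - 2) ∧
      b = algebraMap _ _ p + algebraMap _ _ p' * theta i .black := by
  obtain ⟨r, hr, rfl⟩ := hb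
  choose p p' hp hp' h using exists_expand_monomial (i := i)
  refine ⟨∑ s ∈ r.support, MvPolynomial.C (r.coeff s) * p s,
    ∑ s ∈ r.support, MvPolynomial.C (r.coeff s) * p' s,
    Submodule.sum_mem _ fun s hs => ?_, Submodule.sum_mem _ fun s hs => ?_, ?_⟩
  · have := hr (MvPolynomial.mem_support_iff.mp hs)
    rw [← this]
    exact polyGr_C_mul _ (hp s)
  · have := hr (MvPolynomial.mem_support_iff.mp hs)
    rw [← this]
    exact polyGr_C_mul _ (hp' s)
  · conv_lhs => rw [r.as_sum]
    change mk i _ = _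
    simp only [map_sum, map_mul, Finset.sum_mul, ← Finset.sum_add_distrib]
    refine Finset.sum_congr rfl fun s _ => ?_
    rw [algebraMap_C, mul_assoc, ← mul_add, ← h s, ← map_mul, MvPolynomial.C_mul_monomial, mul_one]

lemma exists_expand (b : Blob k i) :
    ∃ p p' : PolyAlg k, b = algebraMap _ _ p + algebraMap _ _ p' * theta i .black := by
  obtain ⟨r, rfl⟩ := mk_surjective b
  choose p p' hp hp' h using exists_expand_monomial (i := i)
  refine ⟨∑ s ∈ r.support, MvPolynomial.C (r.coeff s) * p s,
    ∑ s ∈ r.support, MvPolynomial.C (r.coeff s) * p' s, ?_⟩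
  conv_lhs => rw [r.as_sum]
  simp only [map_sum, map_mul, Finset.sum_mul, ← Finset.sum_add_distrib]
  refine Finset.sum_congr rfl fun s _ => ?_
  rw [algebraMap_C, mul_assoc, ← mul_add, ← h s, ← map_mul, MvPolynomial.C_mul_monomial, mul_one]

/-- Existence comes from the expansion of monomials, uniqueness from the free model; together they
identify the two coordinates as `proj` and `coeffTheta`. -/
lemma eq_expand (b : Blob k i) :
    b = algebraMap _ _ (proj i b) + algebraMap _ _ (coeffTheta i b) * theta i .black := by
  obtain ⟨p, p', rfl⟩ := exists_expand b
  rw [proj_expand, coeffTheta_expand]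

lemma coeffTheta_mem_polyGr {q : ℤ} {b : Blob k i} (hb : b ∈ gr i q) :
    coeffTheta i b ∈ polyGr _ (q - 2) := by
  obtain ⟨p, p', -, hp', rfl⟩ := exists_expand_of_mem_gr hb
  rwa [coeffTheta_expand]

lemma coeffTheta_mul (b b' : Blob k i) : coeffTheta i (b * b')
    = proj i b * coeffTheta i b' + coeffTheta i b * proj i b'
      - 2 * PolyAlg.diff i * (coeffTheta i b * coeffTheta i b') := by
  conv_lhs => rw [eq_expand b, eq_expand b', expand_mul, coeffTheta_expand]

lemma coeffTheta_algebraMap (p : PolyAlg k) : coeffTheta i (algebraMap _ _ p) = 0 := by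
  simpa using coeffTheta_expand (i := i) p 0

lemma coeffTheta_theta : coeffTheta i (theta i .black) = 1 := by
  simpa using coeffTheta_expand (i := i) 0 1

lemma coeffTheta_one : coeffTheta i (1 : Blob k i) = 0 := by
  simpa using coeffTheta_expand (i := i) 1 0

lemma coeffTheta_algebraMap_mul (p : PolyAlg k) (b : Blob k i) :
    coeffTheta i (algebraMap _ _ p * b) = p * coeffTheta i b := by
  rw [coeffTheta_mul, coeffTheta_algebraMap, proj_algebraMap]
  ring

lemma left_diff : left i (PolyAlg.diff i) = leftDiff i := by
  rw [left, PolyAlg.diff, AlgHom.comp_apply, map_sub, MvPolynomial.rename_X,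
    MvPolynomial.rename_X]
  rfl

lemma leftDiff_eq : leftDiff i = algebraMap _ _ (PolyAlg.diff i) + theta i .black := by
  rw [algebraMap_diff, theta, add_sub_cancel]

/-- From `leftDiff = y + theta` and `theta ^ 2 = -2 * y * theta`, the coefficient of `theta` is `p +
y * q - 2 * y * q`. This is the source of the minus sign in `negLeft`, and so of the alternating
signs later. -/
lemma coeffTheta_leftDiff_mul (b : Blob k i) :
    coeffTheta i (leftDiff i * b) = proj i b - PolyAlg.diff i * coeffTheta i b := by
  rw [coeffTheta_mul, leftDiff_eq, map_add, map_add, proj_theta_black, proj_algebraMap,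
    coeffTheta_algebraMap, coeffTheta_theta]
  ring

end Blob

/-! ### Complexes with a left and a right operator -/

namespace FTVect

lemma gr_congr (V : FTVect) {a a' q q' : ℤ} {t t' : ℚ} {x : V.carrier} (hx : x ∈ V.gr a q t)
    (ha : a = a') (hq : q = q') (ht : t = t') : x ∈ V.gr a' q' t' := by
  subst ha hq ht
  exact hx

lemma fil_congr (V : FTVect) {s s' : ℚ} {x : V.carrier} (hx : x ∈ V.fil s)
    (hs : s = s') : x ∈ V.fil s' := by
  subst hs
  exact hx

end FTVect

/-- A filtered triply graded vector space with two operators, the actions of `x₁ - x₀` from the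
left and from the right, and a differential. -/
structure OpComplex extends FTVect where
  left : carrier →ₗ[ℚ] carrier
  right : carrier →ₗ[ℚ] carrier
  d : carrier →ₗ[ℚ] carrier

/-- The underlying operators of a complex of bimodules over `ℚ[x₀, x₁]`. -/
def BimodComplex.toOp (X : BimodComplex 1) : OpComplex where
  toFTVect := X.toFTVect
  left := LinearMap.restrictScalars ℚ (PolyAlg.diff (0 : Fin 1) • LinearMap.id (R := PolyAlg 1))
  right := LinearMap.restrictScalars ℚ (X.right (PolyAlg.diff (0 : Fin 1)))
  d := LinearMap.restrictScalars ℚ X.d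

section negOperators

variable {M : Type} [AddCommGroup M] [Module ℚ M]

/-- The left operator of `σ⁻¹ β`, in terms of that of `β`. -/
def negLeft (c : M →ₗ[ℚ] M) : ((M × M) × M) →ₗ[ℚ] ((M × M) × M) :=
  LinearMap.prodMap
    ((c ∘ₗ LinearMap.fst ℚ M M).prod (LinearMap.fst ℚ M M - c ∘ₗ LinearMap.snd ℚ M M)) c

/-- The differential of `σ⁻¹ β`, in terms of that of `β`. -/
def negD (d : M →ₗ[ℚ] M) : ((M × M) × M) →ₗ[ℚ] ((M × M) × M) :=
  (LinearMap.prodMap (-d) (-d) ∘ₗ LinearMap.fst ℚ (M × M) M).prod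
    (LinearMap.fst ℚ M M ∘ₗ LinearMap.fst ℚ (M × M) M + d ∘ₗ LinearMap.snd ℚ (M × M) M)

/-- The map of complexes of `σ⁻¹ β` induced by a map of complexes of `β`. -/
def negMap {N : Type} [AddCommGroup N] [Module ℚ N] (f : M →ₗ[ℚ] N) :
    ((M × M) × M) →ₗ[ℚ] ((N × N) × N) :=
  LinearMap.prodMap (LinearMap.prodMap f f) f

end negOperators

namespace OpComplex

/-- The complex of operators of `σ⁻¹ β`, in terms of that of `β`: the blob bimodule is free with
basis `1` and `theta`. -/
def neg (V : OpComplex) : OpComplex where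
  toFTVect := (((V.shift shT).sum (V.shift (shT + shS))).sum V.toFTVect).shift (-(shTS + shA))
  left := negLeft V.left
  right := negMap V.right
  d := negD V.d

/-- A homotopy equivalence of complexes of operators onto a strong retract.  The homotopy is not
required to respect the gradings or the filtration. -/
structure Retract (V W : OpComplex) where
  f : V.carrier →ₗ[ℚ] W.carrier
  g : W.carrier →ₗ[ℚ] V.carrier
  h : V.carrier →ₗ[ℚ] V.carrier
  f_gr : ∀ a q t, ∀ x ∈ V.gr a q t, f x ∈ W.gr a q t
  f_fil : ∀ s, ∀ x ∈ V.fil s, f x ∈ W.fil s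
  g_gr : ∀ a q t, ∀ x ∈ W.gr a q t, g x ∈ V.gr a q t
  g_fil : ∀ s, ∀ x ∈ W.fil s, g x ∈ V.fil s
  f_left : ∀ x, f (V.left x) = W.left (f x)
  f_right : ∀ x, f (V.right x) = W.right (f x)
  f_d : ∀ x, f (V.d x) = W.d (f x)
  g_left : ∀ x, g (W.left x) = V.left (g x)
  g_right : ∀ x, g (W.right x) = V.right (g x)
  g_d : ∀ x, g (W.d x) = V.d (g x)
  -- Commuting with both operators makes the homotopy act on the kernel and on the cokernel of `left
  -- - right`.
  h_left : ∀ x, h (V.left x) = V.left (h x)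
  h_right : ∀ x, h (V.right x) = V.right (h x)
  f_g : ∀ x, f (g x) = x
  g_f : ∀ x, x - g (f x) = V.d (h x) + h (V.d x)

namespace Retract

/-- The composition of two retractions. -/
def trans {U V W : OpComplex} (α : Retract U V) (β : Retract V W) : Retract U W where
  f := β.f ∘ₗ α.f
  g := α.g ∘ₗ β.g
  h := α.h + α.g ∘ₗ β.h ∘ₗ α.f
  f_gr a q t x hx := β.f_gr _ _ _ _ (α.f_gr _ _ _ _ hx)
  f_fil s x hx := β.f_fil _ _ (α.f_fil _ _ hx)
  g_gr a q t x hx := α.g_gr _ _ _ _ (β.g_gr _ _ _ _ hx)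
  g_fil s x hx := α.g_fil _ _ (β.g_fil _ _ hx)
  f_left x := by simp only [LinearMap.comp_apply, α.f_left, β.f_left]
  f_right x := by simp only [LinearMap.comp_apply, α.f_right, β.f_right]
  f_d x := by simp only [LinearMap.comp_apply, α.f_d, β.f_d]
  g_left x := by simp only [LinearMap.comp_apply, α.g_left, β.g_left]
  g_right x := by simp only [LinearMap.comp_apply, α.g_right, β.g_right]
  g_d x := by simp only [LinearMap.comp_apply, α.g_d, β.g_d]
  h_left x := by
    simp only [LinearMap.comp_apply, LinearMap.add_apply, α.f_left, α.h_left, β.h_left, α.g_left,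
      map_add]
  h_right x := by
    simp only [LinearMap.comp_apply, LinearMap.add_apply, α.f_right, α.h_right, β.h_right,
      α.g_right, map_add]
  f_g x := by rw [LinearMap.comp_apply, LinearMap.comp_apply, α.f_g, β.f_g]
  g_f x := by
    have h1 := α.g_f x
    have h2 := congrArg α.g (β.g_f (α.f x))
    simp only [LinearMap.comp_apply, LinearMap.add_apply, α.f_d, map_add, map_sub, α.g_d] at h1 h2 ⊢
    rw [← sub_add_sub_cancel x (α.g (α.f x)), h1, h2]
    abel

/-- The retraction of `σ⁻¹ β` induced by one of `β`. -/
def neg {V W : OpComplex} (α : Retract V W) : Retract V.neg W.neg where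
  f := negMap α.f
  g := negMap α.g
  -- The differential on the two blob summands is `-d`, so the homotopy changes sign there; the two
  -- contributions through the map of the cone then cancel.
  h := LinearMap.prodMap (LinearMap.prodMap (-α.h) (-α.h)) α.h
  f_gr a q t x hx := ⟨⟨α.f_gr _ _ _ _ hx.1.1, α.f_gr _ _ _ _ hx.1.2⟩, α.f_gr _ _ _ _ hx.2⟩
  f_fil s x hx := ⟨⟨α.f_fil _ _ hx.1.1, α.f_fil _ _ hx.1.2⟩, α.f_fil _ _ hx.2⟩
  g_gr a q t x hx := ⟨⟨α.g_gr _ _ _ _ hx.1.1, α.g_gr _ _ _ _ hx.1.2⟩, α.g_gr _ _ _ _ hx.2⟩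
  g_fil s x hx := ⟨⟨α.g_fil _ _ hx.1.1, α.g_fil _ _ hx.1.2⟩, α.g_fil _ _ hx.2⟩
  f_left := fun (x : (V.carrier × V.carrier) × V.carrier) => Prod.ext (Prod.ext (α.f_left _) (by
    change α.f (x.1.1 - V.left x.1.2) = α.f x.1.1 - W.left (α.f x.1.2)
    rw [map_sub, α.f_left])) (α.f_left _)
  f_right := fun (x : (V.carrier × V.carrier) × V.carrier) => Prod.ext (Prod.ext (α.f_right _) (α.f_right _)) (α.f_right _)
  f_d := fun (x : (V.carrier × V.carrier) × V.carrier) => Prod.ext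
    (Prod.ext ((map_neg α.f _).trans (congrArg Neg.neg (α.f_d _)))
      ((map_neg α.f _).trans (congrArg Neg.neg (α.f_d _)))) (by
    change α.f (x.1.1 + V.d x.2) = α.f x.1.1 + W.d (α.f x.2)
    rw [map_add, α.f_d])
  g_left := fun (x : (W.carrier × W.carrier) × W.carrier) => Prod.ext (Prod.ext (α.g_left _) (by
    change α.g (x.1.1 - W.left x.1.2) = α.g x.1.1 - V.left (α.g x.1.2)
    rw [map_sub, α.g_left])) (α.g_left _)
  g_right := fun (x : (W.carrier × W.carrier) × W.carrier) => Prod.ext (Prod.ext (α.g_right _) (α.g_right _)) (α.g_right _)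
  g_d := fun (x : (W.carrier × W.carrier) × W.carrier) => Prod.ext
    (Prod.ext ((map_neg α.g _).trans (congrArg Neg.neg (α.g_d _)))
      ((map_neg α.g _).trans (congrArg Neg.neg (α.g_d _)))) (by
    change α.g (x.1.1 + W.d x.2) = α.g x.1.1 + V.d (α.g x.2)
    rw [map_add, α.g_d])
  h_left := fun (x : (V.carrier × V.carrier) × V.carrier) => Prod.ext (Prod.ext (by
    change -α.h (V.left x.1.1) = V.left (-α.h x.1.1)
    rw [map_neg, α.h_left]) (by
    change -α.h (x.1.1 - V.left x.1.2) = -α.h x.1.1 - V.left (-α.h x.1.2)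
    rw [map_neg, map_sub, α.h_left]
    abel)) (α.h_left _)
  h_right := fun (x : (V.carrier × V.carrier) × V.carrier) => Prod.ext (Prod.ext (by
    change -α.h (V.right x.1.1) = V.right (-α.h x.1.1)
    rw [map_neg, α.h_right]) (by
    change -α.h (V.right x.1.2) = V.right (-α.h x.1.2)
    rw [map_neg, α.h_right])) (α.h_right _)
  f_g := fun (x : (W.carrier × W.carrier) × W.carrier) => Prod.ext (Prod.ext (α.f_g _) (α.f_g _)) (α.f_g _)
  g_f := fun (x : (V.carrier × V.carrier) × V.carrier) => Prod.ext (Prod.ext (by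
    change x.1.1 - α.g (α.f x.1.1) = -V.d (-α.h x.1.1) + -α.h (-V.d x.1.1)
    rw [α.g_f, map_neg, map_neg, neg_neg, neg_neg]) (by
    change x.1.2 - α.g (α.f x.1.2) = -V.d (-α.h x.1.2) + -α.h (-V.d x.1.2)
    rw [α.g_f, map_neg, map_neg, neg_neg, neg_neg])) (by
    change x.2 - α.g (α.f x.2) = (-α.h x.1.1 + V.d (α.h x.2)) + α.h (x.1.1 + V.d x.2)
    rw [α.g_f, map_add]
    abel)

end Retract

end OpComplex

/-! ### The blob tensor product in terms of a basis of the blob bimodule -/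

namespace BlobTensor

variable {k : ℕ} {i : Fin k} {M : Type} [AddCommGroup M] [Module (PolyAlg k) M]

/-- The coefficient of `theta` in the tensor product of the blob bimodule and `M`. -/
def coeffTheta (i : Fin k) : BlobTensor i M →+ M :=
  (TensorProduct.lift (LinearMap.mk₂ (PolyAlg k) (fun (b : Blob k i) (m : M) =>
      Blob.coeffTheta i b • m)
    (fun b b' m => by rw [map_add, add_smul])
    (fun p b m => by rw [Algebra.smul_def, Blob.coeffTheta_algebraMap_mul, mul_smul])
    (fun b m m' => smul_add _ _ _)
    (fun p b m => smul_comm _ _ _))).toAddMonoidHom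

lemma coeffTheta_tmul (b : Blob k i) (m : M) :
    coeffTheta i (tmul i b m) = Blob.coeffTheta i b • m := rfl

lemma add_tmul (b b' : Blob k i) (m : M) : tmul i (b + b') m = tmul i b m + tmul i b' m :=
  TensorProduct.add_tmul _ _ _

lemma tmul_zero (b : Blob k i) : tmul i b (0 : M) = 0 := TensorProduct.tmul_zero _ _

lemma eq_expand (x : BlobTensor i M) :
    x = tmul i 1 (chiMinus i x) + tmul i (Blob.theta i .black) (coeffTheta i x) := by
  induction x using BlobTensor.induction with
  | h0 => rw [map_zero, map_zero, tmul_zero, tmul_zero, add_zero]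
  | ht b m =>
    rw [chiMinus_tmul, coeffTheta_tmul, tmul_smul, tmul_smul, ← add_tmul, mul_one]
    rw [← Blob.eq_expand]
  | ha x y hx hy =>
    conv_lhs => rw [hx, hy]
    rw [map_add, map_add, tmul_add, tmul_add]
    abel

lemma chiMinus_expand (m m' : M) :
    chiMinus i (tmul i 1 m + tmul i (Blob.theta i .black) m') = m := by
  rw [map_add, chiMinus_tmul, chiMinus_tmul, map_one, one_smul, Blob.proj_theta_black, zero_smul,
    add_zero]

lemma coeffTheta_expand (m m' : M) :
    coeffTheta i (tmul i 1 m + tmul i (Blob.theta i .black) m') = m' := by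
  rw [map_add, coeffTheta_tmul, coeffTheta_tmul, Blob.coeffTheta_one, Blob.coeffTheta_theta,
    one_smul, zero_smul, zero_add]

lemma coeffTheta_map (f : M →ₗ[PolyAlg k] M) (x : BlobTensor i M) :
    coeffTheta i (map i f x) = f (coeffTheta i x) := by
  induction x using BlobTensor.induction with
  | h0 => simp only [map_zero]
  | ht b m => rw [map_tmul, coeffTheta_tmul, coeffTheta_tmul, map_smul]
  | ha x y hx hy => simp only [map_add, hx, hy]

lemma coeffTheta_diff_smul (x : BlobTensor i M) :
    coeffTheta i (PolyAlg.diff i • x)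
      = chiMinus i x - PolyAlg.diff i • coeffTheta i x := by
  induction x using BlobTensor.induction with
  | h0 => simp only [map_zero, smul_zero, sub_zero]
  | ht b m =>
    rw [left_smul_tmul, coeffTheta_tmul, coeffTheta_tmul, chiMinus_tmul, Blob.left_diff,
      Blob.coeffTheta_leftDiff_mul, sub_smul, mul_smul]
  | ha x y hx hy =>
    simp only [map_add, smul_add, hx, hy]
    abel

lemma chiMinus_mem_gr {c : Blob.Color} {X : BimodComplex k} {a q : ℤ} {t : ℚ}
    {x : BlobTensor i X.carrier} (hx : x ∈ (ft i c X).gr a q t) : chiMinus i x ∈ X.gr a q t := by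
  refine gr_induction _ (chiMinus i (M := X.carrier)).toAddMonoidHom (fun q' b hb m hm => ?_) hx
  have := X.gr_left _ _ _ _ _ (Blob.proj_mem_polyGr hb) m hm
  rwa [add_sub_cancel] at this

lemma coeffTheta_mem_gr {c : Blob.Color} {X : BimodComplex k} {a q : ℤ} {t : ℚ}
    {x : BlobTensor i X.carrier} (hx : x ∈ (ft i c X).gr a q t) :
    coeffTheta i x ∈ X.gr a (q - 2) t := by
  refine gr_induction _ (coeffTheta i (M := X.carrier)) (fun q' b hb m hm => ?_) hx
  exact X.gr_congr (X.gr_left _ _ _ _ _ (Blob.coeffTheta_mem_polyGr hb) m hm) rfl (by ring) rfl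

lemma chiMinus_mem_fil {X : BimodComplex k} {s : ℚ}
    {x : BlobTensor i X.carrier} (hx : x ∈ (ft i .black X).fil s) : chiMinus i x ∈ X.fil s :=
  chiMinus_fil i X s x (by
    change x ∈ (ft i .black X).fil (s - 0)
    rwa [sub_zero])

/-- The black filtration vanishes above step one, so a nonzero tensor in `F^s` has second factor in
`F^(s-1)` at least. With `expand_mem_fil` this shows that the basis `1`, `theta` of weights zero and
one splits the tensor filtration. -/
lemma coeffTheta_mem_fil {X : BimodComplex k} {s : ℚ}
    {x : BlobTensor i X.carrier} (hx : x ∈ (ft i .black X).fil s) :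
    coeffTheta i x ∈ X.fil (s - 1) := by
  refine fil_induction _ (coeffTheta i (M := X.carrier)) (fun s' b hb m hm => ?_) hx
  rw [coeffTheta_tmul]
  by_cases h : s' ≤ 1
  · exact X.fil_left _ _ _ (X.fil_anti _ _ (by linarith) hm)
  · unfold Blob.fil at hb
    rw [if_neg (by linarith), if_neg h] at hb
    rw [(Submodule.mem_bot ℚ).mp hb, map_zero, zero_smul]
    exact Submodule.zero_mem _

lemma expand_mem_gr {c : Blob.Color} {X : BimodComplex k} {a q : ℤ} {t : ℚ} {m m' : X.carrier}
    (hm : m ∈ X.gr a q t) (hm' : m' ∈ X.gr a (q - 2) t) :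
    (show (ft i c X).carrier from tmul i 1 m + tmul i (Blob.theta i .black) m')
      ∈ (ft i c X).gr a q t := by
  have h1 : (1 : Blob k i) ∈ Blob.gr i 0 := ⟨1, by simpa using C_mem_polyGr 1, map_one (Blob.mk i)⟩
  have h2 : Blob.theta i .black ∈ Blob.gr i 2 := by
    refine ⟨varL i.succ - varL i.castSucc - (varR i.succ - varR i.castSucc), ?_,
      map_sub (Blob.mk i) _ _⟩
    exact Submodule.sub_mem _ (Submodule.sub_mem _ (X_mem_polyGr _) (X_mem_polyGr _))
      (Submodule.sub_mem _ (X_mem_polyGr _) (X_mem_polyGr _))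
  exact Submodule.add_mem _ ((ft i c X).gr_congr (tmul_mem_gr (c := c) h1 hm) rfl (by ring) rfl)
    ((ft i c X).gr_congr (tmul_mem_gr (c := c) h2 hm') rfl (by ring) rfl)

lemma expand_mem_fil {X : BimodComplex k} {s : ℚ} {m m' : X.carrier}
    (hm : m ∈ X.fil s) (hm' : m' ∈ X.fil (s - 1)) :
    (show (ft i .black X).carrier from tmul i 1 m + tmul i (Blob.theta i .black) m')
      ∈ (ft i .black X).fil s := by
  have h1 : (1 : Blob k i) ∈ Blob.fil i .black 0 := by
    unfold Blob.fil
    rw [if_pos le_rfl]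
    trivial
  exact Submodule.add_mem _ ((ft i .black X).fil_congr (tmul_mem_fil h1 hm) (by ring))
    ((ft i .black X).fil_congr (tmul_mem_fil (Blob.theta_mem_fil i .black) hm') (by ring))

end BlobTensor

/-! ### Coordinates on the complex of one more negative crossing -/

namespace BlobTensor

variable {k : ℕ} {i : Fin k} {M : Type} [AddCommGroup M] [Module (PolyAlg k) M] [Module ℚ M]

/-- The coordinates of `[Blob ⊗ M → M]` with respect to the basis of the blob bimodule. -/
def bracketCoords (i : Fin k) : (BlobTensor i M × M) →ₗ[ℚ] ((M × M) × M) :=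
  AddMonoidHom.toRatLinearMap
    { toFun := fun x => ((chiMinus i x.1, coeffTheta i x.1), x.2)
      map_zero' := by simp
      map_add' := fun x y => by simp }

/-- The inverse of `bracketCoords`. -/
def bracketOfCoords (i : Fin k) : ((M × M) × M) →ₗ[ℚ] (BlobTensor i M × M) :=
  AddMonoidHom.toRatLinearMap
    { toFun := fun x => (tmul i 1 x.1.1 + tmul i (Blob.theta i .black) x.1.2, x.2)
      map_zero' := by simp [tmul_zero]
      map_add' := fun x y => by
        simp only [Prod.fst_add, Prod.snd_add, tmul_add, Prod.mk_add_mk]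
        rw [add_add_add_comm] }

lemma bracketCoords_apply (x : BlobTensor i M × M) :
    bracketCoords i x = ((chiMinus i x.1, coeffTheta i x.1), x.2) := rfl

lemma bracketOfCoords_apply (x : (M × M) × M) :
    bracketOfCoords i x = (tmul i 1 x.1.1 + tmul i (Blob.theta i .black) x.1.2, x.2) := rfl

lemma coords_ofCoords (x : (M × M) × M) : bracketCoords i (bracketOfCoords i x) = x := by
  rw [bracketOfCoords_apply, bracketCoords_apply, chiMinus_expand, coeffTheta_expand]

lemma ofCoords_coords (x : BlobTensor i M × M) : bracketOfCoords i (bracketCoords i x) = x := by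
  rw [bracketCoords_apply, bracketOfCoords_apply, ← eq_expand]

/-- The coordinates are bijective, so an intertwining relation for them passes to their inverse. -/
lemma conj_ofCoords {S : (BlobTensor i M × M) → (BlobTensor i M × M)}
    {T : ((M × M) × M) → ((M × M) × M)} (h : ∀ x, bracketCoords i (S x) = T (bracketCoords i x))
    (x : (M × M) × M) : bracketOfCoords i (T x) = S (bracketOfCoords i x) := by
  rw [← ofCoords_coords (S _), h, coords_ofCoords]

end BlobTensor

namespace BimodComplex

variable (X : BimodComplex 1)

lemma coords_left (x : BlobTensor (0 : Fin 1) X.carrier × X.carrier) :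
    BlobTensor.bracketCoords (M := X.carrier) 0 ((X.neg 0).toOp.left x)
      = negLeft X.toOp.left (BlobTensor.bracketCoords (M := X.carrier) 0 x) :=
  Prod.ext (Prod.ext ((BlobTensor.chiMinus (0 : Fin 1)).map_smul (PolyAlg.diff 0) x.1)
    (BlobTensor.coeffTheta_diff_smul x.1)) rfl

lemma coords_right (x : BlobTensor (0 : Fin 1) X.carrier × X.carrier) :
    BlobTensor.bracketCoords (M := X.carrier) 0 ((X.neg 0).toOp.right x)
      = negMap X.toOp.right (BlobTensor.bracketCoords (M := X.carrier) 0 x) :=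
  Prod.ext (Prod.ext (BlobTensor.chiMinus_map 0 X _ x.1) (BlobTensor.coeffTheta_map _ x.1)) rfl

lemma coords_d (x : BlobTensor (0 : Fin 1) X.carrier × X.carrier) :
    BlobTensor.bracketCoords (M := X.carrier) 0 ((X.neg 0).toOp.d x)
      = negD X.toOp.d (BlobTensor.bracketCoords (M := X.carrier) 0 x) :=
  Prod.ext (Prod.ext
    ((map_neg (BlobTensor.chiMinus (0 : Fin 1) (M := X.carrier)) _).trans
      (congrArg Neg.neg (BlobTensor.chiMinus_map 0 X X.d x.1)))
    ((map_neg (BlobTensor.coeffTheta (0 : Fin 1) (M := X.carrier)) _).trans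
      (congrArg Neg.neg (BlobTensor.coeffTheta_map X.d x.1)))) rfl

/-- The complex of `σ⁻¹ β` on two strands, in terms of the basis of the blob bimodule. -/
def retractNeg : (X.neg (0 : Fin 1)).toOp.Retract X.toOp.neg where
  f := BlobTensor.bracketCoords (M := X.carrier) 0
  g := BlobTensor.bracketOfCoords (M := X.carrier) 0
  -- The coordinates are an isomorphism of complexes.
  h := 0
  f_gr a q t := fun (x : BlobTensor (0 : Fin 1) X.carrier × X.carrier) hx => by
    have h1 := BlobTensor.chiMinus_mem_gr (c := .black) hx.1
    have h2 := BlobTensor.coeffTheta_mem_gr (c := .black) hx.1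
    refine ⟨⟨h1, X.gr_congr h2 ?_ ?_ ?_⟩, hx.2⟩
    all_goals simp [shT, shS, shTS, shA]
  f_fil s := fun (x : BlobTensor (0 : Fin 1) X.carrier × X.carrier) hx => by
    refine ⟨⟨X.fil_congr (BlobTensor.chiMinus_mem_fil hx.1) rfl,
      X.fil_congr (BlobTensor.coeffTheta_mem_fil hx.1) ?_⟩, hx.2⟩
    simp [shT, shS, shTS, shA]
  g_gr a q t := fun (x : (X.carrier × X.carrier) × X.carrier) hx => by
    have h2 := hx.1.2
    refine ⟨BlobTensor.expand_mem_gr (c := .black) hx.1.1 (X.gr_congr h2 ?_ ?_ ?_), hx.2⟩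
    all_goals simp [shT, shS, shTS, shA]
  g_fil s := fun (x : (X.carrier × X.carrier) × X.carrier) hx => by
    refine ⟨BlobTensor.expand_mem_fil hx.1.1 (X.fil_congr hx.1.2 ?_), hx.2⟩
    simp [shT, shS, shTS, shA]
  f_left := X.coords_left
  f_right := X.coords_right
  f_d := X.coords_d
  g_left := BlobTensor.conj_ofCoords (M := X.carrier) X.coords_left
  g_right := BlobTensor.conj_ofCoords (M := X.carrier) X.coords_right
  g_d := BlobTensor.conj_ofCoords (M := X.carrier) X.coords_d
  h_left x := (map_zero (X.neg (0 : Fin 1)).toOp.left).symm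
  h_right x := (map_zero (X.neg (0 : Fin 1)).toOp.right).symm
  f_g := BlobTensor.coords_ofCoords (M := X.carrier)
  g_f x := by
    refine (sub_eq_zero.mpr (BlobTensor.ofCoords_coords (i := (0 : Fin 1)) x).symm).trans ?_
    refine (Eq.trans ?_ (add_zero _).symm)
    exact (map_zero (X.neg (0 : Fin 1)).toOp.d).symm

/-- The sum of the variables acts in the same way from the left and from the right. -/
def Central : Prop :=
  ∀ m : X.carrier, (MvPolynomial.X 0 + MvPolynomial.X 1 : PolyAlg 1) • m
    = X.right (MvPolynomial.X 0 + MvPolynomial.X 1) m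

/-- The sum of the variables is symmetric, so by the first blob relation it passes from the left
side of the blob to the intermediate variables, and then through `X`. -/
lemma Central.neg {X : BimodComplex 1} (hX : X.Central) : (X.neg (0 : Fin 1)).Central := by
  have h (x : BlobTensor (0 : Fin 1) X.carrier) :
      (MvPolynomial.X 0 + MvPolynomial.X 1 : PolyAlg 1) • x
        = BlobTensor.right 0 X.right (MvPolynomial.X 0 + MvPolynomial.X 1) x := by
    induction x using BlobTensor.induction with
    | h0 => rw [smul_zero, map_zero]
    | ht b m =>
      have e : Blob.left (0 : Fin 1) (MvPolynomial.X 0 + MvPolynomial.X 1)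
          = algebraMap (PolyAlg 1) (Blob 1 0) (MvPolynomial.X 0 + MvPolynomial.X 1) := by
        rw [← sub_eq_zero, map_add, map_add, add_sub_add_comm, Blob.left_X_sub, Blob.left_X_sub,
          ← map_add]
        apply Blob.mk_eq_zero
        refine Ideal.subset_span (Or.inl (Or.inl ?_))
        change _ = varL 0 + varL 1 - (varR 0 + varR 1)
        ring
      rw [BlobTensor.left_smul_tmul, e, ← BlobTensor.tmul_smul, hX]
      rfl
    | ha x y hx hy => rw [smul_add, hx, hy, LinearMap.map_add]
  exact fun x => Prod.ext (h x.1) (hX x.2)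

lemma central_diag : (BimodComplex.diag 1).Central := fun _ => rfl

end BimodComplex

/-! ### The simplified complexes of the words `σ^{-m}` -/

/-- The sequences that vanish from the index `n` on. -/
def TruncSeq (M : Type) [AddCommGroup M] [Module ℚ M] (n : ℕ) : Submodule ℚ (ℕ → M) where
  carrier := {x | ∀ j, n ≤ j → x j = 0}
  add_mem' hx hy j hj := by rw [Pi.add_apply, hx j hj, hy j hj, add_zero]
  zero_mem' j _ := rfl
  smul_mem' r x hx j hj := by rw [Pi.smul_apply, hx j hj, smul_zero]

namespace TruncSeq

variable {M : Type} [AddCommGroup M] [Module ℚ M] {n : ℕ}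

lemma val_eq_zero (x : TruncSeq M n) {j : ℕ} (hj : n ≤ j) : x.1 j = 0 := x.2 j hj

/-- The inclusion of sequences. -/
def incl (n : ℕ) : TruncSeq M n →ₗ[ℚ] TruncSeq M (n + 1) :=
  LinearMap.restrict LinearMap.id fun x hx j hj => hx j (by omega)

/-- The sequence `0, x 0, x 1, …`. -/
def pre (n : ℕ) : TruncSeq M n →ₗ[ℚ] TruncSeq M (n + 1) :=
  LinearMap.restrict
    { toFun := fun (x : ℕ → M) j => Nat.casesOn j 0 x
      map_add' := fun x y => by
        funext j
        cases j
        · exact (add_zero 0).symm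
        · rfl
      map_smul' := fun r x => by
        funext j
        cases j
        · exact (smul_zero r).symm
        · rfl }
    fun x hx j hj => by
      cases j with
      | zero => rfl
      | succ j => exact hx j (by omega)

/-- The sequence `x 1, x 2, …`. -/
def tail (n : ℕ) : TruncSeq M (n + 1) →ₗ[ℚ] TruncSeq M n :=
  LinearMap.restrict (LinearMap.funLeft ℚ M Nat.succ) fun _ hx j hj => hx (j + 1) (by omega)

/-- The sequence `x 0, 0, 0, …`. -/
def head (n n' : ℕ) : TruncSeq M n →ₗ[ℚ] TruncSeq M (n' + 1) :=
  LinearMap.restrict (LinearMap.single ℚ (fun _ => M) 0 ∘ₗ LinearMap.proj 0) fun x _ j hj => by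
    change (Pi.single 0 (x 0) : ℕ → M) j = 0
    rw [Pi.single_apply, if_neg (by omega)]

/-- The sequence `f 0 (x 0), f 1 (x 1), …`. -/
def map (f : ℕ → M →ₗ[ℚ] M) (n : ℕ) : TruncSeq M n →ₗ[ℚ] TruncSeq M n :=
  LinearMap.restrict (LinearMap.pi fun j => f j ∘ₗ LinearMap.proj j) fun x hx j hj => by
    change f j (x j) = 0
    rw [hx j hj, map_zero]

@[simp] lemma incl_val (x : TruncSeq M n) (j : ℕ) : (incl n x).1 j = x.1 j := rfl
@[simp] lemma pre_val_zero (x : TruncSeq M n) : (pre n x).1 0 = 0 := rfl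
@[simp] lemma pre_val_succ (x : TruncSeq M n) (j : ℕ) : (pre n x).1 (j + 1) = x.1 j := rfl
@[simp] lemma tail_val (x : TruncSeq M (n + 1)) (j : ℕ) : (tail n x).1 j = x.1 (j + 1) := rfl
@[simp] lemma head_val_zero {n' : ℕ} (x : TruncSeq M n) : (head n n' x).1 0 = x.1 0 := rfl
@[simp] lemma head_val_succ {n' : ℕ} (x : TruncSeq M n) (j : ℕ) : (head n n' x).1 (j + 1) = 0 := rfl
@[simp] lemma map_val (f : ℕ → M →ₗ[ℚ] M) (x : TruncSeq M n) (j : ℕ) :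
    (map f n x).1 j = f j (x.1 j) := rfl
@[simp] lemma add_val (x y : TruncSeq M n) (j : ℕ) : (x + y).1 j = x.1 j + y.1 j := rfl
@[simp] lemma sub_val (x y : TruncSeq M n) (j : ℕ) : (x - y).1 j = x.1 j - y.1 j := rfl
@[simp] lemma neg_val (x : TruncSeq M n) (j : ℕ) : (-x).1 j = -x.1 j := rfl
@[simp] lemma zero_val (j : ℕ) : (0 : TruncSeq M n).1 j = 0 := rfl

lemma ext {x y : TruncSeq M n} (h : ∀ j, x.1 j = y.1 j) : x = y := Subtype.ext (funext h)

end TruncSeq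

/-- The sequences of length `n` whose entries have the given degree shifts. -/
def FTVect.trunc (R : FTVect) (c : ℕ → Shift) (n : ℕ) : FTVect where
  carrier := TruncSeq R.carrier n
  gr a q t := (Submodule.pi Set.univ fun j => (R.shift (c j)).gr a q t).comap
    (TruncSeq R.carrier n).subtype
  fil s := (Submodule.pi Set.univ fun j => (R.shift (c j)).fil s).comap
    (TruncSeq R.carrier n).subtype

namespace FTVect

variable {R : FTVect} {n n' : ℕ} {c c' : ℕ → Shift}

/-- The maps between simplified complexes only move entries to other indices, so homogeneity amounts
to comparing the shifts attached to the indices. -/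
lemma trunc_gr_of {a a' q q' : ℤ} {t t' : ℚ} {x : TruncSeq R.carrier n}
    (hx : x ∈ (R.trunc c n).gr a q t) {y : TruncSeq R.carrier n'}
    (h : ∀ j, y.1 j = 0 ∨ ∃ i, y.1 j = x.1 i ∧ a - (c i).1 = a' - (c' j).1 ∧
      q - (c i).2.1 = q' - (c' j).2.1 ∧ t - (c i).2.2.1 = t' - (c' j).2.2.1) :
    y ∈ (R.trunc c' n').gr a' q' t' := fun j _ => by
  change y.1 j ∈ R.gr _ _ _
  rcases h j with h | ⟨i, h, h1, h2, h3⟩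
  · rw [h]
    exact Submodule.zero_mem _
  · rw [h]
    exact R.gr_congr (hx i trivial) h1 h2 h3

lemma trunc_fil_of {s s' : ℚ} {x : TruncSeq R.carrier n}
    (hx : x ∈ (R.trunc c n).fil s) {y : TruncSeq R.carrier n'}
    (h : ∀ j, y.1 j = 0 ∨ ∃ i, y.1 j = x.1 i ∧ s - (c i).2.2.2 = s' - (c' j).2.2.2) :
    y ∈ (R.trunc c' n').fil s' := fun j _ => by
  change y.1 j ∈ R.fil _
  rcases h j with h | ⟨i, h, h1⟩
  · rw [h]
    exact Submodule.zero_mem _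
  · rw [h]
    exact R.fil_congr (hx i trivial) h1

end FTVect

/-- The operator `(-1)^j b` on the entry of index `j`. -/
def altMap {M : Type} [AddCommGroup M] [Module ℚ M] (b : M →ₗ[ℚ] M) (j : ℕ) : M →ₗ[ℚ] M :=
  (-1 : ℚ) ^ j • b

lemma altMap_zero {M : Type} [AddCommGroup M] [Module ℚ M] (b : M →ₗ[ℚ] M) (x : M) :
    altMap b 0 x = b x := by simp [altMap]

lemma altMap_succ {M : Type} [AddCommGroup M] [Module ℚ M] (b : M →ₗ[ℚ] M) (j : ℕ) (x : M) :
    altMap b (j + 1) x = -altMap b j x := by simp [altMap, pow_succ]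

/-! ### The simplified complex and the cancellation after adding a crossing -/

section torusOperators

variable {M : Type} [AddCommGroup M] [Module ℚ M]

/-- The left operator of the simplified complex. -/
def torusLeft (b : M →ₗ[ℚ] M) (m : ℕ) :
    (TruncSeq M m × TruncSeq M (m + 1)) →ₗ[ℚ] (TruncSeq M m × TruncSeq M (m + 1)) :=
  -- On the pair `u j`, `v (j + 1)` this is the left action on a blob: in the basis `1`, `theta` of
  -- the black generator for even `j`, and in that of the green generator for odd `j`.
  (TruncSeq.map (altMap b) m ∘ₗ LinearMap.fst ℚ _ _).prod
    (TruncSeq.pre m ∘ₗ LinearMap.fst ℚ _ _ + TruncSeq.map (altMap b) (m + 1) ∘ₗ LinearMap.snd ℚ _ _)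

/-- The right operator of the simplified complex. -/
def torusRight (b : M →ₗ[ℚ] M) (m : ℕ) :
    (TruncSeq M m × TruncSeq M (m + 1)) →ₗ[ℚ] (TruncSeq M m × TruncSeq M (m + 1)) :=
  LinearMap.prodMap (TruncSeq.map (fun _ => b) m) (TruncSeq.map (fun _ => b) (m + 1))

/-- The differential of the simplified complex. -/
def torusD (M : Type) [AddCommGroup M] [Module ℚ M] (m : ℕ) :
    (TruncSeq M m × TruncSeq M (m + 1)) →ₗ[ℚ] (TruncSeq M m × TruncSeq M (m + 1)) :=
  (0 : _ →ₗ[ℚ] TruncSeq M m).prod (TruncSeq.incl m ∘ₗ LinearMap.fst ℚ _ _)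

/-- The projection of the complex of `σ⁻¹ σ^{-m}` to the simplified complex. -/
def torusProj (M : Type) [AddCommGroup M] [Module ℚ M] (m : ℕ) :
    (((TruncSeq M m × TruncSeq M (m + 1)) × (TruncSeq M m × TruncSeq M (m + 1))) ×
      (TruncSeq M m × TruncSeq M (m + 1))) →ₗ[ℚ] (TruncSeq M (m + 1) × TruncSeq M (m + 1 + 1)) where
  -- Write the argument as `(((u, v), (u', v')), (U, V))`, the primed part being the coefficient of
  -- `theta`. What survives is `v 0`, `V 0`, `u'` and `v'`; the part `u` cancels against `U`, and
  -- the positive indices of `v` against those of `V`. The remaining terms are the corrections that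
  -- make the map commute with the operators and the differential.
  toFun x := (x.1.1.2 - TruncSeq.pre m x.1.2.1 + TruncSeq.incl m x.2.1,
    TruncSeq.pre (m + 1) x.1.2.2 + TruncSeq.incl (m + 1) x.2.2)
  map_add' x y := by
    simp only [Prod.fst_add, Prod.snd_add, map_add, Prod.mk_add_mk]
    congr 1 <;> abel
  map_smul' r x := by
    simp only [Prod.smul_fst, Prod.smul_snd, map_smul, RingHom.id_apply, Prod.smul_mk,
      smul_add, smul_sub]

/-- The inclusion of the simplified complex into the complex of `σ⁻¹ σ^{-m}`. -/
def torusIncl (M : Type) [AddCommGroup M] [Module ℚ M] (m : ℕ) :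
    (TruncSeq M (m + 1) × TruncSeq M (m + 1 + 1)) →ₗ[ℚ]
      (((TruncSeq M m × TruncSeq M (m + 1)) × (TruncSeq M m × TruncSeq M (m + 1))) ×
        (TruncSeq M m × TruncSeq M (m + 1))) where
  toFun x := (((0, TruncSeq.head (m + 1) m x.1), (-TruncSeq.tail m x.1, TruncSeq.tail (m + 1) x.2)),
    (0, TruncSeq.head (m + 1 + 1) m x.2))
  map_add' x y := by
    simp only [Prod.fst_add, Prod.snd_add, map_add, Prod.mk_add_mk, add_zero, neg_add]
  map_smul' r x := by
    simp only [Prod.smul_fst, Prod.smul_snd, map_smul, RingHom.id_apply, Prod.smul_mk,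
      smul_neg, smul_zero]

/-- The homotopy of the retraction to the simplified complex. -/
def torusHomotopy (M : Type) [AddCommGroup M] [Module ℚ M] (m : ℕ) :
    (((TruncSeq M m × TruncSeq M (m + 1)) × (TruncSeq M m × TruncSeq M (m + 1))) ×
        (TruncSeq M m × TruncSeq M (m + 1))) →ₗ[ℚ]
      (((TruncSeq M m × TruncSeq M (m + 1)) × (TruncSeq M m × TruncSeq M (m + 1))) ×
        (TruncSeq M m × TruncSeq M (m + 1))) where
  -- The first two entries invert the map of the cone on `U` and on the tail of `V`. The entry at
  -- `theta` is forced by commutation with the left operator.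
  toFun x := (((x.2.1, TruncSeq.pre m (TruncSeq.tail m x.2.2)), (TruncSeq.tail m x.2.2, 0)), 0)
  map_add' x y := by
    simp only [Prod.fst_add, Prod.snd_add, map_add, Prod.mk_add_mk, add_zero]
  map_smul' r x := by
    simp only [Prod.smul_fst, Prod.smul_snd, map_smul, RingHom.id_apply, Prod.smul_mk, smul_zero]

variable (b : M →ₗ[ℚ] M) {m : ℕ}

lemma torusLeft_apply (x : TruncSeq M m × TruncSeq M (m + 1)) : torusLeft b m x
    = (TruncSeq.map (altMap b) m x.1, TruncSeq.pre m x.1 + TruncSeq.map (altMap b) (m + 1) x.2) := rfl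

lemma torusRight_apply (x : TruncSeq M m × TruncSeq M (m + 1)) : torusRight b m x
    = (TruncSeq.map (fun _ => b) m x.1, TruncSeq.map (fun _ => b) (m + 1) x.2) := rfl

lemma torusD_apply (x : TruncSeq M m × TruncSeq M (m + 1)) : torusD M m x
    = (0, TruncSeq.incl m x.1) := rfl

lemma torusProj_apply (x) : torusProj M m x
    = (x.1.1.2 - TruncSeq.pre m x.1.2.1 + TruncSeq.incl m x.2.1,
      TruncSeq.pre (m + 1) x.1.2.2 + TruncSeq.incl (m + 1) x.2.2) := rfl

lemma torusIncl_apply (x) : torusIncl M m x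
    = (((0, TruncSeq.head (m + 1) m x.1), (-TruncSeq.tail m x.1, TruncSeq.tail (m + 1) x.2)),
      (0, TruncSeq.head (m + 1 + 1) m x.2)) := rfl

lemma torusHomotopy_apply (x) : torusHomotopy M m x
    = (((x.2.1, TruncSeq.pre m (TruncSeq.tail m x.2.2)), (TruncSeq.tail m x.2.2, 0)), 0) := rfl

lemma negLeft_apply (c : M →ₗ[ℚ] M) (x : (M × M) × M) :
    negLeft c x = ((c x.1.1, x.1.1 - c x.1.2), c x.2) := rfl

lemma negD_apply (d : M →ₗ[ℚ] M) (x : (M × M) × M) :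
    negD d x = ((-d x.1.1, -d x.1.2), x.1.1 + d x.2) := rfl

lemma negMap_apply {N : Type} [AddCommGroup N] [Module ℚ N] (f : M →ₗ[ℚ] N) (x : (M × M) × M) :
    negMap f x = ((f x.1.1, f x.1.2), f x.2) := rfl

/-- The left operator changes sign on the coefficient of `theta`, and `pre` raises the index by one,
which changes the sign of `altMap`; the two changes agree. -/
lemma torusProj_left (x) :
    torusProj M m (negLeft (torusLeft b m) x) = torusLeft b (m + 1) (torusProj M m x) := by
  simp only [torusProj_apply, negLeft_apply, torusLeft_apply]
  refine Prod.ext (TruncSeq.ext fun j => ?_) (TruncSeq.ext fun j => ?_) <;>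
    rcases j with _ | _ | j <;> simp [altMap_succ] <;> abel

lemma torusProj_right (x) :
    torusProj M m (negMap (torusRight b m) x) = torusRight b (m + 1) (torusProj M m x) := by
  simp only [torusProj_apply, negMap_apply, torusRight_apply]
  refine Prod.ext (TruncSeq.ext fun j => ?_) (TruncSeq.ext fun j => ?_) <;>
    rcases j with _ | _ | j <;> simp

lemma torusProj_d (x) :
    torusProj M m (negD (torusD M m) x) = torusD M (m + 1) (torusProj M m x) := by
  simp only [torusProj_apply, negD_apply, torusD_apply]
  refine Prod.ext (TruncSeq.ext fun j => ?_) (TruncSeq.ext fun j => ?_) <;>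
    rcases j with _ | _ | j <;> simp <;> abel

lemma torusIncl_left (x) :
    torusIncl M m (torusLeft b (m + 1) x) = negLeft (torusLeft b m) (torusIncl M m x) := by
  simp only [torusIncl_apply, negLeft_apply, torusLeft_apply]
  refine Prod.ext (Prod.ext (Prod.ext ?_ ?_) (Prod.ext ?_ ?_)) (Prod.ext ?_ ?_) <;>
    refine TruncSeq.ext fun j => ?_ <;>
    rcases j with _ | j <;> simp [altMap_succ, altMap_zero] <;>
    try abel

lemma torusIncl_right (x) :
    torusIncl M m (torusRight b (m + 1) x) = negMap (torusRight b m) (torusIncl M m x) := by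
  simp only [torusIncl_apply, negMap_apply, torusRight_apply]
  refine Prod.ext (Prod.ext (Prod.ext ?_ ?_) (Prod.ext ?_ ?_)) (Prod.ext ?_ ?_) <;>
    refine TruncSeq.ext fun j => ?_ <;>
    rcases j with _ | _ | j <;> simp

lemma torusIncl_d (x) :
    torusIncl M m (torusD M (m + 1) x) = negD (torusD M m) (torusIncl M m x) := by
  simp only [torusIncl_apply, negD_apply, torusD_apply]
  refine Prod.ext (Prod.ext (Prod.ext ?_ ?_) (Prod.ext ?_ ?_)) (Prod.ext ?_ ?_) <;>
    refine TruncSeq.ext fun j => ?_ <;>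
    rcases j with _ | _ | j <;> simp

lemma torusHomotopy_left (x) :
    torusHomotopy M m (negLeft (torusLeft b m) x)
      = negLeft (torusLeft b m) (torusHomotopy M m x) := by
  simp only [torusHomotopy_apply, negLeft_apply, torusLeft_apply]
  refine Prod.ext (Prod.ext (Prod.ext ?_ ?_) (Prod.ext ?_ ?_)) (Prod.ext ?_ ?_) <;>
    refine TruncSeq.ext fun j => ?_ <;>
    rcases j with _ | j <;> simp [altMap_succ, altMap_zero] <;>
    try abel

lemma torusHomotopy_right (x) :
    torusHomotopy M m (negMap (torusRight b m) x)
      = negMap (torusRight b m) (torusHomotopy M m x) := by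
  simp only [torusHomotopy_apply, negMap_apply, torusRight_apply]
  refine Prod.ext (Prod.ext (Prod.ext ?_ ?_) (Prod.ext ?_ ?_)) (Prod.ext ?_ ?_) <;>
    refine TruncSeq.ext fun j => ?_ <;>
    rcases j with _ | _ | j <;> simp

lemma torusProj_torusIncl (x) : torusProj M m (torusIncl M m x) = x := by
  simp only [torusProj_apply, torusIncl_apply]
  refine Prod.ext (TruncSeq.ext fun j => ?_) (TruncSeq.ext fun j => ?_) <;>
    rcases j with _ | _ | j <;> simp

lemma torusIncl_torusProj (x) : x - torusIncl M m (torusProj M m x)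
    = negD (torusD M m) (torusHomotopy M m x) + torusHomotopy M m (negD (torusD M m) x) := by
  simp only [torusProj_apply, torusIncl_apply, negD_apply, torusHomotopy_apply, torusD_apply]
  refine Prod.ext (Prod.ext (Prod.ext ?_ ?_) (Prod.ext ?_ ?_)) (Prod.ext ?_ ?_) <;>
    refine TruncSeq.ext fun j => ?_ <;>
    rcases j with _ | j <;>
    simp <;> try abel

end torusOperators

/-- The simplified complex of `σ^{-m}`, up to a degree shift, where `R` is the algebra of the
diagonal bimodule with the operator of multiplication by `x₁ - x₀`. -/
def OpComplex.torus (R : FTVect) (b : R.carrier →ₗ[ℚ] R.carrier) (c : Shift) (m : ℕ) :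
    OpComplex where
  toFTVect := ((R.trunc (fun j => shT + j • shTot) m).sum
    (R.trunc (fun j => j • shTot) (m + 1))).shift c
  left := torusLeft b m
  right := torusRight b m
  d := torusD R.carrier m

/-- The complex of `σ⁻¹ σ^{-m}` retracts to the simplified complex of `σ^{-(m+1)}`. -/
def OpComplex.retractTorus (R : FTVect) (b : R.carrier →ₗ[ℚ] R.carrier) (c : Shift) (m : ℕ) :
    (OpComplex.torus R b c m).neg.Retract (OpComplex.torus R b (c - (shTS + shA)) (m + 1)) where
  f := torusProj R.carrier m
  g := torusIncl R.carrier m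
  h := torusHomotopy R.carrier m
  f_gr a q t := fun x ⟨⟨⟨_, hv⟩, ⟨hu', hv'⟩⟩, ⟨hU, hV⟩⟩ => by
    refine ⟨add_mem (sub_mem (trunc_gr_of hv fun j => .inr ⟨j, rfl, ?_⟩)
      (trunc_gr_of hu' fun j => ?_)) (trunc_gr_of hU fun j => .inr ⟨j, rfl, ?_⟩),
      add_mem (trunc_gr_of hv' fun j => ?_) (trunc_gr_of hV fun j => .inr ⟨j, rfl, ?_⟩)⟩
    · simp [shT, shS, shTS, shA, shTot]
      try ring_nf
      try simp
    -- The extra shift of the `theta` summand is `shT + shS = shTot`, exactly one step of the index,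
    -- as produced by `pre`.
    · rcases j with _ | j
      · exact .inl rfl
      · refine .inr ⟨j, rfl, ?_⟩
        simp [shT, shS, shTS, shA, shTot]
        try ring_nf
        try simp
    · simp [shT, shS, shTS, shA, shTot]
      try ring_nf
      try simp
    · rcases j with _ | j
      · exact .inl rfl
      · refine .inr ⟨j, rfl, ?_⟩
        simp [shT, shS, shTS, shA, shTot]
        try ring_nf
        try simp
    · simp [shT, shS, shTS, shA, shTot]
      try ring_nf
      try simp
  f_fil s := fun x ⟨⟨⟨_, hv⟩, ⟨hu', hv'⟩⟩, ⟨hU, hV⟩⟩ => by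
    refine ⟨add_mem (sub_mem (trunc_fil_of hv fun j => .inr ⟨j, rfl, ?_⟩)
      (trunc_fil_of hu' fun j => ?_)) (trunc_fil_of hU fun j => .inr ⟨j, rfl, ?_⟩),
      add_mem (trunc_fil_of hv' fun j => ?_) (trunc_fil_of hV fun j => .inr ⟨j, rfl, ?_⟩)⟩
    · simp [shT, shS, shTS, shA, shTot]
      try ring_nf
      try simp
    · rcases j with _ | j
      · exact .inl rfl
      · refine .inr ⟨j, rfl, ?_⟩
        simp [shT, shS, shTS, shA, shTot]
        try ring_nf
        try simp
    · simp [shT, shS, shTS, shA, shTot]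
      try ring_nf
      try simp
    · rcases j with _ | j
      · exact .inl rfl
      · refine .inr ⟨j, rfl, ?_⟩
        simp [shT, shS, shTS, shA, shTot]
        try ring_nf
        try simp
    · simp [shT, shS, shTS, shA, shTot]
      try ring_nf
      try simp
  g_gr a q t := fun x ⟨hp, hq⟩ => by
    refine ⟨⟨⟨zero_mem _, trunc_gr_of hp fun j => ?_⟩,
      ⟨neg_mem (trunc_gr_of hp fun j => .inr ⟨j + 1, rfl, ?_⟩),
        trunc_gr_of hq fun j => .inr ⟨j + 1, rfl, ?_⟩⟩⟩,
      ⟨zero_mem _, trunc_gr_of hq fun j => ?_⟩⟩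
    · rcases j with _ | j
      · refine .inr ⟨0, rfl, ?_⟩
        simp [shT, shS, shTS, shA, shTot]
        try ring_nf
        try simp
      · exact .inl rfl
    · simp [shT, shS, shTS, shA, shTot]
      try ring_nf
      try simp
    · simp [shT, shS, shTS, shA, shTot]
      try ring_nf
      try simp
    · rcases j with _ | j
      · refine .inr ⟨0, rfl, ?_⟩
        simp [shT, shS, shTS, shA, shTot]
        try ring_nf
        try simp
      · exact .inl rfl
  g_fil s := fun x ⟨hp, hq⟩ => by
    refine ⟨⟨⟨zero_mem _, trunc_fil_of hp fun j => ?_⟩,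
      ⟨neg_mem (trunc_fil_of hp fun j => .inr ⟨j + 1, rfl, ?_⟩),
        trunc_fil_of hq fun j => .inr ⟨j + 1, rfl, ?_⟩⟩⟩,
      ⟨zero_mem _, trunc_fil_of hq fun j => ?_⟩⟩
    · rcases j with _ | j
      · refine .inr ⟨0, rfl, ?_⟩
        simp [shT, shS, shTS, shA, shTot]
        try ring_nf
        try simp
      · exact .inl rfl
    · simp [shT, shS, shTS, shA, shTot]
      try ring_nf
      try simp
    · simp [shT, shS, shTS, shA, shTot]
      try ring_nf
      try simp
    · rcases j with _ | j
      · refine .inr ⟨0, rfl, ?_⟩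
        simp [shT, shS, shTS, shA, shTot]
        try ring_nf
        try simp
      · exact .inl rfl
  f_left := torusProj_left b
  f_right := torusProj_right b
  f_d := torusProj_d
  g_left := torusIncl_left b
  g_right := torusIncl_right b
  g_d := torusIncl_d
  h_left := torusHomotopy_left b
  h_right := torusHomotopy_right b
  f_g := torusProj_torusIncl
  g_f := torusIncl_torusProj

/-! ### Computing the iterated homology -/

namespace FTVect

variable {V Z : FTVect} {d d' : V.carrier →ₗ[ℚ] V.carrier} (h : ∀ v, d (d' v) = d' (d v))

/-- The class of a cycle. -/
def homologyClass (V : FTVect) (d : V.carrier →ₗ[ℚ] V.carrier) :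
    LinearMap.ker d →ₗ[ℚ] (V.homology d).carrier := Submodule.mkQ _

lemma homologyClass_surjective (x : (V.homology d).carrier) : ∃ v, homologyClass V d v = x :=
  Submodule.mkQ_surjective _ x

lemma homologyClass_eq_zero {v : LinearMap.ker d} :
    homologyClass V d v = 0 ↔ v.1 ∈ LinearMap.range d :=
  Submodule.Quotient.mk_eq_zero _

lemma homologyMap_class (v : LinearMap.ker d) :
    V.homologyMap d d' h (homologyClass V d v)
      = homologyClass V d ⟨d' v.1, by rw [LinearMap.mem_ker, h, v.2, map_zero]⟩ := rfl

/-- The map on homology induced by a map that kills the boundaries. -/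
def homologyDesc {M : Type} [AddCommGroup M] [Module ℚ M] (F : V.carrier →ₗ[ℚ] M)
    (hF : ∀ x, F (d x) = 0) : (V.homology d).carrier →ₗ[ℚ] M :=
  Submodule.liftQ _ (F ∘ₗ (LinearMap.ker d).subtype) (by
    rintro ⟨_, hx⟩ ⟨y, rfl⟩
    exact hF y)

/-- A criterion for the iterated homology of two commuting operators to be `Z`. -/
theorem iteratedHomology_isomorphic (F : V.carrier →ₗ[ℚ] Z.carrier) (G : Z.carrier →ₗ[ℚ] V.carrier)
    (F_gr : ∀ a q t, ∀ x ∈ V.gr a q t, F x ∈ Z.gr a q t) (F_fil : ∀ s, ∀ x ∈ V.fil s, F x ∈ Z.fil s)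
    (G_gr : ∀ a q t, ∀ x ∈ Z.gr a q t, G x ∈ V.gr a q t) (G_fil : ∀ s, ∀ x ∈ Z.fil s, G x ∈ V.fil s)
    (d_G : ∀ z, d (G z) = 0) (d'_G : ∀ z, d' (G z) ∈ LinearMap.range d)
    (F_d : ∀ x, F (d x) = 0) (F_d' : ∀ x, d x = 0 → F (d' x) = 0) (F_G : ∀ z, F (G z) = z)
    (G_F : ∀ x, d x = 0 → d' x ∈ LinearMap.range d →
      ∃ y w, d w = 0 ∧ x - G (F x) = d y + d' w) :
    ((V.homology d).homology (V.homologyMap d d' h)).Isomorphic Z := by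
  set H := V.homology d
  set D : H.carrier →ₗ[ℚ] H.carrier := V.homologyMap d d' h with hD
  set F1 : H.carrier →ₗ[ℚ] Z.carrier := homologyDesc F F_d
  have hF1 : ∀ x, F1 (D x) = 0 := fun x => by
    obtain ⟨v, rfl⟩ := homologyClass_surjective x
    rw [hD, homologyMap_class]
    exact F_d' _ v.2
  set F2 : (H.homology D).carrier →ₗ[ℚ] Z.carrier := homologyDesc F1 hF1
  have key (x : (H.homology D).carrier) : ∃ (v : LinearMap.ker d)
      (hv : D (homologyClass V d v) = 0), homologyClass H D ⟨homologyClass V d v, hv⟩ = x := by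
    obtain ⟨⟨y, hy⟩, rfl⟩ := homologyClass_surjective x
    obtain ⟨v, rfl⟩ := homologyClass_surjective y
    exact ⟨v, hy, rfl⟩
  have hG (z : Z.carrier) : D (homologyClass V d ⟨G z, d_G z⟩) = 0 := by
    rw [hD, homologyMap_class, homologyClass_eq_zero]
    exact d'_G z
  let G2 (z : Z.carrier) : (H.homology D).carrier := homologyClass H D ⟨_, hG z⟩
  have hFG (z : Z.carrier) : F2 (G2 z) = z := F_G z
  have hinj : Function.Injective F2 := by
    rw [injective_iff_map_eq_zero]
    intro x hx
    obtain ⟨v, hv, rfl⟩ := key x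
    have hv0 : F v.1 = 0 := hx
    rw [hD, homologyMap_class, homologyClass_eq_zero] at hv
    obtain ⟨y, w, hw, e⟩ := G_F v.1 v.2 hv
    rw [hv0, map_zero, sub_zero] at e
    rw [homologyClass_eq_zero]
    have hw' : d (d' w) = 0 := by rw [h, hw, map_zero]
    refine ⟨homologyClass V d ⟨w, hw⟩, sub_eq_zero.mp ?_⟩
    change homologyClass V d ⟨d' w, hw'⟩ - homologyClass V d v = 0
    rw [← map_sub, homologyClass_eq_zero]
    refine ⟨-y, ?_⟩
    change d (-y) = d' w - v.1
    rw [e, map_neg]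
    abel
  -- The map `F` bounds the induced subspace from above, and `G` supplies representatives inside `S`
  -- for all of `T`; this gives equality without any strictness of the differentials.
  have hsub (S : Submodule ℚ V.carrier) (T : Submodule ℚ Z.carrier) (h1 : ∀ x ∈ S, F x ∈ T)
      (h2 : ∀ x ∈ T, G x ∈ S) : (inducedSub D (inducedSub d S)).map F2 = T := by
    ext z
    constructor
    · rintro ⟨_, ⟨⟨_, hy⟩, ⟨v, hv, rfl⟩, rfl⟩, rfl⟩
      exact h1 _ hv
    · intro hz
      exact ⟨G2 z, ⟨⟨_, hG z⟩, ⟨⟨G z, d_G z⟩, h2 z hz, rfl⟩, rfl⟩, hFG z⟩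
  refine ⟨LinearEquiv.ofBijective F2 ⟨hinj, fun z => ⟨G2 z, hFG z⟩⟩, fun a q t => ?_, fun s => ?_⟩
  · exact hsub _ _ (F_gr a q t) (G_gr a q t)
  · exact hsub _ _ (F_fil s) (G_fil s)

end FTVect

/-- Maps that identify the homology of `d` on the cokernel of `left - right` with `Zc`, and on the
kernel of `left - right` with `Zk`. -/
structure OpComplex.HomologyData (V : OpComplex) (Zc Zk : FTVect) where
  Fc : V.carrier →ₗ[ℚ] Zc.carrier
  Gc : Zc.carrier →ₗ[ℚ] V.carrier
  Fk : V.carrier →ₗ[ℚ] Zk.carrier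
  Gk : Zk.carrier →ₗ[ℚ] V.carrier
  Fc_gr : ∀ a q t, ∀ x ∈ V.gr a q t, Fc x ∈ Zc.gr a q t
  Fc_fil : ∀ s, ∀ x ∈ V.fil s, Fc x ∈ Zc.fil s
  Gc_gr : ∀ a q t, ∀ x ∈ Zc.gr a q t, Gc x ∈ V.gr a q t
  Gc_fil : ∀ s, ∀ x ∈ Zc.fil s, Gc x ∈ V.fil s
  Fk_gr : ∀ a q t, ∀ x ∈ V.gr a q t, Fk x ∈ Zk.gr a q t
  Fk_fil : ∀ s, ∀ x ∈ V.fil s, Fk x ∈ Zk.fil s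
  Gk_gr : ∀ a q t, ∀ x ∈ Zk.gr a q t, Gk x ∈ V.gr a q t
  Gk_fil : ∀ s, ∀ x ∈ Zk.fil s, Gk x ∈ V.fil s
  Fc_diff : ∀ x, Fc (V.left x - V.right x) = 0
  Fc_d : ∀ x, Fc (V.d x) = 0
  -- On the cokernel a representative is a cycle only modulo the image of `left - right`; on the
  -- kernel, `d_Gk` asks for a true cycle.
  d_Gc : ∀ z, ∃ y, V.d (Gc z) = V.left y - V.right y
  Fc_Gc : ∀ z, Fc (Gc z) = z
  Gc_Fc : ∀ x, (∃ y, V.d x = V.left y - V.right y) →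
    ∃ y w, x - Gc (Fc x) = V.left y - V.right y + V.d w
  Fk_d : ∀ x, V.left x = V.right x → Fk (V.d x) = 0
  diff_Gk : ∀ z, V.left (Gk z) = V.right (Gk z)
  d_Gk : ∀ z, V.d (Gk z) = 0
  Fk_Gk : ∀ z, Fk (Gk z) = z
  -- The correction `w` has to lie in the kernel as well, because the boundaries are those of the
  -- subcomplex.
  Gk_Fk : ∀ x, V.left x = V.right x → V.d x = 0 →
    ∃ w, V.left w = V.right w ∧ x - Gk (Fk x) = V.d w

namespace OpComplex.HomologyData

/-- Transport of the homology along a retraction. -/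
def comp {V W : OpComplex} {Zc Zk : FTVect} (D : W.HomologyData Zc Zk) (α : V.Retract W) :
    V.HomologyData Zc Zk where
  Fc := D.Fc ∘ₗ α.f
  Gc := α.g ∘ₗ D.Gc
  Fk := D.Fk ∘ₗ α.f
  Gk := α.g ∘ₗ D.Gk
  Fc_gr a q t x hx := D.Fc_gr _ _ _ _ (α.f_gr _ _ _ _ hx)
  Fc_fil s x hx := D.Fc_fil _ _ (α.f_fil _ _ hx)
  Gc_gr a q t x hx := α.g_gr _ _ _ _ (D.Gc_gr _ _ _ _ hx)
  Gc_fil s x hx := α.g_fil _ _ (D.Gc_fil _ _ hx)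
  Fk_gr a q t x hx := D.Fk_gr _ _ _ _ (α.f_gr _ _ _ _ hx)
  Fk_fil s x hx := D.Fk_fil _ _ (α.f_fil _ _ hx)
  Gk_gr a q t x hx := α.g_gr _ _ _ _ (D.Gk_gr _ _ _ _ hx)
  Gk_fil s x hx := α.g_fil _ _ (D.Gk_fil _ _ hx)
  Fc_diff x := by
    rw [LinearMap.comp_apply, map_sub, α.f_left, α.f_right, D.Fc_diff]
  Fc_d x := by rw [LinearMap.comp_apply, α.f_d, D.Fc_d]
  d_Gc z := by
    obtain ⟨y, hy⟩ := D.d_Gc z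
    exact ⟨α.g y, by rw [LinearMap.comp_apply, ← α.g_d, hy, map_sub, α.g_left, α.g_right]⟩
  Fc_Gc z := by
    rw [LinearMap.comp_apply, LinearMap.comp_apply, α.f_g, D.Fc_Gc]
  Gc_Fc x := by
    rintro ⟨y, hy⟩
    obtain ⟨y', w, e⟩ := D.Gc_Fc (α.f x) ⟨α.f y, by
      rw [← α.f_d, hy, map_sub, α.f_left, α.f_right]⟩
    -- In `x - g (f x) = d (h x) + h (d x)` the last term is the image of `h y` under `left -
    -- right`, since `h` commutes with both operators.
    refine ⟨α.h y + α.g y', α.h x + α.g w, ?_⟩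
    have e' := congrArg α.g e
    have h1 := α.g_f x
    rw [hy, map_sub α.h, α.h_left, α.h_right] at h1
    rw [map_sub, map_add, map_sub, α.g_left, α.g_right, α.g_d] at e'
    rw [LinearMap.comp_apply, LinearMap.comp_apply, ← sub_add_sub_cancel x (α.g (α.f x)), h1, e']
    simp only [map_add]
    abel
  Fk_d x hx := by
    rw [LinearMap.comp_apply, α.f_d, D.Fk_d]
    rw [← α.f_left, hx, α.f_right]
  diff_Gk z := by rw [LinearMap.comp_apply, ← α.g_left, D.diff_Gk, α.g_right]
  d_Gk z := by rw [LinearMap.comp_apply, ← α.g_d, D.d_Gk, map_zero]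
  Fk_Gk z := by rw [LinearMap.comp_apply, LinearMap.comp_apply, α.f_g, D.Fk_Gk]
  Gk_Fk x hx hd := by
    obtain ⟨w, hw, e⟩ := D.Gk_Fk (α.f x) (by rw [← α.f_left, hx, α.f_right])
      (by rw [← α.f_d, hd, map_zero])
    refine ⟨α.h x + α.g w, ?_, ?_⟩
    · rw [map_add, map_add, ← α.h_left, ← α.h_right, ← α.g_left, ← α.g_right, hx, hw]
    · have e' := congrArg α.g e
      have h1 := α.g_f x
      rw [hd, map_zero, add_zero] at h1
      rw [map_sub, α.g_d] at e'
      rw [LinearMap.comp_apply, LinearMap.comp_apply, ← sub_add_sub_cancel x (α.g (α.f x)), h1, e',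
        map_add]

end OpComplex.HomologyData

/-! ### Hochschild homology on two strands -/

namespace BimodComplex

variable {X : BimodComplex 1}

lemma finset_fin_two (S : Finset (Fin 2)) : S = ∅ ∨ S = {0} ∨ S = {1} ∨ S = {0, 1} := by
  revert S
  decide

/-- The element of the Koszul complex with the given components. -/
def koszulMk {M : Type} (w x y z : M) (S : Finset (Fin 2)) : M :=
  if S = ∅ then w else if S = {0} then x else if S = {1} then y else z

section

variable {M : Type} (w x y z : M)

lemma koszulMk_empty : koszulMk w x y z ∅ = w := if_pos rfl
lemma koszulMk_zero : koszulMk w x y z {0} = x := by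
  rw [koszulMk, if_neg (by decide), if_pos rfl]
lemma koszulMk_one : koszulMk w x y z {1} = y := by
  rw [koszulMk, if_neg (by decide), if_neg (by decide), if_pos rfl]
lemma koszulMk_univ : koszulMk w x y z {0, 1} = z := by
  rw [koszulMk, if_neg (by decide), if_neg (by decide), if_neg (by decide)]

lemma koszul_ext {f g : Finset (Fin 2) → M} (h0 : f ∅ = g ∅) (h1 : f {0} = g {0})
    (h2 : f {1} = g {1}) (h3 : f {0, 1} = g {0, 1}) : f = g := by
  funext S
  rcases finset_fin_two S with rfl | rfl | rfl | rfl <;> assumption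

end

/-- The difference of the left and the right action of `x₁ - x₀`. -/
def diffOp (X : BimodComplex 1) : X.carrier →ₗ[ℚ] X.carrier := X.toOp.left - X.toOp.right

/-- Centrality says that `varDiff 0 + varDiff 1 = 0`, and `diffOp` is `varDiff 1 - varDiff 0`;
solving gives the factor one half. -/
lemma Central.varDiff_one (hX : X.Central) (m : X.carrier) :
    X.varDiff 1 m = (1 / 2 : ℚ) • X.diffOp m := by
  have h := hX m
  rw [map_add, add_smul] at h
  change (MvPolynomial.X 1 : PolyAlg 1) • m - X.right (MvPolynomial.X 1) m
    = (1 / 2 : ℚ) • ((MvPolynomial.X 1 - MvPolynomial.X 0 : PolyAlg 1) • m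
      - X.right (MvPolynomial.X 1 - MvPolynomial.X 0) m)
  rw [map_sub, sub_smul]
  simp only [LinearMap.sub_apply, LinearMap.add_apply] at h ⊢
  generalize (MvPolynomial.X 1 : PolyAlg 1) • m = x1 at h ⊢
  generalize (MvPolynomial.X 0 : PolyAlg 1) • m = x0 at h ⊢
  rw [eq_sub_of_add_eq' h]
  module

lemma Central.varDiff_zero (hX : X.Central) (m : X.carrier) :
    X.varDiff 0 m = -((1 / 2 : ℚ) • X.diffOp m) := by
  rw [← hX.varDiff_one, eq_neg_iff_add_eq_zero]
  have h := hX m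
  rw [map_add, add_smul] at h
  simp only [varDiff, LinearMap.sub_apply, LinearMap.smul_apply, LinearMap.id_apply,
    LinearMap.add_apply] at h ⊢
  rw [eq_sub_of_add_eq' h]
  abel

lemma inner_apply (f : Finset (Fin 2) → X.carrier) (T : Finset (Fin 2)) :
    X.inner f T = ∑ j ∈ Tᶜ, ((-1 : ℚ) ^ (T.filter (· < j)).card) • X.varDiff j (f (insert j T)) := by
  simp only [inner, LinearMap.pi_apply, LinearMap.sum_apply, LinearMap.smul_apply,
    LinearMap.comp_apply, LinearMap.proj_apply, LinearMap.restrictScalars_apply]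

/-- With opposite operators, the Koszul complex is that of the single operator `diffOp`, tensored
with a second exterior generator of zero differential. This accounts for the doubling by `𝐚𝐪²` in
the answer. -/
lemma Central.inner_eq (hX : X.Central) (f : Finset (Fin 2) → X.carrier) :
    X.inner f = koszulMk ((1 / 2 : ℚ) • X.diffOp (f {1} - f {0}))
      (-((1 / 2 : ℚ) • X.diffOp (f {0, 1}))) (-((1 / 2 : ℚ) • X.diffOp (f {0, 1}))) 0 := by
  have h0 : (∅ : Finset (Fin 2))ᶜ = {0, 1} := by decide
  have h1 : ({0} : Finset (Fin 2))ᶜ = {1} := by decide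
  have h2 : ({1} : Finset (Fin 2))ᶜ = {0} := by decide
  have h3 : ({0, 1} : Finset (Fin 2))ᶜ = ∅ := by decide
  have i1 : insert (1 : Fin 2) {0} = ({0, 1} : Finset (Fin 2)) := by decide
  have c1 : (({0} : Finset (Fin 2)).filter (· < 1)).card = 1 := by decide
  have c2 : (({1} : Finset (Fin 2)).filter (· < 0)).card = 0 := by decide
  apply koszul_ext
  · rw [koszulMk_empty, inner_apply, h0, Finset.sum_pair (by decide)]
    simp only [Finset.filter_empty, Finset.card_empty, pow_zero, one_smul, insert_empty_eq]
    rw [hX.varDiff_zero, hX.varDiff_one, map_sub, smul_sub]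
    abel
  · rw [koszulMk_zero, inner_apply, h1, Finset.sum_singleton, i1, c1, hX.varDiff_one, pow_one,
      neg_one_smul]
  · rw [koszulMk_one, inner_apply, h2, Finset.sum_singleton, c2, hX.varDiff_zero, pow_zero,
      one_smul]
  · rw [koszulMk_univ, inner_apply, h3, Finset.sum_empty]

end BimodComplex

namespace BimodComplex

/-! The Koszul complex on two strands, in terms of plain vector spaces. -/

variable {M A B : Type} [AddCommGroup M] [Module ℚ M] [AddCommGroup A] [Module ℚ A]
  [AddCommGroup B] [Module ℚ B]

/-- The Koszul differential of two opposite operators. -/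
def koszulD (δ : M →ₗ[ℚ] M) (f : Finset (Fin 2) → M) : Finset (Fin 2) → M :=
  koszulMk ((1 / 2 : ℚ) • δ (f {1} - f {0}))
      (-((1 / 2 : ℚ) • δ (f {0, 1}))) (-((1 / 2 : ℚ) • δ (f {0, 1}))) 0

lemma koszulD_eq_zero_iff (δ : M →ₗ[ℚ] M) (f : Finset (Fin 2) → M) :
    koszulD δ f = 0 ↔ δ (f {1} - f {0}) = 0 ∧ δ (f {0, 1}) = 0 := by
  have h2 (x : M) : (1 / 2 : ℚ) • x = 0 ↔ x = 0 := by
    rw [smul_eq_zero]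
    norm_num
  unfold koszulD
  constructor
  · intro h
    have e0 := congrFun h ∅
    have e1 := congrFun h {0}
    rw [koszulMk_empty] at e0
    rw [koszulMk_zero] at e1
    exact ⟨(h2 _).mp e0, (h2 _).mp (neg_eq_zero.mp e1)⟩
  · rintro ⟨e0, e1⟩
    rw [e0, e1, smul_zero, neg_zero]
    apply koszul_ext
    · rw [koszulMk_empty]; rfl
    · rw [koszulMk_zero]; rfl
    · rw [koszulMk_one]; rfl
    · rw [koszulMk_univ]; rfl

/-- The factors `2` cancel the halves in `koszulD`. All boundaries have this shape, with equal
components at the two generators. -/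
lemma koszulD_mk (δ : M →ₗ[ℚ] M) (x y : M) :
    koszulD δ (koszulMk 0 0 ((2 : ℚ) • x) (-((2 : ℚ) • y))) = koszulMk (δ x) (δ y) (δ y) 0 := by
  rw [koszulD, koszulMk_one, koszulMk_zero, koszulMk_univ, sub_zero]
  simp only [map_neg, map_smul]
  congr 1 <;> module

/-- The projection of the Koszul complex to the iterated homology. -/
def koszulProj (Fc : M →ₗ[ℚ] A) (Fk : M →ₗ[ℚ] B) :
    (Finset (Fin 2) → M) →ₗ[ℚ] ((A × B) × (A × B)) :=
  ((Fc ∘ₗ LinearMap.proj (R := ℚ) (φ := fun _ : Finset (Fin 2) => M) ∅).prod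
    (Fk ∘ₗ (LinearMap.proj (R := ℚ) (φ := fun _ : Finset (Fin 2) => M) {1}
      - LinearMap.proj (R := ℚ) (φ := fun _ : Finset (Fin 2) => M) {0}))).prod
  ((Fc ∘ₗ LinearMap.proj (R := ℚ) (φ := fun _ : Finset (Fin 2) => M) {0}).prod
    (Fk ∘ₗ LinearMap.proj (R := ℚ) (φ := fun _ : Finset (Fin 2) => M) {0, 1}))

lemma koszulProj_apply (Fc : M →ₗ[ℚ] A) (Fk : M →ₗ[ℚ] B) (f : Finset (Fin 2) → M) :
    koszulProj Fc Fk f = ((Fc (f ∅), Fk (f {1} - f {0})), (Fc (f {0}), Fk (f {0, 1}))) := rfl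

/-- Representatives of the iterated homology in the Koszul complex. -/
def koszulIncl (Gc : A →ₗ[ℚ] M) (Gk : B →ₗ[ℚ] M) :
    ((A × B) × (A × B)) →ₗ[ℚ] (Finset (Fin 2) → M) where
  -- In degree one the cokernel class lies on the diagonal, as the boundaries do, so that the
  -- difference of the two components reads off the kernel class alone.
  toFun z := koszulMk (Gc z.1.1) (Gc z.2.1) (Gc z.2.1 + Gk z.1.2) (Gk z.2.2)
  map_add' z z' := by
    apply koszul_ext <;>
      simp only [Pi.add_apply, koszulMk_empty, koszulMk_zero, koszulMk_one, koszulMk_univ,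
        Prod.fst_add, Prod.snd_add, map_add]
    exact add_add_add_comm _ _ _ _
  map_smul' r z := by
    apply koszul_ext <;>
      simp only [Pi.smul_apply, koszulMk_empty, koszulMk_zero, koszulMk_one, koszulMk_univ,
        Prod.smul_fst, Prod.smul_snd, map_smul, RingHom.id_apply, smul_add]

lemma koszulIncl_apply (Gc : A →ₗ[ℚ] M) (Gk : B →ₗ[ℚ] M) (z) : koszulIncl Gc Gk z
    = koszulMk (Gc z.1.1) (Gc z.2.1) (Gc z.2.1 + Gk z.1.2) (Gk z.2.2) := rfl

variable {δ d : M →ₗ[ℚ] M} {Fc : M →ₗ[ℚ] A} {Fk : M →ₗ[ℚ] B} {Gc : A →ₗ[ℚ] M} {Gk : B →ₗ[ℚ] M}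

lemma koszulD_incl (diff_Gk : ∀ z, δ (Gk z) = 0) (z) : koszulD δ (koszulIncl Gc Gk z) = 0 := by
  refine (koszulD_eq_zero_iff _ _).mpr ⟨?_, ?_⟩
  · rw [koszulIncl_apply, koszulMk_one, koszulMk_zero, add_sub_cancel_left, diff_Gk]
  · rw [koszulIncl_apply, koszulMk_univ, diff_Gk]

lemma koszulD_incl_outer (d_Gc : ∀ z, ∃ y, d (Gc z) = δ y) (d_Gk : ∀ z, d (Gk z) = 0) (z) :
    ∃ y, koszulD δ y = fun S => d (koszulIncl Gc Gk z S) := by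
  obtain ⟨y, hy⟩ := d_Gc z.1.1
  obtain ⟨y', hy'⟩ := d_Gc z.2.1
  refine ⟨_, (koszulD_mk δ y y').trans (koszul_ext ?_ ?_ ?_ ?_)⟩
  · rw [koszulMk_empty, koszulIncl_apply, koszulMk_empty, hy]
  · rw [koszulMk_zero, koszulIncl_apply, koszulMk_zero, hy']
  · rw [koszulMk_one, koszulIncl_apply, koszulMk_one, map_add, hy', d_Gk, add_zero]
  · rw [koszulMk_univ, koszulIncl_apply, koszulMk_univ, d_Gk]

lemma koszulProj_koszulD (Fc_diff : ∀ x, Fc (δ x) = 0) (f) :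
    koszulProj Fc Fk (koszulD δ f) = 0 := by
  rw [koszulProj_apply, koszulD, koszulMk_empty, koszulMk_zero, koszulMk_one, koszulMk_univ,
    sub_self, map_neg, map_smul, map_smul, Fc_diff, Fc_diff, map_zero, smul_zero, neg_zero]
  rfl

lemma koszulProj_outer (Fc_d : ∀ x, Fc (d x) = 0) (Fk_d : ∀ x, δ x = 0 → Fk (d x) = 0) {f}
    (hf : koszulD δ f = 0) : koszulProj Fc Fk (fun S => d (f S)) = 0 := by
  obtain ⟨h1, h2⟩ := (koszulD_eq_zero_iff δ f).mp hf
  rw [koszulProj_apply, Fc_d, Fc_d, Fk_d _ h2, ← map_sub, Fk_d _ h1]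
  rfl

lemma koszulProj_incl (Fc_Gc : ∀ z, Fc (Gc z) = z) (Fk_Gk : ∀ z, Fk (Gk z) = z) (z) :
    koszulProj Fc Fk (koszulIncl Gc Gk z) = z := by
  rw [koszulProj_apply, koszulIncl_apply, koszulMk_empty, koszulMk_zero, koszulMk_one,
    koszulMk_univ, add_sub_cancel_left, Fc_Gc, Fc_Gc, Fk_Gk, Fk_Gk]

lemma koszulIncl_proj
    (Gc_Fc : ∀ x, (∃ y, d x = δ y) → ∃ y w, x - Gc (Fc x) = δ y + d w)
    (Gk_Fk : ∀ x, δ x = 0 → d x = 0 → ∃ w, δ w = 0 ∧ x - Gk (Fk x) = d w) {f}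
    (hf : koszulD δ f = 0) (hd : ∃ g, koszulD δ g = fun S => d (f S)) :
    ∃ y w, koszulD δ w = 0 ∧
      f - koszulIncl Gc Gk (koszulProj Fc Fk f) = koszulD δ y + fun S => d (w S) := by
  obtain ⟨h1, h2⟩ := (koszulD_eq_zero_iff δ f).mp hf
  obtain ⟨g, hg⟩ := hd
  have g0 := congrFun hg ∅
  have g1 := congrFun hg {0}
  have g2 := congrFun hg {1}
  have g3 := congrFun hg {0, 1}
  rw [koszulD, koszulMk_empty] at g0
  rw [koszulD, koszulMk_zero] at g1
  rw [koszulD, koszulMk_one] at g2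
  rw [koszulD, koszulMk_univ] at g3
  -- The outer differential of `f` is a Koszul boundary, and those have equal components at `{0}`
  -- and `{1}`.
  have hk : d (f {1} - f {0}) = 0 := by rw [map_sub, ← g1, ← g2, sub_self]
  obtain ⟨y0, w0, e0⟩ := Gc_Fc (f ∅) ⟨(1 / 2 : ℚ) • (g {1} - g {0}), by rw [← g0, map_smul]⟩
  obtain ⟨y1, w1, e1⟩ := Gc_Fc (f {0}) ⟨-((1 / 2 : ℚ) • g {0, 1}), by
    rw [← g1, map_neg, map_smul]⟩
  obtain ⟨w2, hw2, e2⟩ := Gk_Fk _ h1 hk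
  obtain ⟨w3, hw3, e3⟩ := Gk_Fk _ h2 g3.symm
  -- Repeating `w1` at both generators makes their difference `w2`, which lies in the kernel of `δ`;
  -- hence the second witness is a Koszul cycle.
  refine ⟨koszulMk 0 0 ((2 : ℚ) • y0) (-((2 : ℚ) • y1)), koszulMk w0 w1 (w1 + w2) w3, ?_, ?_⟩
  · refine (koszulD_eq_zero_iff _ _).mpr ⟨?_, ?_⟩
    · rw [koszulMk_one, koszulMk_zero, add_sub_cancel_left, hw2]
    · rw [koszulMk_univ, hw3]
  · rw [koszulD_mk, koszulProj_apply, koszulIncl_apply]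
    apply koszul_ext <;> simp only [Pi.add_apply, Pi.sub_apply, koszulMk_empty, koszulMk_zero,
      koszulMk_one, koszulMk_univ]
    · exact e0
    · exact e1
    · rw [map_add, ← e2, ← add_assoc, ← e1]
      abel
    · rw [e3, zero_add]

variable {X : BimodComplex 1} {Zc Zk : FTVect}

/-- The homology of a closure on two strands, in terms of the kernel and the cokernel of the
difference of the left and right actions. -/
theorem outerHomology_isomorphic (hX : X.Central) (D : X.toOp.HomologyData Zc Zk) :
    X.outerHomology.Isomorphic
      ((Zc.sum (Zk.shift shA)).sum ((Zc.sum (Zk.shift shA)).shift shA)) := by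
  have hin (f : Finset (Fin 2) → X.carrier) : X.inner f = koszulD X.diffOp f := hX.inner_eq f
  have hk (x : X.carrier) : X.diffOp x = 0 ↔ X.toOp.left x = X.toOp.right x := sub_eq_zero
  refine iteratedHomology_isomorphic (V := X.koszul) (d := X.inner) (d' := X.outer)
    (Z := (Zc.sum (Zk.shift shA)).sum ((Zc.sum (Zk.shift shA)).shift shA)) X.inner_outer
    (koszulProj (M := X.carrier) D.Fc D.Fk) (koszulIncl (M := X.carrier) D.Gc D.Gk)
    ?_ ?_ ?_ ?_ ?_ ?_ ?_ ?_ ?_ ?_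
  · intro a q t f hf
    have h0 : f ∅ ∈ X.gr _ _ _ := hf ∅ trivial
    have h1 : f {0} ∈ X.gr _ _ _ := hf {0} trivial
    have h2 : f {1} ∈ X.gr _ _ _ := hf {1} trivial
    have h3 : f {0, 1} ∈ X.gr _ _ _ := hf {0, 1} trivial
    refine ⟨⟨D.Fc_gr _ _ _ _ (X.gr_congr h0 ?_ ?_ ?_),
      D.Fk_gr _ _ _ _ (sub_mem (X.gr_congr h2 ?_ ?_ ?_) (X.gr_congr h1 ?_ ?_ ?_))⟩,
      ⟨D.Fc_gr _ _ _ _ (X.gr_congr h1 ?_ ?_ ?_), D.Fk_gr _ _ _ _ (X.gr_congr h3 ?_ ?_ ?_)⟩⟩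
    all_goals simp [shA]
    all_goals ring
  · intro s f hf
    have h0 : f ∅ ∈ X.fil _ := hf ∅ trivial
    have h1 : f {0} ∈ X.fil _ := hf {0} trivial
    have h2 : f {1} ∈ X.fil _ := hf {1} trivial
    have h3 : f {0, 1} ∈ X.fil _ := hf {0, 1} trivial
    refine ⟨⟨D.Fc_fil _ _ h0,
      D.Fk_fil _ _ (sub_mem (X.fil_congr h2 ?_) (X.fil_congr h1 ?_))⟩,
      ⟨D.Fc_fil _ _ (X.fil_congr h1 ?_), D.Fk_fil _ _ (X.fil_congr h3 ?_)⟩⟩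
    all_goals simp [shA]
  · rintro a q t z ⟨⟨h0, h1⟩, ⟨h2, h3⟩⟩ S -
    have h0 := D.Gc_gr _ _ _ _ h0
    have h1 := D.Gk_gr _ _ _ _ h1
    have h2 := D.Gc_gr _ _ _ _ h2
    have h3 := D.Gk_gr _ _ _ _ h3
    change koszulMk _ _ _ _ S ∈ _
    rcases finset_fin_two S with rfl | rfl | rfl | rfl
    · rw [koszulMk_empty]
      exact X.gr_congr h0 (by simp) (by simp) rfl
    · rw [koszulMk_zero]
      exact X.gr_congr h2 (by simp [shA]) (by simp [shA]) (by simp [shA])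
    · rw [koszulMk_one]
      exact add_mem (X.gr_congr h2 (by simp [shA]) (by simp [shA]) (by simp [shA]))
        (X.gr_congr h1 (by simp [shA]) (by simp [shA]) (by simp [shA]))
    · rw [koszulMk_univ]
      exact X.gr_congr h3 (by simp [shA]; ring) (by simp [shA]; ring) (by simp [shA])
  · rintro s z ⟨⟨h0, h1⟩, ⟨h2, h3⟩⟩ S -
    have h0 := D.Gc_fil _ _ h0
    have h1 := D.Gk_fil _ _ h1
    have h2 := D.Gc_fil _ _ h2
    have h3 := D.Gk_fil _ _ h3
    change koszulMk _ _ _ _ S ∈ _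
    rcases finset_fin_two S with rfl | rfl | rfl | rfl
    · rw [koszulMk_empty]
      exact h0
    · rw [koszulMk_zero]
      exact X.fil_congr h2 (by simp [shA])
    · rw [koszulMk_one]
      exact add_mem (X.fil_congr h2 (by simp [shA])) (X.fil_congr h1 (by simp [shA]))
    · rw [koszulMk_univ]
      exact X.fil_congr h3 (by simp [shA])
  · exact fun z => (hin _).trans (koszulD_incl (M := X.carrier) (fun z => (hk _).mpr (D.diff_Gk z)) z)
  · intro z
    obtain ⟨y, hy⟩ := koszulD_incl_outer (M := X.carrier) (δ := X.diffOp)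
      (d := X.d.restrictScalars ℚ) D.d_Gc D.d_Gk z
    exact ⟨y, (hin y).trans hy⟩
  · intro f
    exact (congrArg (koszulProj (M := X.carrier) D.Fc D.Fk) (hin f)).trans
      (koszulProj_koszulD (M := X.carrier) (δ := X.diffOp) D.Fc_diff f)
  · intro f hf
    exact koszulProj_outer (M := X.carrier) (δ := X.diffOp) (d := X.d.restrictScalars ℚ) D.Fc_d
      (fun x hx => D.Fk_d x ((hk x).mp hx)) ((hin f).symm.trans hf)
  · exact fun z => koszulProj_incl (M := X.carrier) D.Fc_Gc D.Fk_Gk z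
  · rintro f hf ⟨g, hg⟩
    obtain ⟨y, w, hw, e⟩ := koszulIncl_proj (M := X.carrier) (δ := X.diffOp)
      (d := X.d.restrictScalars ℚ) (Gc := D.Gc) (Fc := D.Fc) (Gk := D.Gk) (Fk := D.Fk) D.Gc_Fc
      (fun x hx hd => by
        obtain ⟨w, hw, e⟩ := D.Gk_Fk x ((hk x).mp hx) hd
        exact ⟨w, (hk w).mpr hw, e⟩)
      ((hin f).symm.trans hf) ⟨g, (hin g).symm.trans hg⟩
    exact ⟨y, w, (hin w).trans hw,
      e.trans (congrArg (fun z : Finset (Fin 2) → X.carrier => z + X.outer w) (hin y).symm)⟩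

end BimodComplex

/-! ### The homology of the simplified complexes -/

/-- Division by an injective operator `b` with a complement isomorphic to `A` of its image. -/
structure DivisionData (M A : Type) [AddCommGroup M] [Module ℚ M] [AddCommGroup A]
    [Module ℚ A] where
  b : M →ₗ[ℚ] M
  quo : M →ₗ[ℚ] M
  rem : M →ₗ[ℚ] A
  const : A →ₗ[ℚ] M
  quo_b : ∀ x, quo (b x) = x
  rem_b : ∀ x, rem (b x) = 0
  rem_const : ∀ z, rem (const z) = z
  quo_const : ∀ z, quo (const z) = 0
  b_quo : ∀ x, b (quo x) = x - const (rem x)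

namespace TruncSeq

variable {M A : Type} [AddCommGroup M] [Module ℚ M] [AddCommGroup A] [Module ℚ A]

/-- The value of index `j`. -/
def eval (m j : ℕ) : TruncSeq M m →ₗ[ℚ] M := LinearMap.proj j ∘ₗ (TruncSeq M m).subtype

lemma eval_apply (m j : ℕ) (x : TruncSeq M m) : eval m j x = x.1 j := rfl

/-- The sequence whose only entry is at the index `p`. -/
def single {m : ℕ} (p : ℕ) (hp : p < m) : M →ₗ[ℚ] TruncSeq M m :=
  LinearMap.codRestrict _ (LinearMap.single ℚ (fun _ => M) p) fun x j hj => by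
    change (Pi.single p x : ℕ → M) j = 0
    rw [Pi.single_apply, if_neg (by omega)]

lemma single_val {m p : ℕ} (hp : p < m) (x : M) (j : ℕ) :
    (single p hp x).1 j = if j = p then x else 0 := Pi.single_apply _ _ _

/-- The sequence with the entries `z k` at the indices `2 * k + r`. -/
def spread {n m : ℕ} (r : ℕ) (h : 2 * n + r ≤ m + 1) : (Fin n → M) →ₗ[ℚ] TruncSeq M m :=
  -- The largest index is `2 * (n - 1) + r`, so the bound `m + 1` in `h` is the sharp one.
  ∑ k : Fin n, single (2 * k + r) (by omega) ∘ₗ LinearMap.proj k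

lemma spread_val {n m r : ℕ} (h : 2 * n + r ≤ m + 1) (z : Fin n → M) (j : ℕ) :
    (spread (m := m) r h z).1 j = ∑ k : Fin n, if j = 2 * k + r then z k else 0 := by
  rw [← eval_apply, spread, LinearMap.sum_apply, map_sum]
  exact Finset.sum_congr rfl fun k _ => single_val (m := m) (p := 2 * k + r) (by omega) (z k) j

lemma spread_val_self {n m r : ℕ} (h : 2 * n + r ≤ m + 1) (z : Fin n → M) (k : Fin n) :
    (spread (m := m) r h z).1 (2 * k + r) = z k := by
  rw [spread_val, Finset.sum_eq_single k, if_pos rfl]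
  · intro k' _ hk
    rw [if_neg fun e => hk (Fin.ext (by omega))]
  · simp

lemma spread_val_of_ne {n m r : ℕ} (h : 2 * n + r ≤ m + 1) (z : Fin n → M) {j : ℕ}
    (hj : ∀ k < n, j ≠ 2 * k + r) : (spread (m := m) r h z).1 j = 0 := by
  rw [spread_val]
  exact Finset.sum_eq_zero fun k _ => if_neg (hj k k.2)

lemma spread_val_lt {n m r k : ℕ} (h : 2 * n + r ≤ m + 1) (z : Fin n → M) (hk : k < n) :
    (spread (m := m) r h z).1 (2 * k + r) = z ⟨k, hk⟩ := spread_val_self h z ⟨k, hk⟩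

/-- The sequence with the entries `f k` at the indices `2 * k` and `g k` at the indices
`2 * k + 1`. -/
def interleave (m : ℕ) (f g : ℕ → M) : TruncSeq M m :=
  ⟨fun j => if j < m then if Even j then f (j / 2) else g (j / 2) else 0,
    fun _ hj => if_neg (not_lt.mpr hj)⟩

lemma interleave_even {m : ℕ} (f g : ℕ → M) (k : ℕ) :
    (interleave m f g).1 (2 * k) = if 2 * k < m then f k else 0 := by
  change (if 2 * k < m then if Even (2 * k) then f (2 * k / 2) else g (2 * k / 2) else 0) = _
  rw [if_pos (even_two_mul k), Nat.mul_div_cancel_left k two_pos]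

lemma interleave_odd {m : ℕ} (f g : ℕ → M) (k : ℕ) :
    (interleave m f g).1 (2 * k + 1) = if 2 * k + 1 < m then g k else 0 := by
  change (if 2 * k + 1 < m then
    if Even (2 * k + 1) then f ((2 * k + 1) / 2) else g ((2 * k + 1) / 2) else 0) = _
  rw [if_neg (Nat.not_even_two_mul_add_one k), show (2 * k + 1) / 2 = k by omega]

lemma ext_parity {m : ℕ} {x y : TruncSeq M m} (h0 : ∀ k, x.1 (2 * k) = y.1 (2 * k))
    (h1 : ∀ k, x.1 (2 * k + 1) = y.1 (2 * k + 1)) : x = y :=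
  TruncSeq.ext fun j => by
    obtain ⟨k, rfl | rfl⟩ := Nat.even_or_odd' j
    · exact h0 k
    · exact h1 k

lemma ext_parity_succ {m : ℕ} {x y : TruncSeq M m} (h0 : x.1 0 = y.1 0)
    (h1 : ∀ k, x.1 (2 * k + 1) = y.1 (2 * k + 1))
    (h2 : ∀ k, x.1 (2 * k + 2) = y.1 (2 * k + 2)) : x = y :=
  ext_parity (fun k => by
    rcases k with _ | k
    · exact h0
    · exact h2 k) h1

end TruncSeq

/-! ### The difference of the two actions, index by index -/

section torusDiff

variable {M : Type} [AddCommGroup M] [Module ℚ M] (b : M →ₗ[ℚ] M) {m : ℕ}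

lemma altMap_even (k : ℕ) (x : M) : altMap b (2 * k) x = b x := by
  simp [altMap, pow_mul]

lemma altMap_odd (k : ℕ) (x : M) : altMap b (2 * k + 1) x = -b x := by
  rw [altMap_succ, altMap_even]

/-- The difference of the left and the right operator of the simplified complex. -/
def torusDiff (m : ℕ) : (TruncSeq M m × TruncSeq M (m + 1)) →ₗ[ℚ]
    (TruncSeq M m × TruncSeq M (m + 1)) := torusLeft b m - torusRight b m

variable (x : TruncSeq M m × TruncSeq M (m + 1))

lemma torusDiff_fst_even (k : ℕ) : (torusDiff b m x).1.1 (2 * k) = 0 := by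
  change altMap b (2 * k) (x.1.1 (2 * k)) - b (x.1.1 (2 * k)) = 0
  rw [altMap_even, sub_self]

lemma torusDiff_fst_odd (k : ℕ) :
    (torusDiff b m x).1.1 (2 * k + 1) = b ((-2 : ℚ) • x.1.1 (2 * k + 1)) := by
  change altMap b (2 * k + 1) (x.1.1 (2 * k + 1)) - b (x.1.1 (2 * k + 1)) = _
  rw [altMap_odd, map_smul]
  module

lemma torusDiff_snd_zero : (torusDiff b m x).2.1 0 = 0 := by
  change 0 + altMap b 0 (x.2.1 0) - b (x.2.1 0) = 0
  rw [altMap_zero, zero_add, sub_self]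

lemma torusDiff_snd_odd (k : ℕ) :
    (torusDiff b m x).2.1 (2 * k + 1) = x.1.1 (2 * k) + b ((-2 : ℚ) • x.2.1 (2 * k + 1)) := by
  change x.1.1 (2 * k) + altMap b (2 * k + 1) (x.2.1 (2 * k + 1)) - b (x.2.1 (2 * k + 1)) = _
  rw [altMap_odd, map_smul]
  module

lemma torusDiff_snd_even (k : ℕ) : (torusDiff b m x).2.1 (2 * k + 2) = x.1.1 (2 * k + 1) := by
  change x.1.1 (2 * k + 1) + altMap b (2 * (k + 1)) (x.2.1 (2 * k + 2)) - b (x.2.1 (2 * k + 2)) = _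
  rw [altMap_even, add_sub_cancel_right]

lemma torusDiff_eq_zero_iff : torusLeft b m x = torusRight b m x ↔ torusDiff b m x = 0 :=
  sub_eq_zero.symm

lemma torusD_fst : (torusD M m x).1 = 0 := rfl

lemma torusD_snd (j : ℕ) : (torusD M m x).2.1 j = x.1.1 j := rfl

end torusDiff

/-! ### Cycles on the cokernel and the kernel, reduced modulo boundaries -/

namespace DivisionData

variable {M A : Type} [AddCommGroup M] [Module ℚ M] [AddCommGroup A] [Module ℚ A]
  (S : DivisionData M A) {m n : ℕ}

lemma b_injective {x : M} (h : S.b x = 0) : x = 0 := by rw [← S.quo_b x, h, map_zero]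

/-- The classes in the cokernel of `torusDiff` at the odd indices. -/
def cokerProj (n m : ℕ) : (TruncSeq M m × TruncSeq M (m + 1)) →ₗ[ℚ] (Fin n → A) :=
  LinearMap.pi fun k => S.rem ∘ₗ TruncSeq.eval m (2 * k + 1) ∘ₗ LinearMap.fst ℚ _ _

/-- Representatives of the classes in the cokernel of `torusDiff` at the odd indices. -/
def cokerIncl (h : 2 * n + 1 ≤ m + 1) : (Fin n → A) →ₗ[ℚ] (TruncSeq M m × TruncSeq M (m + 1)) :=
  LinearMap.inl ℚ _ _ ∘ₗ TruncSeq.spread 1 h ∘ₗ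
    LinearMap.pi fun k => S.const ∘ₗ LinearMap.proj k

/-- The classes in the kernel of `torusDiff` at the even indices. -/
def kerProj (n m : ℕ) : (TruncSeq M m × TruncSeq M (m + 1)) →ₗ[ℚ] (A × (Fin n → A)) :=
  (S.rem ∘ₗ TruncSeq.eval (m + 1) 0 ∘ₗ LinearMap.snd ℚ _ _).prod
    (LinearMap.pi fun k => S.rem ∘ₗ TruncSeq.eval (m + 1) (2 * k + 2) ∘ₗ LinearMap.snd ℚ _ _)

/-- Representatives of the classes in the kernel of `torusDiff` at the even indices. -/
def kerIncl (h : 2 * n + 2 ≤ m + 2) :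
    (A × (Fin n → A)) →ₗ[ℚ] (TruncSeq M m × TruncSeq M (m + 1)) :=
  LinearMap.inr ℚ _ _ ∘ₗ (TruncSeq.single 0 (Nat.succ_pos m) ∘ₗ S.const).coprod
    (TruncSeq.spread 2 h ∘ₗ LinearMap.pi fun k => S.const ∘ₗ LinearMap.proj k)

lemma cokerProj_apply (x : TruncSeq M m × TruncSeq M (m + 1)) (k : Fin n) :
    S.cokerProj n m x k = S.rem (x.1.1 (2 * k + 1)) := rfl

lemma kerProj_apply (x : TruncSeq M m × TruncSeq M (m + 1)) : S.kerProj n m x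
    = (S.rem (x.2.1 0), fun k : Fin n => S.rem (x.2.1 (2 * k + 2))) := rfl

lemma cokerIncl_odd (h : 2 * n + 1 ≤ m + 1) (z : Fin n → A) {k : ℕ} (hk : k < n) :
    (S.cokerIncl h z).1.1 (2 * k + 1) = S.const (z ⟨k, hk⟩) :=
  TruncSeq.spread_val_lt h _ hk

lemma cokerIncl_even (h : 2 * n + 1 ≤ m + 1) (z : Fin n → A) (k : ℕ) :
    (S.cokerIncl h z).1.1 (2 * k) = 0 :=
  TruncSeq.spread_val_of_ne h _ fun k' _ => by omega

lemma kerIncl_fst (h : 2 * n + 2 ≤ m + 2) (z : A × (Fin n → A)) : (S.kerIncl h z).1 = 0 := rfl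

lemma kerIncl_val (h : 2 * n + 2 ≤ m + 2) (z : A × (Fin n → A)) (j : ℕ) :
    (S.kerIncl h z).2.1 j = (TruncSeq.single 0 (Nat.succ_pos m) (S.const z.1)).1 j
      + (TruncSeq.spread (m := m + 1) 2 h fun k => S.const (z.2 k)).1 j := rfl

lemma kerIncl_zero (h : 2 * n + 2 ≤ m + 2) (z : A × (Fin n → A)) :
    (S.kerIncl h z).2.1 0 = S.const z.1 := by
  rw [kerIncl_val, TruncSeq.single_val, TruncSeq.spread_val_of_ne, if_pos rfl, add_zero]
  intro k _
  omega

lemma kerIncl_odd (h : 2 * n + 2 ≤ m + 2) (z : A × (Fin n → A)) (k : ℕ) :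
    (S.kerIncl h z).2.1 (2 * k + 1) = 0 := by
  rw [kerIncl_val, TruncSeq.single_val, TruncSeq.spread_val_of_ne, if_neg (by omega), add_zero]
  intro k _
  omega

lemma kerIncl_even (h : 2 * n + 2 ≤ m + 2) (z : A × (Fin n → A)) {k : ℕ} (hk : k < n) :
    (S.kerIncl h z).2.1 (2 * k + 2) = S.const (z.2 ⟨k, hk⟩) := by
  rw [kerIncl_val, TruncSeq.single_val, TruncSeq.spread_val_lt h _ hk, if_neg (by omega), zero_add]

lemma kerIncl_of_le (h : 2 * n + 2 ≤ m + 2) (z : A × (Fin n → A)) {k : ℕ} (hk : n ≤ k) :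
    (S.kerIncl h z).2.1 (2 * k + 2) = 0 := by
  rw [kerIncl_val, TruncSeq.single_val, TruncSeq.spread_val_of_ne, if_neg (by omega), add_zero]
  intro k _
  omega

lemma cokerIncl_of_le (h : 2 * n + 1 ≤ m + 1) (z : Fin n → A) {k : ℕ} (hk : n ≤ k) :
    (S.cokerIncl h z).1.1 (2 * k + 1) = 0 :=
  TruncSeq.spread_val_of_ne h _ fun k' _ => by omega

lemma cokerProj_diff (x) : S.cokerProj n m (torusDiff S.b m x) = 0 := by
  funext k
  rw [cokerProj_apply, torusDiff_fst_odd, S.rem_b]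
  rfl

lemma cokerProj_d (x) : S.cokerProj n m (torusD M m x) = 0 := by
  funext k
  rw [cokerProj_apply, torusD_fst, TruncSeq.zero_val, map_zero]
  rfl

lemma cokerProj_incl (h : 2 * n + 1 ≤ m + 1) (z : Fin n → A) :
    S.cokerProj n m (S.cokerIncl h z) = z := by
  funext k
  rw [cokerProj_apply, S.cokerIncl_odd h z k.2, S.rem_const]

/-- A sequence supported at the odd indices is, as a boundary, in the image of `torusDiff`. -/
lemma exists_torusDiff_eq_d (x : TruncSeq M m × TruncSeq M (m + 1))
    (hx : ∀ k, x.1.1 (2 * k) = 0) : ∃ y, torusD M m x = torusDiff S.b m y := by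
  -- The operator `torusDiff` moves entry `j` of the first sequence to index `j + 1` of the second,
  -- so the witness is `x.1` shifted down. Its odd entries vanish by `hx`, so no term with `b`
  -- appears.
  refine ⟨(⟨fun j => x.1.1 (j + 1), fun j hj => x.1.2 _ (by omega)⟩, 0),
    Prod.ext (TruncSeq.ext_parity (fun k => ?_) fun k => ?_)
      (TruncSeq.ext_parity_succ ?_ (fun k => ?_) fun k => ?_)⟩
  · rw [torusDiff_fst_even, torusD_fst, TruncSeq.zero_val]
  · rw [torusDiff_fst_odd, torusD_fst, TruncSeq.zero_val]
    change 0 = S.b ((-2 : ℚ) • x.1.1 (2 * (k + 1)))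
    rw [hx, smul_zero, map_zero]
  · rw [torusDiff_snd_zero, torusD_snd]
    exact hx 0
  · rw [torusDiff_snd_odd, torusD_snd, TruncSeq.zero_val, smul_zero, map_zero, add_zero]
  · rw [torusDiff_snd_even, torusD_snd]

/-- The entry of index `2 * k + 2` equals entry `2 * k + 1` of the first part of `y`. The first part
of a boundary is zero, so `b` kills that entry up to the factor `-2`, and `b` is injective; at index
zero `torusDiff` has no entry at all. -/
lemma even_eq_zero_of_d_eq (x : TruncSeq M m × TruncSeq M (m + 1))
    (h : ∃ y, torusD M m x = torusDiff S.b m y) (k : ℕ) : x.1.1 (2 * k) = 0 := by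
  obtain ⟨y, h⟩ := h
  have h2 (j : ℕ) : x.1.1 j = (torusDiff S.b m y).2.1 j := by rw [← h]; rfl
  have h1 (j : ℕ) : (torusDiff S.b m y).1.1 j = 0 := by rw [← h]; rfl
  rcases k with _ | k
  · rw [h2]
    exact torusDiff_snd_zero _ _
  · have := h1 (2 * k + 1)
    rw [torusDiff_fst_odd] at this
    have := S.b_injective this
    rw [smul_eq_zero_iff_right (by norm_num)] at this
    rw [h2, ← this]
    exact torusDiff_snd_even _ _ _

/-- Reduction of a cycle of the cokernel of `torusDiff`, up to an error `r` at the last index when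
that is even. -/
lemma exists_coker_reduction (x : TruncSeq M m × TruncSeq M (m + 1))
    (hx : ∀ k, x.1.1 (2 * k) = 0) (h : 2 * n + 1 ≤ m + 1) (hn : m ≤ 2 * n + 1)
    (e : TruncSeq M (m + 1)) (he0 : ∀ j < m, e.1 j = 0)
    (he : ∀ k, 2 * k + 2 = m → e.1 m = x.2.1 m + (1 / 2 : ℚ) • S.quo (x.1.1 (2 * k + 1)))
    (he' : ∀ k, 2 * k + 1 = m → e.1 m = 0) (hm : m ≠ 0) :
    ∃ y w, x - (S.cokerIncl h (S.cokerProj n m x) + ((0, e) : TruncSeq M m × TruncSeq M (m + 1)))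
      = torusDiff S.b m y + torusD M m w := by
  have eo (k : ℕ) : e.1 (2 * k + 1) = 0 := by
    rcases lt_trichotomy (2 * k + 1) m with h' | h' | h'
    · exact he0 _ h'
    · rw [h', he' k h']
    · exact TruncSeq.val_eq_zero e h'
  -- The even entries of `y` produce the odd entries of `x.2`; the odd entries, with `-1 / 2`
  -- against the factor `-2` in `torusDiff`, remove the multiples of `b` from `x.1` and leave only
  -- the remainders.
  set y : TruncSeq M m := TruncSeq.interleave m (fun k => x.2.1 (2 * k + 1))
    fun k => (-1 / 2 : ℚ) • S.quo (x.1.1 (2 * k + 1)) with hy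
  -- The differential of `w` supplies what is still missing at the even indices of `x.2`. It reaches
  -- indices below `m` only, which is why `e` is needed when `m` is even.
  set w : TruncSeq M m := TruncSeq.interleave m
    (fun k => x.2.1 (2 * k) - (TruncSeq.pre m y).1 (2 * k)) fun _ => 0 with hw
  have yo (k : ℕ) : y.1 (2 * k + 1) = (-1 / 2 : ℚ) • S.quo (x.1.1 (2 * k + 1)) := by
    rw [hy, TruncSeq.interleave_odd, ite_eq_left_iff]
    intro h'
    rw [TruncSeq.val_eq_zero x.1 (not_lt.mp h'), map_zero, smul_zero]
  have ye (k : ℕ) : y.1 (2 * k) = x.2.1 (2 * k + 1) := by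
    rw [hy, TruncSeq.interleave_even, ite_eq_left_iff]
    intro h'
    rw [TruncSeq.val_eq_zero x.2 (by omega)]
  have hz (z : M) : z = S.b (S.quo z) + S.const (S.rem z) := by rw [S.b_quo, sub_add_cancel]
  refine ⟨(y, 0), (w, 0), sub_eq_iff_eq_add.mpr
    (Prod.ext (TruncSeq.ext_parity (fun k => ?_) fun k => ?_)
      (TruncSeq.ext_parity_succ ?_ (fun k => ?_) fun k => ?_))⟩
  · change _ = (torusDiff S.b m (y, 0)).1.1 (2 * k) + 0 + ((S.cokerIncl h _).1.1 (2 * k) + 0)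
    rw [torusDiff_fst_even, cokerIncl_even, hx]
    simp
  · change _ = (torusDiff S.b m (y, 0)).1.1 (2 * k + 1) + 0
      + ((S.cokerIncl h _).1.1 (2 * k + 1) + 0)
    rw [torusDiff_fst_odd, yo, smul_smul, add_zero, add_zero]
    norm_num
    by_cases hk : k < n
    · rw [S.cokerIncl_odd h _ hk]
      exact hz _
    · rw [S.cokerIncl_of_le h _ (not_lt.mp hk), TruncSeq.val_eq_zero x.1 (by omega)]
      simp
  · change _ = (torusDiff S.b m (y, 0)).2.1 0 + w.1 (2 * 0) + (0 + e.1 0)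
    rw [torusDiff_snd_zero, hw, TruncSeq.interleave_even, if_pos (by omega), he0 0 (by omega)]
    simp
  · change _ = (torusDiff S.b m (y, 0)).2.1 (2 * k + 1) + w.1 (2 * k + 1) + (0 + e.1 (2 * k + 1))
    rw [torusDiff_snd_odd, hw, TruncSeq.interleave_odd, eo, ye]
    simp
  · change _ = (torusDiff S.b m (y, 0)).2.1 (2 * k + 2) + w.1 (2 * (k + 1))
      + (0 + e.1 (2 * k + 2))
    rw [torusDiff_snd_even, hw, TruncSeq.interleave_even]
    change _ = y.1 (2 * k + 1) + (if _ then _ - y.1 (2 * k + 1) else 0) + _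
    rw [yo]
    rcases lt_trichotomy (2 * k + 2) m with h' | h' | h'
    · rw [if_pos (by omega), he0 _ h', zero_add, add_zero, add_sub_cancel]
      rfl
    · rw [if_neg (by omega), h', he k h']
      module
    · rw [if_neg (by omega), TruncSeq.val_eq_zero x.2 h', TruncSeq.val_eq_zero e h',
        TruncSeq.val_eq_zero x.1 (by omega), map_zero]
      simp

/-- On the kernel, entry `2 * k` of `x.1` is `2 * b` times entry `2 * k + 1` of `x.2`, so its
remainder vanishes. -/
lemma kerProj_d (x : TruncSeq M m × TruncSeq M (m + 1)) (hx : torusDiff S.b m x = 0) :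
    S.kerProj n m (torusD M m x) = 0 := by
  have h (k : ℕ) : S.rem (x.1.1 (2 * k)) = 0 := by
    have e := torusDiff_snd_odd S.b x k
    rw [hx] at e
    rw [eq_neg_of_add_eq_zero_left e.symm, map_neg, S.rem_b, neg_zero]
  rw [kerProj_apply, torusD_snd]
  exact Prod.ext (h 0) (funext fun k => h (k + 1))

lemma diff_kerIncl (h : 2 * n + 2 ≤ m + 2) (z : A × (Fin n → A)) :
    torusDiff S.b m (S.kerIncl h z) = 0 := by
  refine Prod.ext (TruncSeq.ext_parity (fun k => ?_) fun k => ?_)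
      (TruncSeq.ext_parity_succ ?_ (fun k => ?_) fun k => ?_)
  · exact torusDiff_fst_even _ _ _
  · rw [torusDiff_fst_odd, kerIncl_fst, TruncSeq.zero_val, smul_zero, map_zero]
    rfl
  · exact torusDiff_snd_zero _ _
  · rw [torusDiff_snd_odd, kerIncl_fst, TruncSeq.zero_val, kerIncl_odd, smul_zero, map_zero,
      add_zero]
    rfl
  · rw [torusDiff_snd_even, kerIncl_fst]
    rfl

lemma d_kerIncl (h : 2 * n + 2 ≤ m + 2) (z : A × (Fin n → A)) :
    torusD M m (S.kerIncl h z) = 0 := rfl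

lemma kerProj_incl (h : 2 * n + 2 ≤ m + 2) (z : A × (Fin n → A)) :
    S.kerProj n m (S.kerIncl h z) = z := by
  rw [kerProj_apply, kerIncl_zero, S.rem_const]
  refine Prod.ext rfl (funext fun k => ?_)
  change S.rem ((S.kerIncl h z).2.1 (2 * k + 2)) = _
  rw [S.kerIncl_even h z k.2, S.rem_const]

/-- Reduction of a cycle of the kernel of `torusDiff`, up to an error at the last index when that is
even. -/
lemma exists_ker_reduction (x : TruncSeq M m × TruncSeq M (m + 1)) (hx : torusDiff S.b m x = 0)
    (hd : torusD M m x = 0) (h : 2 * n + 2 ≤ m + 2) (hn : m ≤ 2 * n + 2)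
    (e : TruncSeq M (m + 1)) (he0 : ∀ j < m, e.1 j = 0)
    (he : ∀ k, 2 * k + 2 = m → n ≤ k ∧ e.1 m = x.2.1 m)
    (he' : ∀ k, 2 * k + 1 = m → e.1 m = 0) (hm : m ≠ 0) :
    ∃ w, torusDiff S.b m w = 0 ∧
      x - (S.kerIncl h (S.kerProj n m x) + ((0, e) : TruncSeq M m × TruncSeq M (m + 1)))
        = torusD M m w := by
  have eo (k : ℕ) : e.1 (2 * k + 1) = 0 := by
    rcases lt_trichotomy (2 * k + 1) m with h' | h' | h'
    · exact he0 _ h'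
    · rw [h', he' k h']
    · exact TruncSeq.val_eq_zero e h'
  have xu (j : ℕ) : x.1.1 j = 0 := by rw [← torusD_snd, hd]; rfl
  -- Since `d x = 0` gives `x.1 = 0`, the kernel condition at odd indices leaves only `b` applied to
  -- these entries.
  have xo (k : ℕ) : x.2.1 (2 * k + 1) = 0 := by
    have := torusDiff_snd_odd S.b x k
    rw [hx, xu, zero_add] at this
    have := S.b_injective this.symm
    rwa [smul_eq_zero_iff_right (by norm_num)] at this
  -- The multiples of `b` at even indices of `x.2` are boundaries of `u`; the odd entries of `v` are
  -- the halves of the quotients, which puts `(u, v)` in the kernel of `torusDiff`.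
  set u : TruncSeq M m := TruncSeq.interleave m (fun k => S.b (S.quo (x.2.1 (2 * k))))
    fun _ => 0 with hu
  set v : TruncSeq M (m + 1) := TruncSeq.interleave (m + 1) (fun _ => 0)
    fun k => (1 / 2 : ℚ) • S.quo (x.2.1 (2 * k)) with hv
  have uo (k : ℕ) : u.1 (2 * k + 1) = 0 := by rw [hu, TruncSeq.interleave_odd, ite_self]
  refine ⟨(u, v), Prod.ext (TruncSeq.ext_parity (fun k => ?_) fun k => ?_)
      (TruncSeq.ext_parity_succ ?_ (fun k => ?_) fun k => ?_),
    sub_eq_iff_eq_add.mpr (Prod.ext (TruncSeq.ext fun j => ?_)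
      (TruncSeq.ext_parity_succ ?_ (fun k => ?_) fun k => ?_))⟩
  · exact torusDiff_fst_even _ _ _
  · rw [torusDiff_fst_odd, uo, smul_zero, map_zero]
    rfl
  · exact torusDiff_snd_zero _ _
  · rw [torusDiff_snd_odd, hu, hv, TruncSeq.interleave_even, TruncSeq.interleave_odd]
    change _ = (0 : M)
    by_cases h' : 2 * k < m
    · rw [if_pos h', if_pos (by omega), smul_smul, map_smul]
      module
    · rw [if_neg h', if_neg (by omega)]
      simp
  · rw [torusDiff_snd_even, uo]
    rfl
  · change _ = 0 + ((0 : M) + 0)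
    rw [xu, add_zero, add_zero]
  · change _ = u.1 (2 * 0) + ((S.kerIncl h _).2.1 0 + e.1 0)
    rw [hu, TruncSeq.interleave_even, if_pos (by omega), kerIncl_zero, he0 0 (by omega), add_zero,
      S.b_quo]
    exact (sub_add_cancel _ _).symm
  · change _ = u.1 (2 * k + 1) + ((S.kerIncl h _).2.1 (2 * k + 1) + e.1 (2 * k + 1))
    rw [uo, kerIncl_odd, eo, xo, add_zero, add_zero]
  · change _ = u.1 (2 * (k + 1)) + ((S.kerIncl h _).2.1 (2 * k + 2) + e.1 (2 * k + 2))
    rw [hu, TruncSeq.interleave_even]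
    rcases lt_trichotomy (2 * k + 2) m with h' | h' | h'
    · rw [if_pos (by omega), he0 _ h', S.kerIncl_even h _ (by omega : k < n), add_zero, S.b_quo]
      exact (sub_add_cancel _ _).symm
    · rw [if_neg (by omega), S.kerIncl_of_le h _ (he k h').1, h', (he k h').2, zero_add, zero_add]
    · rw [if_neg (by omega), S.kerIncl_of_le h _ (by omega), TruncSeq.val_eq_zero x.2 h',
        TruncSeq.val_eq_zero e h', add_zero, add_zero]

end DivisionData

/-! ### The additional free classes of an even word -/

section lastIndex

variable {M A : Type} [AddCommGroup M] [Module ℚ M] [AddCommGroup A] [Module ℚ A]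
  (S : DivisionData M A) (n : ℕ)

/-- The class at the last index of an even word. -/
def lastProj (quo : M →ₗ[ℚ] M) (n : ℕ) :
    (TruncSeq M (2 * n + 2) × TruncSeq M (2 * n + 2 + 1)) →ₗ[ℚ] M :=
  TruncSeq.eval _ (2 * n + 2) ∘ₗ LinearMap.snd ℚ _ _ +
    (1 / 2 : ℚ) • (quo ∘ₗ TruncSeq.eval _ (2 * n + 1) ∘ₗ LinearMap.fst ℚ _ _)

/-- The representatives at the last index of an even word. -/
def lastIncl (M : Type) [AddCommGroup M] [Module ℚ M] (n : ℕ) :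
    M →ₗ[ℚ] (TruncSeq M (2 * n + 2) × TruncSeq M (2 * n + 2 + 1)) :=
  LinearMap.inr ℚ _ _ ∘ₗ TruncSeq.single (2 * n + 2) (Nat.lt_succ_self _)

variable (x : TruncSeq M (2 * n + 2) × TruncSeq M (2 * n + 2 + 1))

lemma lastProj_apply (quo : M →ₗ[ℚ] M) :
    lastProj quo n x = x.2.1 (2 * n + 2) + (1 / 2 : ℚ) • quo (x.1.1 (2 * n + 1)) := rfl

lemma lastProj_zero_apply : lastProj (0 : M →ₗ[ℚ] M) n x = x.2.1 (2 * n + 2) := by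
  rw [lastProj_apply, LinearMap.zero_apply, smul_zero, add_zero]

lemma lastIncl_snd (r : M) (j : ℕ) :
    (lastIncl M n r).2.1 j = if j = 2 * n + 2 then r else 0 :=
  TruncSeq.single_val (Nat.lt_succ_self _) _ _

namespace DivisionData

/-- An entry `w` at the last odd index is sent to `-2 * b w` there and to `w` at the last even
index. In the cokernel, `w` at the last index is thus `2 * b w` at the previous one, whence the
coefficient one half of the quotient. -/
lemma lastProj_diff : lastProj S.quo n (torusDiff S.b _ x) = 0 := by
  rw [lastProj_apply, torusDiff_snd_even, torusDiff_fst_odd, S.quo_b]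
  module

lemma lastProj_d (quo : M →ₗ[ℚ] M) : lastProj quo n (torusD M _ x) = quo 0 + x.1.1 (2 * n + 2) := by
  rw [lastProj_apply, torusD_snd, torusD_fst, TruncSeq.zero_val, map_zero, smul_zero, add_zero,
    zero_add]

lemma lastProj_d_eq_zero (quo : M →ₗ[ℚ] M) : lastProj quo n (torusD M _ x) = 0 := by
  rw [lastProj_d, map_zero, zero_add]
  exact TruncSeq.val_eq_zero _ le_rfl

variable (z : (Fin (n + 1) → A) × M) (y : (A × (Fin n → A)) × M)
  (h : 2 * (n + 1) + 1 ≤ 2 * n + 2 + 1) (h' : 2 * n + 2 ≤ 2 * n + 2 + 2)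

lemma exists_torusDiff_eq_d_coprod : ∃ y, torusD M (2 * n + 2)
    ((S.cokerIncl h).coprod (lastIncl M n) z) = torusDiff S.b (2 * n + 2) y :=
  S.exists_torusDiff_eq_d _ fun k => by
    change (S.cokerIncl _ z.1).1.1 (2 * k) + 0 = 0
    rw [S.cokerIncl_even, add_zero]

/-- The chosen representatives of remainders have quotient zero, so `lastProj` does not see them,
and the last classes have no component in the first sequence. -/
lemma cokerProj_coprod : ((S.cokerProj (n + 1) (2 * n + 2)).prod (lastProj S.quo n))
    ((S.cokerIncl h).coprod (lastIncl M n) z) = z := by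
  refine Prod.ext ?_ ?_
  · change S.cokerProj (n + 1) (2 * n + 2) (S.cokerIncl h z.1 + lastIncl M n z.2) = z.1
    rw [map_add, S.cokerProj_incl]
    refine add_eq_left.mpr (funext fun k => ?_)
    exact map_zero S.rem
  · change lastProj S.quo n (S.cokerIncl h z.1 + lastIncl M n z.2) = z.2
    rw [map_add, lastProj_apply, lastProj_apply, lastIncl_snd, if_pos rfl,
      S.cokerIncl_odd h z.1 (Nat.lt_succ_self n), S.quo_const, smul_zero, add_zero]
    change 0 + (z.2 + (1 / 2 : ℚ) • S.quo 0) = z.2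
    rw [map_zero, smul_zero, add_zero, zero_add]

lemma diff_kerIncl_coprod :
    torusDiff S.b (2 * n + 2) ((S.kerIncl h').coprod (lastIncl M n) y) = 0 := by
  rw [LinearMap.coprod_apply, map_add, S.diff_kerIncl, zero_add]
  refine Prod.ext (TruncSeq.ext_parity (fun k => ?_) fun k => ?_)
      (TruncSeq.ext_parity_succ ?_ (fun k => ?_) fun k => ?_)
  · exact torusDiff_fst_even _ _ _
  · rw [torusDiff_fst_odd]
    change S.b ((-2 : ℚ) • (0 : M)) = 0
    rw [smul_zero, map_zero]
  · exact torusDiff_snd_zero _ _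
  · rw [torusDiff_snd_odd, lastIncl_snd, if_neg (by omega)]
    change 0 + S.b ((-2 : ℚ) • (0 : M)) = 0
    rw [smul_zero, map_zero, add_zero]
  · exact torusDiff_snd_even _ _ _

lemma d_kerIncl_coprod : torusD M (2 * n + 2) ((S.kerIncl h').coprod (lastIncl M n) y) = 0 :=
  Prod.ext rfl (TruncSeq.ext fun _ => zero_add (0 : M))

lemma kerProj_coprod : ((S.kerProj n (2 * n + 2)).prod (lastProj 0 n))
    ((S.kerIncl h').coprod (lastIncl M n) y) = y := by
  refine Prod.ext ?_ ?_
  · change S.kerProj n (2 * n + 2) (S.kerIncl h' y.1 + lastIncl M n y.2) = y.1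
    rw [map_add, S.kerProj_incl]
    refine add_eq_left.mpr (Prod.ext ?_ (funext fun k => ?_))
    · change S.rem ((lastIncl M n y.2).2.1 0) = 0
      rw [lastIncl_snd, if_neg (by omega), map_zero]
    · change S.rem ((lastIncl M n y.2).2.1 (2 * k + 2)) = 0
      rw [lastIncl_snd, if_neg (by omega), map_zero]
  · change lastProj 0 n (S.kerIncl h' y.1 + lastIncl M n y.2) = y.2
    rw [map_add, lastProj_apply, lastProj_apply, lastIncl_snd, if_pos rfl,
      S.kerIncl_of_le h' y.1 le_rfl]
    simp

end DivisionData

end lastIndex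

/-- Filtered graded division by `b`, which raises the `q`-degree by 2. -/
structure FTDivisionData (R P : FTVect) extends DivisionData R.carrier P.carrier where
  quo_gr : ∀ a q t, ∀ x ∈ R.gr a q t, quo x ∈ R.gr a (q - 2) t
  quo_fil : ∀ s, ∀ x ∈ R.fil s, quo x ∈ R.fil s
  rem_gr : ∀ a q t, ∀ x ∈ R.gr a q t, rem x ∈ P.gr a q t
  rem_fil : ∀ s, ∀ x ∈ R.fil s, rem x ∈ P.fil s
  const_gr : ∀ a q t, ∀ x ∈ P.gr a q t, const x ∈ R.gr a q t
  const_fil : ∀ s, ∀ x ∈ P.fil s, const x ∈ R.fil s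
  fil_anti : ∀ s s', s ≤ s' → R.fil s' ≤ R.fil s

/-! ### Degrees and filtration of the representatives -/

namespace FTVect

variable {R : FTVect} {c : Shift} {m : ℕ} {e : ℕ → Shift}

lemma mem_shift_trunc_gr {a q : ℤ} {t : ℚ} {x : TruncSeq R.carrier m} :
    x ∈ ((R.trunc e m).shift c).gr a q t ↔ ∀ j, x.1 j ∈ (R.shift (c + e j)).gr a q t := by
  change (∀ j, _ → x.1 j ∈ R.gr (a - c.1 - (e j).1) (q - c.2.1 - (e j).2.1)
    (t - c.2.2.1 - (e j).2.2.1)) ↔ ∀ j, x.1 j ∈ R.gr (a - (c.1 + (e j).1))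
    (q - (c.2.1 + (e j).2.1)) (t - (c.2.2.1 + (e j).2.2.1))
  simp only [sub_sub, Set.mem_univ, forall_true_left]

lemma mem_shift_trunc_fil {s : ℚ} {x : TruncSeq R.carrier m} :
    x ∈ ((R.trunc e m).shift c).fil s ↔ ∀ j, x.1 j ∈ (R.shift (c + e j)).fil s := by
  change (∀ j, _ → x.1 j ∈ R.fil (s - c.2.2.2 - (e j).2.2.2)) ↔
    ∀ j, x.1 j ∈ R.fil (s - (c.2.2.2 + (e j).2.2.2))
  simp only [sub_sub, Set.mem_univ, forall_true_left]

lemma single_mem_shift_trunc_gr {a q : ℤ} {t : ℚ} {p : ℕ} (hp : p < m) {x : R.carrier}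
    (hx : x ∈ (R.shift (c + e p)).gr a q t) :
    TruncSeq.single p hp x ∈ ((R.trunc e m).shift c).gr a q t :=
  mem_shift_trunc_gr.mpr fun j => by
    rw [TruncSeq.single_val]
    split_ifs with h
    · rw [h]
      exact hx
    · exact Submodule.zero_mem _

lemma single_mem_shift_trunc_fil {s : ℚ} {p : ℕ} (hp : p < m) {x : R.carrier}
    (hx : x ∈ (R.shift (c + e p)).fil s) :
    TruncSeq.single p hp x ∈ ((R.trunc e m).shift c).fil s :=
  mem_shift_trunc_fil.mpr fun j => by
    rw [TruncSeq.single_val]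
    split_ifs with h
    · rw [h]
      exact hx
    · exact Submodule.zero_mem _

lemma spread_mem_shift_trunc_gr {a q : ℤ} {t : ℚ} {n r : ℕ} (h : 2 * n + r ≤ m + 1)
    {z : Fin n → R.carrier} (hz : ∀ k : Fin n, z k ∈ (R.shift (c + e (2 * k + r))).gr a q t) :
    TruncSeq.spread r h z ∈ ((R.trunc e m).shift c).gr a q t := by
  rw [TruncSeq.spread, LinearMap.sum_apply]
  exact Submodule.sum_mem _ fun k _ => single_mem_shift_trunc_gr (by omega) (hz k)

lemma spread_mem_shift_trunc_fil {s : ℚ} {n r : ℕ} (h : 2 * n + r ≤ m + 1)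
    {z : Fin n → R.carrier} (hz : ∀ k : Fin n, z k ∈ (R.shift (c + e (2 * k + r))).fil s) :
    TruncSeq.spread r h z ∈ ((R.trunc e m).shift c).fil s := by
  rw [TruncSeq.spread, LinearMap.sum_apply]
  exact Submodule.sum_mem _ fun k _ => single_mem_shift_trunc_fil (by omega) (hz k)

/-- The classes at the odd indices. -/
def oddClasses (P : FTVect) (c : Shift) (n : ℕ) : FTVect :=
  FTVect.finSum fun k : Fin n => P.shift (c + (shT + (2 * k + 1 : ℕ) • shTot))

/-- The classes at the even indices. -/
def evenClasses (P : FTVect) (c : Shift) (n : ℕ) : FTVect :=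
  (P.shift (c + (0 : ℕ) • shTot)).sum
    (FTVect.finSum fun k : Fin n => P.shift (c + (2 * k + 2 : ℕ) • shTot))

section classes

variable {P : FTVect} {n : ℕ} {a q : ℤ} {t s : ℚ}

lemma mem_oddClasses_gr {z : Fin n → P.carrier} : z ∈ (P.oddClasses c n).gr a q t ↔
    ∀ k : Fin n, z k ∈ (P.shift (c + (shT + (2 * k + 1 : ℕ) • shTot))).gr a q t :=
  ⟨fun h k => h k trivial, fun h k _ => h k⟩

lemma mem_oddClasses_fil {z : Fin n → P.carrier} : z ∈ (P.oddClasses c n).fil s ↔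
    ∀ k : Fin n, z k ∈ (P.shift (c + (shT + (2 * k + 1 : ℕ) • shTot))).fil s :=
  ⟨fun h k => h k trivial, fun h k _ => h k⟩

lemma mem_evenClasses_gr {z : P.carrier × (Fin n → P.carrier)} :
    z ∈ (P.evenClasses c n).gr a q t ↔ z.1 ∈ (P.shift (c + (0 : ℕ) • shTot)).gr a q t ∧
      ∀ k : Fin n, z.2 k ∈ (P.shift (c + (2 * k + 2 : ℕ) • shTot)).gr a q t :=
  and_congr Iff.rfl ⟨fun h k => h k trivial, fun h k _ => h k⟩

lemma mem_evenClasses_fil {z : P.carrier × (Fin n → P.carrier)} :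
    z ∈ (P.evenClasses c n).fil s ↔ z.1 ∈ (P.shift (c + (0 : ℕ) • shTot)).fil s ∧
      ∀ k : Fin n, z.2 k ∈ (P.shift (c + (2 * k + 2 : ℕ) • shTot)).fil s :=
  and_congr Iff.rfl ⟨fun h k => h k trivial, fun h k _ => h k⟩

variable {b : R.carrier →ₗ[ℚ] R.carrier}
  {x : TruncSeq R.carrier m × TruncSeq R.carrier (m + 1)}

lemma mem_torus_gr : x ∈ (OpComplex.torus R b c m).gr a q t ↔
    x.1 ∈ ((R.trunc (fun j => shT + j • shTot) m).shift c).gr a q t ∧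
      x.2 ∈ ((R.trunc (fun j => j • shTot) (m + 1)).shift c).gr a q t := Iff.rfl

lemma mem_torus_fil : x ∈ (OpComplex.torus R b c m).fil s ↔
    x.1 ∈ ((R.trunc (fun j => shT + j • shTot) m).shift c).fil s ∧
      x.2 ∈ ((R.trunc (fun j => j • shTot) (m + 1)).shift c).fil s := Iff.rfl

end classes

end FTVect

namespace FTDivisionData

variable {R P : FTVect} (S : FTDivisionData R P) (c : Shift) (n : ℕ) {m : ℕ}
  {a q : ℤ} {t s : ℚ}

lemma rem_shift_gr (e : Shift) {x : R.carrier} (hx : x ∈ (R.shift e).gr a q t) :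
    S.rem x ∈ (P.shift e).gr a q t := S.rem_gr _ _ _ _ hx

lemma rem_shift_fil (e : Shift) {x : R.carrier} (hx : x ∈ (R.shift e).fil s) :
    S.rem x ∈ (P.shift e).fil s := S.rem_fil _ _ hx

lemma const_shift_gr (e : Shift) {x : P.carrier} (hx : x ∈ (P.shift e).gr a q t) :
    S.const x ∈ (R.shift e).gr a q t := S.const_gr _ _ _ _ hx

lemma const_shift_fil (e : Shift) {x : P.carrier} (hx : x ∈ (P.shift e).fil s) :
    S.const x ∈ (R.shift e).fil s := S.const_fil _ _ hx

variable {c n} {x : TruncSeq R.carrier m × TruncSeq R.carrier (m + 1)}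

lemma cokerProj_gr (hx : x ∈ (OpComplex.torus R S.b c m).gr a q t) :
    S.cokerProj n m x ∈ (P.oddClasses c n).gr a q t :=
  mem_oddClasses_gr.mpr fun k =>
    S.rem_shift_gr _ (mem_shift_trunc_gr.mp (mem_torus_gr.mp hx).1 (2 * k + 1))

lemma cokerProj_fil (hx : x ∈ (OpComplex.torus R S.b c m).fil s) :
    S.cokerProj n m x ∈ (P.oddClasses c n).fil s :=
  mem_oddClasses_fil.mpr fun k =>
    S.rem_shift_fil _ (mem_shift_trunc_fil.mp (mem_torus_fil.mp hx).1 (2 * k + 1))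

lemma kerProj_gr (hx : x ∈ (OpComplex.torus R S.b c m).gr a q t) :
    S.kerProj n m x ∈ (P.evenClasses c n).gr a q t :=
  mem_evenClasses_gr.mpr
    ⟨S.rem_shift_gr _ (mem_shift_trunc_gr.mp (mem_torus_gr.mp hx).2 0), fun k =>
      S.rem_shift_gr _ (mem_shift_trunc_gr.mp (mem_torus_gr.mp hx).2 (2 * k + 2))⟩

lemma kerProj_fil (hx : x ∈ (OpComplex.torus R S.b c m).fil s) :
    S.kerProj n m x ∈ (P.evenClasses c n).fil s :=
  mem_evenClasses_fil.mpr
    ⟨S.rem_shift_fil _ (mem_shift_trunc_fil.mp (mem_torus_fil.mp hx).2 0), fun k =>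
      S.rem_shift_fil _ (mem_shift_trunc_fil.mp (mem_torus_fil.mp hx).2 (2 * k + 2))⟩

lemma cokerIncl_gr (h : 2 * n + 1 ≤ m + 1) {z : Fin n → P.carrier}
    (hz : z ∈ (P.oddClasses c n).gr a q t) :
    S.cokerIncl h z ∈ (OpComplex.torus R S.b c m).gr a q t :=
  mem_torus_gr.mpr ⟨spread_mem_shift_trunc_gr h fun k =>
    S.const_shift_gr _ (mem_oddClasses_gr.mp hz k), Submodule.zero_mem _⟩

lemma cokerIncl_fil (h : 2 * n + 1 ≤ m + 1) {z : Fin n → P.carrier}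
    (hz : z ∈ (P.oddClasses c n).fil s) :
    S.cokerIncl h z ∈ (OpComplex.torus R S.b c m).fil s :=
  mem_torus_fil.mpr ⟨spread_mem_shift_trunc_fil h fun k =>
    S.const_shift_fil _ (mem_oddClasses_fil.mp hz k), Submodule.zero_mem _⟩

lemma kerIncl_gr (h : 2 * n + 2 ≤ m + 2) {z : P.carrier × (Fin n → P.carrier)}
    (hz : z ∈ (P.evenClasses c n).gr a q t) :
    S.kerIncl h z ∈ (OpComplex.torus R S.b c m).gr a q t :=
  mem_torus_gr.mpr ⟨Submodule.zero_mem _, Submodule.add_mem _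
    (single_mem_shift_trunc_gr (Nat.succ_pos m) (S.const_shift_gr _ (mem_evenClasses_gr.mp hz).1))
    (spread_mem_shift_trunc_gr h fun k => S.const_shift_gr _ ((mem_evenClasses_gr.mp hz).2 k))⟩

lemma kerIncl_fil (h : 2 * n + 2 ≤ m + 2) {z : P.carrier × (Fin n → P.carrier)}
    (hz : z ∈ (P.evenClasses c n).fil s) :
    S.kerIncl h z ∈ (OpComplex.torus R S.b c m).fil s :=
  mem_torus_fil.mpr ⟨Submodule.zero_mem _, Submodule.add_mem _
    (single_mem_shift_trunc_fil (Nat.succ_pos m) (S.const_shift_fil _ (mem_evenClasses_fil.mp hz).1))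
    (spread_mem_shift_trunc_fil h fun k =>
      S.const_shift_fil _ ((mem_evenClasses_fil.mp hz).2 k))⟩

variable (c n)

/-- The homology for odd words. -/
def homologyDataOdd : (OpComplex.torus R S.b c (2 * n + 1)).HomologyData (P.oddClasses c n)
    (P.evenClasses c n) where
  Fc := S.cokerProj n (2 * n + 1)
  Gc := S.cokerIncl (by omega)
  Fk := S.kerProj n (2 * n + 1)
  Gk := S.kerIncl (by omega)
  Fc_gr _ _ _ _ hx := S.cokerProj_gr hx
  Fc_fil _ _ hx := S.cokerProj_fil hx
  Gc_gr _ _ _ _ hx := S.cokerIncl_gr _ hx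
  Gc_fil _ _ hx := S.cokerIncl_fil _ hx
  Fk_gr _ _ _ _ hx := S.kerProj_gr hx
  Fk_fil _ _ hx := S.kerProj_fil hx
  Gk_gr _ _ _ _ hx := S.kerIncl_gr _ hx
  Gk_fil _ _ hx := S.kerIncl_fil _ hx
  Fc_diff := S.cokerProj_diff
  Fc_d := S.cokerProj_d
  d_Gc z := S.exists_torusDiff_eq_d _ (S.cokerIncl_even _ z)
  Fc_Gc := S.cokerProj_incl _
  Gc_Fc x hx := by
    -- The last index `2 * n + 1` is odd, so the reduction leaves no error and `e` is zero.
    obtain ⟨y, w, h⟩ := S.exists_coker_reduction x (S.even_eq_zero_of_d_eq x hx) (n := n)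
      (by omega) le_rfl 0 (fun _ _ => rfl) (fun k hk => by omega) (fun _ _ => rfl) (by omega)
    refine ⟨y, w, Eq.trans ?_ h⟩
    exact congrArg (x - ·) (add_zero _).symm
  Fk_d x hx := S.kerProj_d x ((torusDiff_eq_zero_iff S.b x).mp hx)
  diff_Gk z := (torusDiff_eq_zero_iff S.b _).mpr (S.diff_kerIncl _ z)
  d_Gk := S.d_kerIncl _
  Fk_Gk := S.kerProj_incl _
  Gk_Fk x hx hd := by
    obtain ⟨w, hw, h⟩ := S.exists_ker_reduction x ((torusDiff_eq_zero_iff S.b x).mp hx) hd (n := n)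
      (by omega) (by omega) 0 (fun _ _ => rfl) (fun k hk => by omega) (fun _ _ => rfl) (by omega)
    refine ⟨w, (torusDiff_eq_zero_iff S.b w).mpr hw, Eq.trans ?_ h⟩
    exact congrArg (x - ·) (add_zero _).symm

variable {n}

lemma lastProj_gr {x : TruncSeq R.carrier (2 * n + 2) × TruncSeq R.carrier (2 * n + 2 + 1)}
    (hx : x ∈ (OpComplex.torus R S.b c (2 * n + 2)).gr a q t) :
    lastProj S.quo n x ∈ (R.shift (c + (2 * n + 2) • shTot)).gr a q t := by
  refine Submodule.add_mem _ (mem_shift_trunc_gr.mp (mem_torus_gr.mp hx).2 (2 * n + 2))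
    (Submodule.smul_mem _ _ ?_)
  refine R.gr_congr (S.quo_gr _ _ _ _
    (mem_shift_trunc_gr.mp (mem_torus_gr.mp hx).1 (2 * n + 1))) ?_ ?_ ?_ <;>
  · simp [shT, shS, shTot]
    try ring_nf

/-- The weight of the last odd index of the first sequence is one less than that of the last index
of the second, so the quotient is only included in the required step by `fil_anti`. Multiples of `b`
thus have a higher weight in the cokernel than the remainders, and the single copy of `R` has to be
split. -/
lemma lastProj_fil {x : TruncSeq R.carrier (2 * n + 2) × TruncSeq R.carrier (2 * n + 2 + 1)}
    (hx : x ∈ (OpComplex.torus R S.b c (2 * n + 2)).fil s) :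
    lastProj S.quo n x ∈ (R.shift (c + (2 * n + 2) • shTot)).fil s := by
  refine Submodule.add_mem _ (mem_shift_trunc_fil.mp (mem_torus_fil.mp hx).2 (2 * n + 2))
    (Submodule.smul_mem _ _ ?_)
  refine S.fil_anti _ _ ?_ (S.quo_fil _ _
    (mem_shift_trunc_fil.mp (mem_torus_fil.mp hx).1 (2 * n + 1)))
  simp [shT, shS, shTot]
  linarith

lemma lastIncl_gr {r : R.carrier} (hr : r ∈ (R.shift (c + (2 * n + 2) • shTot)).gr a q t) :
    lastIncl R.carrier n r ∈ (OpComplex.torus R S.b c (2 * n + 2)).gr a q t :=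
  mem_torus_gr.mpr ⟨Submodule.zero_mem _, single_mem_shift_trunc_gr (by omega) hr⟩

lemma lastIncl_fil {r : R.carrier} (hr : r ∈ (R.shift (c + (2 * n + 2) • shTot)).fil s) :
    lastIncl R.carrier n r ∈ (OpComplex.torus R S.b c (2 * n + 2)).fil s :=
  mem_torus_fil.mpr ⟨Submodule.zero_mem _, single_mem_shift_trunc_fil (by omega) hr⟩

variable (n)

lemma lastEval_gr {x : TruncSeq R.carrier (2 * n + 2) × TruncSeq R.carrier (2 * n + 2 + 1)}
    (hx : x ∈ (OpComplex.torus R S.b c (2 * n + 2)).gr a q t) :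
    lastProj 0 n x ∈ (R.shift (c + (2 * n + 2) • shTot)).gr a q t :=
  Submodule.add_mem _ (mem_shift_trunc_gr.mp (mem_torus_gr.mp hx).2 (2 * n + 2))
    (Submodule.smul_mem _ _ (Submodule.zero_mem _))

lemma lastEval_fil {x : TruncSeq R.carrier (2 * n + 2) × TruncSeq R.carrier (2 * n + 2 + 1)}
    (hx : x ∈ (OpComplex.torus R S.b c (2 * n + 2)).fil s) :
    lastProj 0 n x ∈ (R.shift (c + (2 * n + 2) • shTot)).fil s :=
  Submodule.add_mem _ (mem_shift_trunc_fil.mp (mem_torus_fil.mp hx).2 (2 * n + 2))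
    (Submodule.smul_mem _ _ (Submodule.zero_mem _))

/-- The homology for even words. -/
def homologyDataEven : (OpComplex.torus R S.b c (2 * n + 2)).HomologyData
    ((P.oddClasses c (n + 1)).sum (R.shift (c + (2 * n + 2) • shTot)))
    ((P.evenClasses c n).sum (R.shift (c + (2 * n + 2) • shTot))) where
  Fc := (S.cokerProj (n + 1) (2 * n + 2)).prod (lastProj S.quo n)
  Gc := (S.cokerIncl (n := n + 1) (m := 2 * n + 2) (by omega)).coprod (lastIncl R.carrier n)
  Fk := (S.kerProj n (2 * n + 2)).prod (lastProj 0 n)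
  Gk := (S.kerIncl (n := n) (m := 2 * n + 2) (by omega)).coprod (lastIncl R.carrier n)
  Fc_gr _ _ _ _ hx := ⟨S.cokerProj_gr hx, S.lastProj_gr c hx⟩
  Fc_fil _ _ hx := ⟨S.cokerProj_fil hx, S.lastProj_fil c hx⟩
  Gc_gr _ _ _ _ hx := Submodule.add_mem _ (S.cokerIncl_gr _ hx.1) (S.lastIncl_gr c hx.2)
  Gc_fil _ _ hx := Submodule.add_mem _ (S.cokerIncl_fil _ hx.1) (S.lastIncl_fil c hx.2)
  Fk_gr _ _ _ _ hx := ⟨S.kerProj_gr hx, S.lastEval_gr c n hx⟩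
  Fk_fil _ _ hx := ⟨S.kerProj_fil hx, S.lastEval_fil c n hx⟩
  Gk_gr _ _ _ _ hx := Submodule.add_mem _ (S.kerIncl_gr _ hx.1) (S.lastIncl_gr c hx.2)
  Gk_fil _ _ hx := Submodule.add_mem _ (S.kerIncl_fil _ hx.1) (S.lastIncl_fil c hx.2)
  Fc_diff x := Prod.ext (S.cokerProj_diff x) (S.lastProj_diff n x)
  Fc_d x := Prod.ext (S.cokerProj_d x) (DivisionData.lastProj_d_eq_zero n x _)
  d_Gc z := S.exists_torusDiff_eq_d_coprod n z _
  Fc_Gc z := S.cokerProj_coprod n z _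
  -- Here the last index is even and out of reach of the differential; the error is exactly the
  -- class read by `lastProj`.
  Gc_Fc x hx := S.exists_coker_reduction x (S.even_eq_zero_of_d_eq x hx) (n := n + 1)
      (by omega) (by omega) (TruncSeq.single (2 * n + 2) (by omega) (lastProj S.quo n x))
      (fun j hj => by rw [TruncSeq.single_val, if_neg hj.ne])
      (fun k hk => by
        obtain rfl : k = n := by omega
        rw [TruncSeq.single_val, if_pos rfl]
        rfl)
      (fun k hk => by omega) (by omega)
  Fk_d x hx := Prod.ext (S.kerProj_d x ((torusDiff_eq_zero_iff S.b x).mp hx))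
    (DivisionData.lastProj_d_eq_zero n x _)
  diff_Gk z := (torusDiff_eq_zero_iff S.b _).mpr (S.diff_kerIncl_coprod n z _)
  d_Gk z := S.d_kerIncl_coprod n z _
  Fk_Gk z := S.kerProj_coprod n z _
  Gk_Fk x hx hd := by
    obtain ⟨w, hw, h⟩ := S.exists_ker_reduction x ((torusDiff_eq_zero_iff S.b x).mp hx) hd (n := n)
      (by omega) (by omega) (TruncSeq.single (2 * n + 2) (by omega) (lastProj 0 n x))
      (fun j hj => by rw [TruncSeq.single_val, if_neg hj.ne])
      (fun k hk => ⟨by omega, by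
        rw [TruncSeq.single_val, if_pos rfl]
        exact lastProj_zero_apply n x⟩)
      (fun k hk => by omega) (by omega)
    exact ⟨w, (torusDiff_eq_zero_iff S.b w).mpr hw, h⟩

end FTDivisionData

/-! ### Filtered triply graded vector spaces with a homogeneous basis -/

namespace FTVect

/-- The basis `b` consists of homogeneous elements of the degrees and weights `deg`, and it is
adapted to the gradings and the filtration. -/
def IsAdapted (V : FTVect) {ι : Type} (b : Module.Basis ι ℚ V.carrier) (deg : ι → Shift) : Prop :=
  (∀ a q t, V.gr a q t =
    Submodule.span ℚ (b '' {i | (deg i).1 = a ∧ (deg i).2.1 = q ∧ (deg i).2.2.1 = t})) ∧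
  ∀ s, V.fil s = Submodule.span ℚ (b '' {i | s ≤ (deg i).2.2.2})

/-- The existence of an adapted basis of the given degrees and weights. -/
def HasDegrees (V : FTVect) {ι : Type} (deg : ι → Shift) : Prop :=
  ∃ b : Module.Basis ι ℚ V.carrier, V.IsAdapted b deg

lemma mem_span_basis {M ι : Type} [AddCommGroup M] [Module ℚ M] (b : Module.Basis ι ℚ M)
    {T : Set ι} {x : M} : x ∈ Submodule.span ℚ (b '' T) ↔ ∀ i, b.repr x i ≠ 0 → i ∈ T := by
  rw [b.mem_span_image]
  exact ⟨fun h i hi => h (Finsupp.mem_support_iff.mpr hi),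
    fun h i hi => h i (Finsupp.mem_support_iff.mp hi)⟩

lemma map_span_basis {M N ι κ : Type} [AddCommGroup M] [Module ℚ M] [AddCommGroup N] [Module ℚ N]
    (b : Module.Basis ι ℚ M) (b' : Module.Basis κ ℚ N) (e : ι ≃ κ) {S : Set ι} {T : Set κ}
    (h : ∀ i, i ∈ S ↔ e i ∈ T) : (Submodule.span ℚ (b '' S)).map (b.equiv b' e).toLinearMap
      = Submodule.span ℚ (b' '' T) := by
  rw [Submodule.map_span]
  congr 1
  ext x
  constructor
  · rintro ⟨_, ⟨i, hi, rfl⟩, rfl⟩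
    exact ⟨e i, (h i).mp hi, (b.equiv_apply _ _ _).symm⟩
  · rintro ⟨k, hk, rfl⟩
    refine ⟨b (e.symm k), ⟨e.symm k, (h _).mpr (by rwa [e.apply_symm_apply]), rfl⟩, ?_⟩
    exact (b.equiv_apply _ _ _).trans (by rw [e.apply_symm_apply])

lemma prod_span_basis {M N ι κ : Type} [AddCommGroup M] [Module ℚ M] [AddCommGroup N] [Module ℚ N]
    (b : Module.Basis ι ℚ M) (b' : Module.Basis κ ℚ N) {S : Set ι} {T : Set κ} {U : Set (ι ⊕ κ)}
    (h : ∀ i, i ∈ S ↔ .inl i ∈ U) (h' : ∀ i, i ∈ T ↔ .inr i ∈ U) :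
    (Submodule.span ℚ (b '' S)).prod (Submodule.span ℚ (b' '' T))
      = Submodule.span ℚ (b.prod b' '' U) := by
  ext x
  rw [Submodule.mem_prod, mem_span_basis, mem_span_basis, mem_span_basis, Sum.forall]
  simp only [h, h', Module.Basis.prod_repr_inl, Module.Basis.prod_repr_inr]

lemma pi_span_basis {n : ℕ} {M : Fin n → Type} {ι : Fin n → Type} [∀ k, AddCommGroup (M k)]
    [∀ k, Module ℚ (M k)] (b : ∀ k, Module.Basis (ι k) ℚ (M k)) {S : ∀ k, Set (ι k)}
    {U : Set (Σ k, ι k)} (h : ∀ k i, i ∈ S k ↔ ⟨k, i⟩ ∈ U) :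
    Submodule.pi Set.univ (fun k => Submodule.span ℚ (b k '' S k))
      = Submodule.span ℚ (Pi.basis b '' U) := by
  ext x
  rw [Submodule.mem_pi, mem_span_basis, Sigma.forall]
  simp only [Set.mem_univ, forall_true_left, mem_span_basis, h, Pi.basis_repr]

/-- The parameter `a` runs over the ways of distributing a degree or a filtration index on the two
factors; a pair of basis vectors belongs to the span as soon as one distribution admits it. -/
lemma tensor_span_basis {M N ι κ : Type} [AddCommGroup M] [Module ℚ M] [AddCommGroup N]
    [Module ℚ N] (b : Module.Basis ι ℚ M) (b' : Module.Basis κ ℚ N) {α : Type}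
    {S : α → Set ι} {T : α → Set κ} {U : Set (ι × κ)}
    (h : ∀ i k, (i, k) ∈ U ↔ ∃ a, i ∈ S a ∧ k ∈ T a) :
    Submodule.span ℚ {x | ∃ a, ∃ v ∈ Submodule.span ℚ (b '' S a),
        ∃ w ∈ Submodule.span ℚ (b' '' T a), v ⊗ₜ[ℚ] w = x}
      = Submodule.span ℚ (b.tensorProduct b' '' U) := by
  refine le_antisymm (Submodule.span_le.mpr ?_) (Submodule.span_le.mpr ?_)
  · rintro _ ⟨a, v, hv, w, hw, rfl⟩
    refine Submodule.span_induction₂ (p := fun v w _ _ => v ⊗ₜ[ℚ] w ∈ _) ?_ ?_ ?_ ?_ ?_ ?_ ?_ hv hw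
    · rintro _ _ ⟨i, hi, rfl⟩ ⟨k, hk, rfl⟩
      exact Submodule.subset_span ⟨(i, k), (h i k).mpr ⟨a, hi, hk⟩, b.tensorProduct_apply _ _ _⟩
    · intro y _
      rw [TensorProduct.zero_tmul]
      exact zero_mem _
    · intro x _
      rw [TensorProduct.tmul_zero]
      exact zero_mem _
    · intro x y z _ _ _ hx hy
      rw [TensorProduct.add_tmul]
      exact add_mem hx hy
    · intro x y z _ _ _ hx hy
      rw [TensorProduct.tmul_add]
      exact add_mem hx hy
    · intro r x y _ _ hx
      rw [← TensorProduct.smul_tmul']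
      exact Submodule.smul_mem _ r hx
    · intro r x y _ _ hx
      rw [TensorProduct.tmul_smul]
      exact Submodule.smul_mem _ r hx
  · rintro _ ⟨⟨i, k⟩, hik, rfl⟩
    obtain ⟨a, hi, hk⟩ := (h i k).mp hik
    exact Submodule.subset_span ⟨a, b i, Submodule.subset_span ⟨i, hi, rfl⟩, b' k,
      Submodule.subset_span ⟨k, hk, rfl⟩, (b.tensorProduct_apply _ _ _).symm⟩

namespace HasDegrees

variable {V W : FTVect} {ι κ : Type} {d : ι → Shift} {d' : κ → Shift}

/-- Gradings and filtration are spanned by basis vectors selected by degree and weight, so a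
bijection of bases that preserves these data suffices. -/
theorem isomorphic (hV : V.HasDegrees d) (hW : W.HasDegrees d') (e : ι ≃ κ)
    (h : ∀ i, d i = d' (e i)) : V.Isomorphic W := by
  obtain ⟨b, hb, hb'⟩ := hV
  obtain ⟨b', hc, hc'⟩ := hW
  refine ⟨b.equiv b' e, fun a q t => ?_, fun s => ?_⟩
  · rw [hb, hc]
    exact map_span_basis b b' e fun i => by rw [Set.mem_ofPred_eq, Set.mem_ofPred_eq, h]
  · rw [hb', hc']
    exact map_span_basis b b' e fun i => by rw [Set.mem_ofPred_eq, Set.mem_ofPred_eq, h]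

theorem of_isomorphic (h : V.Isomorphic W) (hW : W.HasDegrees d) : V.HasDegrees d := by
  obtain ⟨e, he, he'⟩ := h
  obtain ⟨b, hb, hb'⟩ := hW
  have key (S : Submodule ℚ V.carrier) (U : Set ι)
      (h : S.map e.toLinearMap = Submodule.span ℚ (b '' U)) :
      S = Submodule.span ℚ (b.map e.symm '' U) := by
    refine Submodule.map_injective_of_injective e.injective (h.trans ?_)
    rw [Submodule.map_span, ← Set.image_comp]
    congr 2
    funext i
    exact (e.apply_symm_apply _).symm
  exact ⟨b.map e.symm, fun a q t => key _ _ ((he a q t).trans (hb a q t)),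
    fun s => key _ _ ((he' s).trans (hb' s))⟩

lemma shift (hV : V.HasDegrees d) (c : Shift) : (V.shift c).HasDegrees fun i => d i + c := by
  obtain ⟨b, hb, hb'⟩ := hV
  refine ⟨b, fun a q t => (hb _ _ _).trans ?_, fun s => (hb' _).trans ?_⟩
  · congr 2
    ext i
    simp only [Set.mem_ofPred_eq, Prod.fst_add, Prod.snd_add, eq_sub_iff_add_eq]
  · congr 2
    ext i
    simp only [Set.mem_ofPred_eq, Prod.snd_add, sub_le_iff_le_add]

lemma sum (hV : V.HasDegrees d) (hW : W.HasDegrees d') : (V.sum W).HasDegrees (Sum.elim d d') := by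
  obtain ⟨b, hb, hb'⟩ := hV
  obtain ⟨b', hc, hc'⟩ := hW
  refine ⟨b.prod b', fun a q t => ?_, fun s => ?_⟩
  · change (V.gr a q t).prod (W.gr a q t) = _
    rw [hb, hc]
    exact prod_span_basis b b' (fun _ => Iff.rfl) fun _ => Iff.rfl
  · change (V.fil s).prod (W.fil s) = _
    rw [hb', hc']
    exact prod_span_basis b b' (fun _ => Iff.rfl) fun _ => Iff.rfl

lemma finSum {n : ℕ} {V : Fin n → FTVect} {ι : Fin n → Type} {d : ∀ k, ι k → Shift}
    (h : ∀ k, (V k).HasDegrees (d k)) :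
    (FTVect.finSum V).HasDegrees fun i : Σ k, ι k => d i.1 i.2 := by
  choose b hb hb' using h
  refine ⟨Pi.basis b, fun a q t => ?_, fun s => ?_⟩
  · change Submodule.pi Set.univ (fun k => (V k).gr a q t) = _
    simp only [hb]
    exact pi_span_basis b fun _ _ => Iff.rfl
  · change Submodule.pi Set.univ (fun k => (V k).fil s) = _
    simp only [hb']
    exact pi_span_basis b fun _ _ => Iff.rfl

lemma tensor (hV : V.HasDegrees d) (hW : W.HasDegrees d') :
    (V.tensor W).HasDegrees fun i : ι × κ => d i.1 + d' i.2 := by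
  obtain ⟨b, hb, hb'⟩ := hV
  obtain ⟨b', hc, hc'⟩ := hW
  refine ⟨b.tensorProduct b', fun a q t => ?_, fun s => ?_⟩
  · refine Eq.trans ?_ (tensor_span_basis b b' (α := ℤ × ℤ × ℚ)
      (S := fun x => {i | (d i).1 = x.1 ∧ (d i).2.1 = x.2.1 ∧ (d i).2.2.1 = x.2.2})
      (T := fun x => {i | (d' i).1 = a - x.1 ∧ (d' i).2.1 = q - x.2.1 ∧ (d' i).2.2.1 = t - x.2.2})
      fun i k => ?_)
    · simp only [← hb, ← hc, Prod.exists]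
      rfl
    · constructor
      · rintro ⟨rfl, rfl, rfl⟩
        exact ⟨((d i).1, (d i).2.1, (d i).2.2.1), ⟨rfl, rfl, rfl⟩, (add_sub_cancel_left _ _).symm,
          (add_sub_cancel_left _ _).symm, (add_sub_cancel_left _ _).symm⟩
      · rintro ⟨x, ⟨h1, h2, h3⟩, h4, h5, h6⟩
        refine ⟨?_, ?_, ?_⟩
        · change (d i).1 + (d' k).1 = a
          rw [h1, h4, add_sub_cancel]
        · change (d i).2.1 + (d' k).2.1 = q
          rw [h2, h5, add_sub_cancel]
        · change (d i).2.2.1 + (d' k).2.2.1 = t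
          rw [h3, h6, add_sub_cancel]
  · refine Eq.trans ?_ (tensor_span_basis b b' (α := ℚ) (S := fun x => {i | x ≤ (d i).2.2.2})
      (T := fun x => {i | s - x ≤ (d' i).2.2.2}) fun i k => ?_)
    · simp only [← hb', ← hc']
      rfl
    · constructor
      · intro h
        have h : s ≤ (d i).2.2.2 + (d' k).2.2.2 := h
        -- The best distribution of `s` gives the first factor its full weight.
        refine ⟨(d i).2.2.2, le_refl (d i).2.2.2, ?_⟩
        change s - (d i).2.2.2 ≤ (d' k).2.2.2
        linarith
      · rintro ⟨x, h1, h2⟩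
        change s ≤ (d i).2.2.2 + (d' k).2.2.2
        have h1 : x ≤ (d i).2.2.2 := h1
        have h2 : s - x ≤ (d' k).2.2.2 := h2
        linarith

lemma reindex (hV : V.HasDegrees d) (e : κ ≃ ι) : V.HasDegrees fun k => d (e k) := by
  obtain ⟨b, hb, hb'⟩ := hV
  have key (T : Set ι) : b '' T = b.reindex e.symm '' {k | e k ∈ T} := by
    ext x
    constructor
    · rintro ⟨i, hi, rfl⟩
      exact ⟨e.symm i, by rwa [Set.mem_ofPred_eq, e.apply_symm_apply], by simp⟩
    · rintro ⟨k, hk, rfl⟩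
      exact ⟨e k, hk, by simp⟩
  exact ⟨b.reindex e.symm, fun a q t => (hb a q t).trans (by rw [key]; rfl),
    fun s => (hb' s).trans (by rw [key]; rfl)⟩

end HasDegrees

lemma trivialFil_eq_span {M ι : Type} [AddCommGroup M] [Module ℚ M] (b : Module.Basis ι ℚ M)
    (s : ℚ) : trivialFil M s = Submodule.span ℚ (b '' {_i | s ≤ 0}) := by
  unfold trivialFil
  split_ifs with h
  · simp [h, b.span_eq]
  · simp [h]

lemma hasDegrees_rat : rat.HasDegrees fun _ : Unit => 0 := by
  refine ⟨Module.Basis.singleton Unit ℚ, fun a q t => ?_, trivialFil_eq_span _⟩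
  change (if a = 0 ∧ q = 0 ∧ t = 0 then (⊤ : Submodule ℚ ℚ) else ⊥) =
    Submodule.span ℚ ((Module.Basis.singleton Unit ℚ) '' {_i | 0 = a ∧ 0 = q ∧ 0 = t})
  split_ifs with h
  · obtain ⟨rfl, rfl, rfl⟩ := h
    have : {_i : Unit | (0 : ℤ) = 0 ∧ (0 : ℤ) = 0 ∧ (0 : ℚ) = 0} = Set.univ := by simp
    rw [this, Set.image_univ, Module.Basis.span_eq]
  · have : {_i : Unit | 0 = a ∧ 0 = q ∧ 0 = t} = ∅ :=
      Set.eq_empty_of_forall_notMem fun _ ⟨h1, h2, h3⟩ => h ⟨h1.symm, h2.symm, h3.symm⟩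
    rw [this, Set.image_empty, Submodule.span_empty]

lemma poly_gr_eq_span (σ : Type) (a q : ℤ) (t : ℚ) :
    (if a = 0 ∧ t = 0 then polyGr σ q else ⊥) = Submodule.span ℚ
      (MvPolynomial.basisMonomials σ ℚ ''
        {u | 0 = a ∧ 2 * (u.degree : ℤ) = q ∧ 0 = t}) := by
  ext x
  rw [mem_span_basis (MvPolynomial.basisMonomials σ ℚ)]
  have hw (u : σ →₀ ℕ) : Finsupp.weight (fun _ : σ => (2 : ℤ)) u = 2 * (u.degree : ℤ) := by
    rw [Finsupp.weight_apply, Finsupp.degree_apply, Finsupp.sum, Nat.cast_sum, Finset.mul_sum]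
    simp [mul_comm]
  split_ifs with h
  · obtain ⟨rfl, rfl⟩ := h
    constructor
    · intro hx u hu
      exact ⟨rfl, (hw u).symm.trans (hx hu), rfl⟩
    · intro hx u hu
      exact (hw u).trans (hx u hu).2.1
  · constructor
    · intro hx u hu
      rw [Submodule.mem_bot] at hx
      rw [hx, map_zero] at hu
      exact absurd rfl hu
    · intro hx
      refine MvPolynomial.ext _ _ fun u => ?_
      by_contra hu
      obtain ⟨h1, -, h3⟩ := hx u hu
      exact h ⟨h1.symm, h3.symm⟩

lemma hasDegrees_poly (σ : Type) :
    (poly σ).HasDegrees fun u : σ →₀ ℕ => (0, 2 * (u.degree : ℤ), 0, 0) :=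
  ⟨MvPolynomial.basisMonomials σ ℚ, poly_gr_eq_span σ, trivialFil_eq_span _⟩

/-- The degree of the monomial of a variable. -/
def powDegree (i : ℕ) : Shift := (0, 2 * (i : ℤ), 0, 0)

lemma hasDegrees_poly_of_unique (σ : Type) [Unique σ] : (poly σ).HasDegrees powDegree := by
  have h := (hasDegrees_poly σ).reindex (Finsupp.uniqueEquiv (default : σ)).symm
  convert h using 2 with i
  rw [powDegree]
  simp [Finsupp.degree_single]

lemma hasDegrees_poly_fin_two :
    (poly (Fin 2)).HasDegrees fun i : ℕ × ℕ => powDegree i.1 + powDegree i.2 := by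
  have h := (hasDegrees_poly (Fin 2)).reindex
    ((finTwoArrowEquiv ℕ).symm.trans Finsupp.equivFunOnFinite.symm)
  convert h using 2 with i
  simp [powDegree, Finsupp.degree_eq_sum, Fin.sum_univ_two, mul_add]

end FTVect

/-! ### The complexes of the words `σ^{-m}` -/

lemma polyGr_aeval {σ τ : Type} (f : σ → MvPolynomial τ ℚ) (hf : ∀ i, f i ∈ polyGr τ 2) {q : ℤ}
    {p : MvPolynomial σ ℚ} (hp : p ∈ polyGr σ q) : MvPolynomial.aeval f p ∈ polyGr τ q := by
  rw [MvPolynomial.aeval_def, MvPolynomial.eval₂_eq]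
  refine Submodule.sum_mem _ fun d hd => polyGr_C_mul _ ?_
  have h := MvPolynomial.IsWeightedHomogeneous.prod d.support (fun i => f i ^ d i) _
    fun i _ => MvPolynomial.IsWeightedHomogeneous.pow (hf i) (d i)
  have e := hp (MvPolynomial.mem_support_iff.mp hd)
  rw [Finsupp.weight_apply, Finsupp.sum] at e
  rwa [e] at h

namespace FTVect

lemma poly_gr_map {σ τ : Type} (f : MvPolynomial σ ℚ →ₗ[ℚ] MvPolynomial τ ℚ) {q q' : ℤ}
    (hf : ∀ p ∈ polyGr σ q, f p ∈ polyGr τ q') {a : ℤ} {t : ℚ} {p : MvPolynomial σ ℚ}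
    (hp : p ∈ (poly σ).gr a q t) : f p ∈ (poly τ).gr a q' t := by
  unfold poly at hp ⊢
  dsimp only at hp ⊢
  split_ifs at hp ⊢ with h
  · exact hf p hp
  · rw [Submodule.mem_bot] at hp ⊢
    rw [hp, map_zero]

lemma trivialFil_map {M N : Type} [AddCommGroup M] [Module ℚ M] [AddCommGroup N] [Module ℚ N]
    (f : M →ₗ[ℚ] N) {s : ℚ} {x : M} (hx : x ∈ trivialFil M s) : f x ∈ trivialFil N s :=
  trivialFil_mem_iff.mpr fun hs => by rw [trivialFil_mem_iff.mp hx hs, map_zero]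

end FTVect

/-! ### Sum and difference as variables, and division by the difference -/

namespace PolyAlg

/-- The change of variables to half of the difference and half of the sum. -/
def toSumDiff : PolyAlg 1 →ₐ[ℚ] PolyAlg 1 :=
  MvPolynomial.aeval ![MvPolynomial.C (1 / 2) * (MvPolynomial.X 0 - MvPolynomial.X 1),
    MvPolynomial.C (1 / 2) * (MvPolynomial.X 0 + MvPolynomial.X 1)]

/-- The change of variables to the sum and the difference. -/
def ofSumDiff : PolyAlg 1 →ₐ[ℚ] PolyAlg 1 :=
  MvPolynomial.aeval ![MvPolynomial.X 0 + MvPolynomial.X 1, MvPolynomial.X 1 - MvPolynomial.X 0]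

lemma two_halves (p : PolyAlg 1) : MvPolynomial.C (1 / 2) * p + MvPolynomial.C (1 / 2) * p = p := by
  rw [← add_mul, ← MvPolynomial.C_add, add_halves, MvPolynomial.C_1, one_mul]

lemma toSumDiff_ofSumDiff (p : PolyAlg 1) : toSumDiff (ofSumDiff p) = p := by
  have h : toSumDiff.comp ofSumDiff = AlgHom.id ℚ (PolyAlg 1) := by
    refine MvPolynomial.algHom_ext fun i => ?_
    fin_cases i
    · simp only [toSumDiff, ofSumDiff, AlgHom.comp_apply, MvPolynomial.aeval_X]
      refine Eq.trans ?_ (two_halves (MvPolynomial.X 0))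
      simp
      ring
    · simp only [toSumDiff, ofSumDiff, AlgHom.comp_apply, MvPolynomial.aeval_X]
      refine Eq.trans ?_ (two_halves (MvPolynomial.X 1))
      simp
      ring
  exact DFunLike.congr_fun h p

lemma ofSumDiff_toSumDiff (p : PolyAlg 1) : ofSumDiff (toSumDiff p) = p := by
  have h : ofSumDiff.comp toSumDiff = AlgHom.id ℚ (PolyAlg 1) := by
    refine MvPolynomial.algHom_ext fun i => ?_
    fin_cases i
    · simp only [toSumDiff, ofSumDiff, AlgHom.comp_apply, MvPolynomial.aeval_X]
      refine Eq.trans ?_ (two_halves (MvPolynomial.X 0))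
      simp
      ring
    · simp only [toSumDiff, ofSumDiff, AlgHom.comp_apply, MvPolynomial.aeval_X]
      refine Eq.trans ?_ (two_halves (MvPolynomial.X 1))
      simp
      ring
  exact DFunLike.congr_fun h p

lemma ofSumDiff_X_one : ofSumDiff (MvPolynomial.X 1) = diff 0 := by
  simp [ofSumDiff, diff]

lemma toSumDiff_diff : toSumDiff (diff 0) = MvPolynomial.X 1 := by
  rw [← ofSumDiff_X_one, toSumDiff_ofSumDiff]

lemma toSumDiff_mem {q : ℤ} {p : PolyAlg 1} (hp : p ∈ polyGr (Fin 2) q) :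
    toSumDiff p ∈ polyGr (Fin 2) q := by
  refine polyGr_aeval _ (fun i => ?_) hp
  fin_cases i
  · exact polyGr_C_mul _ (Submodule.sub_mem _ (X_mem_polyGr _) (X_mem_polyGr _))
  · exact polyGr_C_mul _ (Submodule.add_mem _ (X_mem_polyGr _) (X_mem_polyGr _))

lemma ofSumDiff_mem {q : ℤ} {p : PolyAlg 1} (hp : p ∈ polyGr (Fin 2) q) :
    ofSumDiff p ∈ polyGr (Fin 2) q := by
  refine polyGr_aeval _ (fun i => ?_) hp
  fin_cases i
  · exact Submodule.add_mem _ (X_mem_polyGr _) (X_mem_polyGr _)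
  · exact Submodule.sub_mem _ (X_mem_polyGr _) (X_mem_polyGr _)

/-- The quotient of the division by `X 1`. -/
def quoX : PolyAlg 1 →ₗ[ℚ] PolyAlg 1 where
  toFun p := p.divMonomial (Finsupp.single 1 1)
  map_add' p p' := MvPolynomial.add_divMonomial _ _ _
  map_smul' r p := MvPolynomial.ext _ _ fun u => by
    simp

lemma coeff_quoX (p : PolyAlg 1) (u : Fin 2 →₀ ℕ) :
    MvPolynomial.coeff u (quoX p) = MvPolynomial.coeff (Finsupp.single 1 1 + u) p :=
  MvPolynomial.coeff_divMonomial _ _ _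

/-- The evaluation at `X 1 = 0`. -/
def remX : PolyAlg 1 →ₐ[ℚ] PolyAlg 0 := MvPolynomial.aeval ![MvPolynomial.X 0, 0]

/-- The polynomials in `X 0`. -/
def constX : PolyAlg 0 →ₐ[ℚ] PolyAlg 1 := MvPolynomial.rename fun _ => 0

lemma remX_constX (z : PolyAlg 0) : remX (constX z) = z := by
  have h : remX.comp constX = AlgHom.id ℚ (PolyAlg 0) := by
    refine MvPolynomial.algHom_ext fun i => ?_
    fin_cases i
    simp [remX, constX]
  exact DFunLike.congr_fun h z

lemma quoX_X_mul (p : PolyAlg 1) : quoX (MvPolynomial.X 1 * p) = p :=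
  MvPolynomial.X_mul_divMonomial _ _

lemma quoX_constX (z : PolyAlg 0) : quoX (constX z) = 0 := by
  refine MvPolynomial.ext _ _ fun u => ?_
  rw [coeff_quoX, MvPolynomial.coeff_zero]
  by_contra h
  obtain ⟨v, hv, -⟩ := MvPolynomial.coeff_rename_ne_zero _ _ _ h
  have := DFunLike.congr_fun hv 1
  rw [Finsupp.mapDomain_of_notMem_range _ _ (by simp)] at this
  simp at this
  omega

lemma exists_eq_constX_remX (p : PolyAlg 1) :
    ∃ p', p = MvPolynomial.X 1 * p' + constX (remX p) := by
  induction p using MvPolynomial.induction_on with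
  | C r => exact ⟨0, by simp [remX, constX]⟩
  | add p q hp hq =>
    obtain ⟨p', hp⟩ := hp
    obtain ⟨q', hq⟩ := hq
    refine ⟨p' + q', ?_⟩
    rw [map_add, map_add, mul_add, add_add_add_comm, ← hp, ← hq]
  | mul_X p i hp =>
    obtain ⟨p', hp⟩ := hp
    fin_cases i
    · refine ⟨p' * MvPolynomial.X 0, ?_⟩
      have h : constX (remX (MvPolynomial.X 0)) = MvPolynomial.X 0 := by simp [remX, constX]
      change p * MvPolynomial.X 0 = _ + constX (remX (p * MvPolynomial.X 0))
      rw [map_mul, map_mul, h, ← mul_assoc, ← add_mul, ← hp]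
    · refine ⟨p, ?_⟩
      have h : remX (MvPolynomial.X 1) = 0 := by simp [remX]
      change p * MvPolynomial.X 1 = _ + constX (remX (p * MvPolynomial.X 1))
      rw [map_mul, h, mul_zero, map_zero, add_zero, mul_comm]

/-- In any decomposition of `p` into a multiple of `X 1` and a polynomial in `X 0`, `quoX` recovers
the cofactor, because it kills polynomials in `X 0`. -/
lemma X_mul_quoX (p : PolyAlg 1) : MvPolynomial.X 1 * quoX p = p - constX (remX p) := by
  obtain ⟨p', hp⟩ := exists_eq_constX_remX p
  have h : quoX p = p' := by rw [hp, map_add, quoX_X_mul, quoX_constX, add_zero]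
  rw [h, eq_sub_iff_add_eq, ← hp]

lemma quoX_mem {q : ℤ} {p : PolyAlg 1} (hp : p ∈ polyGr (Fin 2) q) :
    quoX p ∈ polyGr (Fin 2) (q - 2) := fun u hu => by
  rw [coeff_quoX] at hu
  have h := hp hu
  rw [map_add, Finsupp.weight_single] at h
  rw [eq_sub_iff_add_eq', ← h]
  simp

lemma remX_X_mul (p : PolyAlg 1) : remX (MvPolynomial.X 1 * p) = 0 := by
  have h : remX (MvPolynomial.X 1) = 0 := by simp [remX]
  rw [map_mul, h, zero_mul]

/-- Division by `X 1` of polynomials in two variables. -/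
def divisionData : FTDivisionData (poly (Fin 2)) (poly (Fin 1)) where
  b := LinearMap.mulLeft ℚ (MvPolynomial.X 1 : PolyAlg 1)
  quo := quoX
  rem := remX.toLinearMap
  const := constX.toLinearMap
  quo_b := quoX_X_mul
  rem_b := remX_X_mul
  rem_const := remX_constX
  quo_const := quoX_constX
  b_quo := X_mul_quoX
  quo_gr _ _ _ _ hx := poly_gr_map quoX (fun _ => quoX_mem) hx
  quo_fil _ _ hx := trivialFil_map quoX hx
  rem_gr _ _ _ _ hx := poly_gr_map remX.toLinearMap (fun _ => polyGr_aeval _ fun i => by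
    fin_cases i
    · exact X_mem_polyGr _
    · exact Submodule.zero_mem _) hx
  rem_fil _ _ hx := trivialFil_map remX.toLinearMap hx
  const_gr _ _ _ _ hx := poly_gr_map constX.toLinearMap (fun _ => polyGr_rename _) hx
  const_fil _ _ hx := trivialFil_map constX.toLinearMap hx
  fil_anti := (BimodComplex.diag 1).fil_anti

/-- The embedding in the simplified complex of the trivial word. -/
def toTorus : PolyAlg 1 →ₗ[ℚ] (TruncSeq (PolyAlg 1) 0 × TruncSeq (PolyAlg 1) (0 + 1)) :=
  LinearMap.inr ℚ _ _ ∘ₗ TruncSeq.single 0 one_pos ∘ₗ toSumDiff.toLinearMap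

/-- The projection from the simplified complex of the trivial word. -/
def ofTorus : (TruncSeq (PolyAlg 1) 0 × TruncSeq (PolyAlg 1) (0 + 1)) →ₗ[ℚ] PolyAlg 1 :=
  ofSumDiff.toLinearMap ∘ₗ TruncSeq.eval _ 0 ∘ₗ LinearMap.snd ℚ _ _

lemma toTorus_snd_zero (p : PolyAlg 1) : (toTorus p).2.1 0 = toSumDiff p :=
  (TruncSeq.single_val one_pos _ 0).trans (if_pos rfl)

/-- For the trivial word the first sequence is empty and the second has one entry, the diagonal
bimodule itself. -/
lemma torus_zero_ext {x y : TruncSeq (PolyAlg 1) 0 × TruncSeq (PolyAlg 1) (0 + 1)}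
    (h : x.2.1 0 = y.2.1 0) : x = y := by
  refine Prod.ext (TruncSeq.ext fun j => ?_) (TruncSeq.ext fun j => ?_)
  · rw [TruncSeq.val_eq_zero _ (Nat.zero_le _), TruncSeq.val_eq_zero _ (Nat.zero_le _)]
  · rcases j with _ | j
    · exact h
    · rw [TruncSeq.val_eq_zero _ (by omega), TruncSeq.val_eq_zero _ (by omega)]

lemma ofTorus_toTorus (p : PolyAlg 1) : ofTorus (toTorus p) = p :=
  (congrArg ofSumDiff (toTorus_snd_zero p)).trans (ofSumDiff_toSumDiff p)

lemma toTorus_ofTorus (x) : toTorus (ofTorus x) = x :=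
  torus_zero_ext ((toTorus_snd_zero _).trans (toSumDiff_ofSumDiff _))

/-- The operator of multiplication by `X 1`. -/
def mulX : PolyAlg 1 →ₗ[ℚ] PolyAlg 1 := LinearMap.mulLeft ℚ (MvPolynomial.X 1)

lemma toSumDiff_diff_mul (p : PolyAlg 1) : toSumDiff (diff 0 * p) = mulX (toSumDiff p) := by
  rw [map_mul, toSumDiff_diff]
  rfl

lemma toTorus_left (p : PolyAlg 1) : toTorus (diff 0 * p) = torusLeft mulX 0 (toTorus p) :=
  torus_zero_ext <| by
    rw [toTorus_snd_zero, toSumDiff_diff_mul, torusLeft_apply, ← toTorus_snd_zero]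
    simp [altMap_zero]

lemma toTorus_right (p : PolyAlg 1) : toTorus (diff 0 * p) = torusRight mulX 0 (toTorus p) :=
  torus_zero_ext <| by
    rw [toTorus_snd_zero, toSumDiff_diff_mul, torusRight_apply, ← toTorus_snd_zero]
    rfl

lemma torusD_zero (x) : torusD (PolyAlg 1) 0 x = 0 :=
  torus_zero_ext ((torusD_snd x 0).trans (TruncSeq.val_eq_zero _ le_rfl))

lemma ofTorus_comm {S : PolyAlg 1 → PolyAlg 1}
    {T : (TruncSeq (PolyAlg 1) 0 × TruncSeq (PolyAlg 1) (0 + 1)) →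
      (TruncSeq (PolyAlg 1) 0 × TruncSeq (PolyAlg 1) (0 + 1))}
    (h : ∀ p, toTorus (S p) = T (toTorus p)) (x) : ofTorus (T x) = S (ofTorus x) := by
  rw [← ofTorus_toTorus (S (ofTorus x)), h, toTorus_ofTorus]

end PolyAlg

lemma shift_zero_smul_gr (R : FTVect) (a q : ℤ) (t : ℚ) :
    (R.shift ((0 : Shift) + (0 : ℕ) • shTot)).gr a q t = R.gr a q t := by
  rw [zero_smul, add_zero]
  change R.gr (a - 0) (q - 0) (t - 0) = _
  rw [sub_zero, sub_zero, sub_zero]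

lemma shift_zero_smul_fil (R : FTVect) (s : ℚ) :
    (R.shift ((0 : Shift) + (0 : ℕ) • shTot)).fil s = R.fil s := by
  rw [zero_smul, add_zero]
  change R.fil (s - 0) = _
  rw [sub_zero]

open PolyAlg in
/-- The complex of the trivial word, in the simplified form. -/
def retractDiag : (BimodComplex.diag 1).toOp.Retract (OpComplex.torus (poly (Fin 2)) mulX 0 0) where
  f := toTorus
  g := ofTorus
  h := 0
  f_gr a q t x hx := mem_torus_gr.mpr ⟨Submodule.zero_mem _, single_mem_shift_trunc_gr one_pos (by
    rw [shift_zero_smul_gr]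
    exact poly_gr_map toSumDiff.toLinearMap (fun _ => toSumDiff_mem) hx)⟩
  f_fil s x hx := mem_torus_fil.mpr ⟨Submodule.zero_mem _, single_mem_shift_trunc_fil one_pos (by
    rw [shift_zero_smul_fil]
    exact trivialFil_map toSumDiff.toLinearMap hx)⟩
  g_gr a q t x hx := by
    have h := mem_shift_trunc_gr.mp (mem_torus_gr.mp hx).2 0
    rw [shift_zero_smul_gr] at h
    exact poly_gr_map ofSumDiff.toLinearMap (fun _ => ofSumDiff_mem) h
  g_fil s x hx := by
    have h := mem_shift_trunc_fil.mp (mem_torus_fil.mp hx).2 0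
    rw [shift_zero_smul_fil] at h
    exact trivialFil_map ofSumDiff.toLinearMap h
  f_left := toTorus_left
  f_right := toTorus_right
  f_d x := (map_zero toTorus).trans (torusD_zero _).symm
  g_left := ofTorus_comm toTorus_left
  g_right := ofTorus_comm toTorus_right
  g_d x := (congrArg ofTorus (torusD_zero x)).trans (map_zero ofTorus)
  h_left _ := (map_zero (BimodComplex.diag 1).toOp.left).symm
  h_right _ := (map_zero (BimodComplex.diag 1).toOp.right).symm
  f_g := toTorus_ofTorus
  g_f x := by
    refine (sub_eq_zero.mpr (ofTorus_toTorus x).symm).trans ?_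
    exact (add_zero (0 : PolyAlg 1)).symm

/-- The complex of `σ^{-m}`. -/
def torusWord (m : ℕ) : BimodComplex 1 := rouquier (List.replicate m (Crossing.neg (0 : Fin 1)))

lemma torusWord_central (m : ℕ) : (torusWord m).Central := by
  induction m with
  | zero => exact BimodComplex.central_diag
  | succ m ih => exact BimodComplex.Central.neg ih

/-- The degree shift of the simplified complex of `σ^{-m}`. -/
def torusShift : ℕ → Shift
  | 0 => 0
  | m + 1 => torusShift m - (shTS + shA)

lemma torusShift_eq (m : ℕ) : torusShift m = -(m • (shTS + shA)) := by
  induction m with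
  | zero => simp [torusShift]
  | succ m ih => rw [torusShift, ih, succ_nsmul, neg_add, sub_eq_add_neg]

/-- The complex of `σ^{-m}` retracts to the simplified complex. -/
def retractTorusWord : ∀ m : ℕ,
    (torusWord m).toOp.Retract (OpComplex.torus (poly (Fin 2)) PolyAlg.mulX (torusShift m) m)
  | 0 => retractDiag
  | m + 1 => (BimodComplex.retractNeg (X := torusWord m)).trans
      ((retractTorusWord m).neg.trans (OpComplex.retractTorus _ _ _ _))

/-! ### The homology of the closures -/

namespace BimodComplex

lemma finset_fin_one (S : Finset (Fin 1)) : S = ∅ ∨ S = Finset.univ := by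
  revert S
  decide

/-- The components of an element of the Koszul complex on one strand. -/
def unknotProj : (Finset (Fin 1) → PolyAlg 0) →ₗ[ℚ] (PolyAlg 0 × PolyAlg 0) :=
  (LinearMap.proj ∅).prod (LinearMap.proj Finset.univ)

/-- The element of the Koszul complex on one strand with the given components. -/
def unknotIncl : (PolyAlg 0 × PolyAlg 0) →ₗ[ℚ] (Finset (Fin 1) → PolyAlg 0) :=
  LinearMap.pi fun S => if S = ∅ then LinearMap.fst ℚ _ _ else LinearMap.snd ℚ _ _

lemma unknotIncl_proj (f : Finset (Fin 1) → PolyAlg 0) : unknotIncl (unknotProj f) = f := by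
  funext S
  obtain rfl | rfl := finset_fin_one S <;> rfl

lemma inner_diag (k : ℕ) (f : Finset (Fin (k + 1)) → PolyAlg k) :
    (BimodComplex.diag k).inner f = 0 := by
  have h (j : Fin (k + 1)) : (BimodComplex.diag k).varDiff j = 0 :=
    LinearMap.ext fun _ => sub_eq_zero.mpr rfl
  funext T
  simp [inner, h]
  rfl

/-- Both actions on the diagonal bimodule agree and its differential is zero, so the homology is the
whole Koszul complex. -/
theorem outerHomology_diag_zero : (BimodComplex.diag 0).outerHomology.Isomorphic
    ((poly (Fin 1)).sum ((poly (Fin 1)).shift shA)) := by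
  refine iteratedHomology_isomorphic _ (Z := (poly (Fin 1)).sum ((poly (Fin 1)).shift shA))
    unknotProj unknotIncl ?_ ?_ ?_ ?_ ?_ ?_ ?_ ?_ ?_ ?_
  · intro a q t f hf
    refine ⟨(poly (Fin 1)).gr_congr (hf ∅ trivial) ?_ ?_ rfl,
      (poly (Fin 1)).gr_congr (hf Finset.univ trivial) ?_ ?_ ?_⟩ <;> simp [shA]
  · intro s f hf
    exact ⟨hf ∅ trivial, (poly (Fin 1)).fil_congr (hf Finset.univ trivial) (by simp [shA])⟩
  · rintro a q t z ⟨h1, h2⟩ S -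
    obtain rfl | rfl := finset_fin_one S
    · refine (poly (Fin 1)).gr_congr h1 ?_ ?_ ?_ <;> simp
    · refine (poly (Fin 1)).gr_congr h2 ?_ ?_ ?_ <;> simp [shA]
  · rintro s z ⟨h1, h2⟩ S -
    obtain rfl | rfl := finset_fin_one S
    · exact h1
    · exact (poly (Fin 1)).fil_congr h2 (by simp [shA])
  · exact fun z => inner_diag 0 _
  · exact fun z => ⟨0, map_zero _⟩
  · exact fun f => (congrArg unknotProj (inner_diag 0 f)).trans (map_zero unknotProj)
  · exact fun f _ => map_zero unknotProj
  · exact fun z => rfl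
  · intro f _ _
    refine ⟨0, 0, map_zero _, (sub_eq_zero.mpr (unknotIncl_proj f).symm).trans ?_⟩
    exact (add_zero _).symm.trans (congrArg₂ (· + ·) (map_zero (BimodComplex.diag 0).inner).symm
      (map_zero (BimodComplex.diag 0).outer).symm)

end BimodComplex

namespace FTVect

variable {V : FTVect} {ι κ : Type}

/-- The degrees of the sum of a space and its shift by `𝐚𝐪²`. -/
def doubleDegree (d : ι → Shift) : ι ⊕ ι → Shift := Sum.elim d fun i => d i + shA

lemma HasDegrees.double {d : ι → Shift} (h : V.HasDegrees d) :
    (V.sum (V.shift shA)).HasDegrees (doubleDegree d) := h.sum (h.shift shA)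

/-- The degrees of `H3unknot`. -/
def unknotDegree (i : ℕ ⊕ ℕ) : Shift := doubleDegree powDegree i + (0 + 1) • shTS

lemma hasDegrees_unknot : H3unknot.HasDegrees unknotDegree :=
  (HasDegrees.of_isomorphic BimodComplex.outerHomology_diag_zero
    (hasDegrees_poly_of_unique (Fin 1)).double).shift _

/-- The degrees of `FTVect.oddClasses` of a polynomial algebra in one variable. -/
def oddDegree (c : Shift) (n : ℕ) (i : Σ _ : Fin n, ℕ) : Shift :=
  powDegree i.2 + (c + (shT + (2 * i.1 + 1 : ℕ) • shTot))

/-- The degrees of `FTVect.evenClasses` of a polynomial algebra in one variable. -/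
def evenDegree (c : Shift) (n : ℕ) : ℕ ⊕ (Σ _ : Fin n, ℕ) → Shift :=
  Sum.elim (fun i => powDegree i + (c + (0 : ℕ) • shTot))
    fun i => powDegree i.2 + (c + (2 * i.1 + 2 : ℕ) • shTot)

lemma hasDegrees_oddClasses (c : Shift) (n : ℕ) :
    ((poly (Fin 1)).oddClasses c n).HasDegrees (oddDegree c n) :=
  HasDegrees.finSum
    (V := fun k : Fin n => (poly (Fin 1)).shift (c + (shT + (2 * k + 1 : ℕ) • shTot)))
    (d := fun k i => powDegree i + (c + (shT + (2 * k + 1 : ℕ) • shTot)))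
    fun _ => (hasDegrees_poly_of_unique (Fin 1)).shift _

lemma hasDegrees_evenClasses (c : Shift) (n : ℕ) :
    ((poly (Fin 1)).evenClasses c n).HasDegrees (evenDegree c n) :=
  ((hasDegrees_poly_of_unique (Fin 1)).shift _).sum
    (HasDegrees.finSum
      (V := fun k : Fin n => (poly (Fin 1)).shift (c + (2 * k + 2 : ℕ) • shTot))
      (d := fun k i => powDegree i + (c + (2 * k + 2 : ℕ) • shTot))
      fun _ => (hasDegrees_poly_of_unique (Fin 1)).shift _)

/-- The degrees of the homology of a closure in terms of those of the homology on the cokernel and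
the kernel of the difference of the left and right operators. -/
def closureDegree (d : ι → Shift) (d' : κ → Shift) (i : (ι ⊕ κ) ⊕ (ι ⊕ κ)) : Shift :=
  doubleDegree (Sum.elim d fun i => d' i + shA) i + (1 + 1) • shTS

lemma hasDegrees_torus {m : ℕ} {Zc Zk : FTVect} (D : (torusWord m).toOp.HomologyData Zc Zk)
    {d : ι → Shift} {d' : κ → Shift} (hc : Zc.HasDegrees d) (hk : Zk.HasDegrees d') :
    (H3torus m).HasDegrees (closureDegree d d') :=
  (HasDegrees.of_isomorphic (BimodComplex.outerHomology_isomorphic (torusWord_central m) D)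
    (hc.sum (hk.shift shA)).double).shift _

lemma hasDegrees_torus_odd (n : ℕ) : (H3torus (2 * n + 1)).HasDegrees
    (closureDegree (oddDegree (torusShift (2 * n + 1)) n)
      (evenDegree (torusShift (2 * n + 1)) n)) :=
  hasDegrees_torus ((PolyAlg.divisionData.homologyDataOdd _ n).comp (retractTorusWord (2 * n + 1)))
    (hasDegrees_oddClasses _ n) (hasDegrees_evenClasses _ n)

/-- The degrees of the last classes of an even word. -/
def lastDegree (c : Shift) (n : ℕ) (i : ℕ × ℕ) : Shift :=
  powDegree i.1 + powDegree i.2 + (c + (2 * n + 2 : ℕ) • shTot)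

lemma hasDegrees_torus_even (n : ℕ) : (H3torus (2 * n + 2)).HasDegrees
    (closureDegree
      (Sum.elim (oddDegree (torusShift (2 * n + 2)) (n + 1)) (lastDegree (torusShift (2 * n + 2)) n))
      (Sum.elim (evenDegree (torusShift (2 * n + 2)) n)
        (lastDegree (torusShift (2 * n + 2)) n))) :=
  hasDegrees_torus ((PolyAlg.divisionData.homologyDataEven _ n).comp (retractTorusWord (2 * n + 2)))
    ((hasDegrees_oddClasses _ (n + 1)).sum (hasDegrees_poly_fin_two.shift _))
    ((hasDegrees_evenClasses _ n).sum (hasDegrees_poly_fin_two.shift _))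

/-- The correspondence of the classes of an odd word. -/
def oddEquiv (n : ℕ) : ℕ × (Unit ⊕ (Σ _ : Fin n, Unit ⊕ Unit)) ≃
    (Σ _ : Fin n, ℕ) ⊕ (ℕ ⊕ (Σ _ : Fin n, ℕ)) where
  toFun
    | (i, .inl _) => .inr (.inl i)
    | (i, .inr ⟨k, .inl _⟩) => .inr (.inr ⟨k, i⟩)
    | (i, .inr ⟨k, .inr _⟩) => .inl ⟨k, i⟩
  invFun
    | .inr (.inl i) => (i, .inl ())
    | .inr (.inr ⟨k, i⟩) => (i, .inr ⟨k, .inl ()⟩)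
    | .inl ⟨k, i⟩ => (i, .inr ⟨k, .inr ()⟩)
  left_inv := by rintro ⟨i, _ | ⟨k, _ | _⟩⟩ <;> rfl
  right_inv := by rintro (⟨k, i⟩ | i | ⟨k, i⟩) <;> rfl

/-- The correspondence of the classes of an even word. -/
def evenEquiv (n : ℕ) :
    ((Σ _ : Fin n, ℕ) ⊕ (ℕ ⊕ (Σ _ : Fin n, ℕ))) ⊕ (ℕ × ((ℕ ⊕ ℕ) ⊕ Unit)) ≃
    ((Σ _ : Fin (n + 1), ℕ) ⊕ (ℕ × ℕ)) ⊕ ((ℕ ⊕ (Σ _ : Fin n, ℕ)) ⊕ (ℕ × ℕ)) where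
  toFun
    | .inl (.inl ⟨k, i⟩) => .inl (.inl ⟨k.castSucc, i⟩)
    | .inl (.inr x) => .inr (.inl x)
    | .inr (i, .inl (.inl j)) => .inr (.inr (i, j))
    | .inr (i, .inl (.inr j)) => .inl (.inr (i, j))
    -- Compared with the word with one crossing less, the even word has one new odd class, and one
    -- new copy of the two-variable polynomials in each of the cokernel and the kernel.
    | .inr (i, .inr _) => .inl (.inl ⟨Fin.last n, i⟩)
  invFun
    | .inl (.inl ⟨k, i⟩) =>
      Fin.lastCases (.inr (i, .inr ())) (fun k => .inl (.inl ⟨k, i⟩)) k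
    | .inl (.inr (i, j)) => .inr (i, .inl (.inr j))
    | .inr (.inl x) => .inl (.inr x)
    | .inr (.inr (i, j)) => .inr (i, .inl (.inl j))
  left_inv := by rintro ((⟨k, i⟩ | x) | ⟨i, (j | j) | _⟩) <;> simp
  right_inv := by
    rintro ((⟨k, i⟩ | ⟨i, j⟩) | x | ⟨i, j⟩)
    · cases k using Fin.lastCases <;> simp
    all_goals rfl

theorem HasDegrees.isomorphic_of_symm {W : FTVect} {d : ι → Shift} {d' : κ → Shift}
    (hV : V.HasDegrees d) (hW : W.HasDegrees d') (e : κ ≃ ι) (h : ∀ i, d (e i) = d' i) :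
    V.Isomorphic W :=
  hV.isomorphic hW e.symm fun i => by rw [← h, e.apply_symm_apply]

/-- The kernel classes carry one `𝐚𝐪²` from the Koszul complex, which together with one `𝐮` absorbs
one of the `2n + 1` inverse shifts. The cokernel classes lack it, whence `𝐚_q⁻¹`; the kernel class
of index `2k + 2` gives the summand with `𝐬_q`, as `𝐭_tot = 𝐭_a 𝐬_q`. -/
theorem torus_odd_isomorphic (n : ℕ) : (H3torus (2 * n + 1)).Isomorphic
    ((H3unknot.shift (-(2 * n : ℤ) • (shTS + shA))).tensor
      (FTVect.rat.sum
        ((FTVect.finSum fun k : Fin n =>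
          ((FTVect.rat.shift shS).sum (FTVect.rat.shift (-shA))).shift
            ((2 * (k : ℤ) + 1) • shTot)).shift shT))) := by
  refine (hasDegrees_torus_odd n).isomorphic_of_symm ((hasDegrees_unknot.shift _).tensor
    (hasDegrees_rat.sum ((HasDegrees.finSum
      (V := fun k : Fin n => ((FTVect.rat.shift shS).sum (FTVect.rat.shift (-shA))).shift
            ((2 * (k : ℤ) + 1) • shTot))
      (d := fun k i => Sum.elim (fun _ : Unit => (0 : Shift) + shS) (fun _ : Unit => 0 + -shA) i
        + ((2 * (k : ℤ) + 1) • shTot))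
      fun k => ((hasDegrees_rat.shift _).sum (hasDegrees_rat.shift _)).shift _).shift _)))
    ((Equiv.sumProdDistrib ℕ ℕ _).trans (Equiv.sumCongr (oddEquiv n) (oddEquiv n))) ?_
  rintro ⟨i | i, _ | ⟨k, _ | _⟩⟩
  all_goals
    simp [closureDegree, doubleDegree, oddDegree, evenDegree, oddEquiv, unknotDegree,
      torusShift_eq, powDegree, shA, shS, shT, shTS, shTot]
    try ring_nf
    try simp

/-- All but the last classes are those of the odd word, shifted by the additional crossing. For the
others, `𝐭_tot = 𝐮² 𝐚_q` turns the power `2n + 1` of `𝐭_tot` and the negative powers of the crossing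
shift into `𝐮^(2n+1) 𝐚_q⁻¹`, up to the unknot factor. -/
theorem torus_even_isomorphic (n : ℕ) : (H3torus (2 * n + 2)).Isomorphic
    (((H3torus (2 * n + 1)).shift (-(shTS + shA))).sum
      ((H3unknot.shift ((2 * ((n + 1 : ℕ) : ℤ) - 1) • shTS - shA + shT)).tensor
        (((FTVect.ratZ.shift (shA + shS)).sum (FTVect.ratZ.shift shS)).sum FTVect.rat))) := by
  have hz : FTVect.ratZ.HasDegrees powDegree := hasDegrees_poly_of_unique Unit
  refine (hasDegrees_torus_even n).isomorphic_of_symm (((hasDegrees_torus_odd n).shift _).sum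
    ((hasDegrees_unknot.shift _).tensor
      (((hz.shift _).sum (hz.shift _)).sum hasDegrees_rat)))
    ((Equiv.sumCongr (Equiv.refl _) (Equiv.sumProdDistrib ℕ ℕ _)).trans
      ((Equiv.sumSumSumComm _ _ _ _).trans (Equiv.sumCongr (evenEquiv n) (evenEquiv n)))) ?_
  rintro (((⟨k, i⟩ | i | ⟨k, i⟩) | (⟨k, i⟩ | i | ⟨k, i⟩)) | ⟨i | i, (j | j) | _⟩)
  all_goals
    simp [closureDegree, doubleDegree, oddDegree, evenDegree, lastDegree, evenEquiv, unknotDegree,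
      torusShift_eq, powDegree, shA, shS, shT, shTS, shTot]
    try ring_nf
    try simp

end FTVect

end

theorem mainTheorem4 :
    (∀ n : ℕ,
      (H3torus (2 * n + 1)).Isomorphic
        ((H3unknot.shift (-(2 * n : ℤ) • (shTS + shA))).tensor
          (FTVect.rat.sum
            ((FTVect.finSum fun k : Fin n =>
              ((FTVect.rat.shift shS).sum (FTVect.rat.shift (-shA))).shift
                ((2 * (k : ℤ) + 1) • shTot)).shift shT)))) ∧
    (∀ n : ℕ, 1 ≤ n →
      (H3torus (2 * n)).Isomorphic
        (((H3torus (2 * n - 1)).shift (-(shTS + shA))).sum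
          ((H3unknot.shift ((2 * (n : ℤ) - 1) • shTS - shA + shT)).tensor
            (((FTVect.ratZ.shift (shA + shS)).sum (FTVect.ratZ.shift shS)).sum
              FTVect.rat)))) := by
  refine ⟨FTVect.torus_odd_isomorphic, fun n hn => ?_⟩
  -- Writing `n + 1` for `n` turns `2 * n - 1` into `2 * n + 1` and removes the truncated
  -- subtraction.
  obtain ⟨n, rfl⟩ := Nat.exists_eq_add_of_le' hn
  exact FTVect.torus_even_isomorphic n
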